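/- **Setting.** Let $\mathfrak g$ be a finite-dimensional simple complex Lie algebra of classical type ($A_n,B_n,C_n,D_n$) or of type $G_2$, with a Cartan subalgebra $\mathfrak h$, a choice of simple roots, and highest root $\theta$. Let $(\ ,\ )$ be the form on $\mathfrak h^*$ induced by the Killing form and normalized by $(\theta,\theta)=2$, let $g^*$ be the dual Coxeter number, let $k\ge 0$ be an integer and $\kappa=k+g^*$. Let $\lambda_1,\dots,\lambda_N$ be dominant integral weights with $(\lambda_j,\theta)\le k$, and let $\beta(1),\dots,\beta(M)$ ($M\ge 1$) be simple roots with $\sum_{j=1}^N\lambda_j=\sum_{a=1}^M\beta(a)$. Let $z_1,\dots,z_N\in\mathbb C$ be distinct and $$X_{\vec z}=\{(t_1,\dots,t_M)\in\mathbb C^M : t_a\ne t_b \ (a\neq b),\ t_a\ne z_j\},$$ $$\mathcal R=\prod_{i<j}(z_i-z_j)^{-(\lambda_i,\lambda_j)/\kappa}\prod_{a,j}(t_a-z_j)^{(\lambda_j,\beta(a))/\kappa}\prod_{a<b}(t_a-t_b)^{-(\beta(a),\beta(b))/\kappa}.$$ Let $\Omega=Q\,dt_1\wedge\dots\wedge dt_M$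 with $Q$ a regular (algebraic) function on $X_{\vec z}$ that is invariant under all permutations $\sigma$ of the variables such that $\beta(\sigma(a))=\beta(a)$ for all $a$. Assume that $\mathcal R\Omega$ is square integrable, that is, $\int_{X_{\vec z}}|\mathcal R|^2|Q|^2<\infty$ for Lebesgue measure (the absolute value $|\mathcal R|$ is single valued). For a form with at most a simple pole along $t_a=t_1$, written near its generic point as $\Omega'\wedge\frac{d(t_a-t_1)}{t_a-t_1}$, let $\mathrm{Res}_{t_a=t_1}$ denote its Poincaré residue $\Omega'|_{t_a=t_1}$, a form in the variables other than $t_a$. For $1\le\ell\le M$ consider the iterated residue $$\mathrm{Res}_{\vec T}\,\Omega=\mathrm{Res}_{t_\ell=t_1}\mathrm{Res}_{t_{\ell-1}=t_1}\cdots\mathrm{Res}_{t_2=t_1}\Omega,$$ a form in $t_1,t_{\ell+1},\dots,t_M$ (equal to $\Omega$ if $\ell=1$). **Theorem 7.2.** If $\mathrm{Res}_{\vec T}\,\Omega$ is (defined and) nonzero, then 1. $\beta(1)+\dots+\beta(\ell)$ is a positive root; 2. $\mathrm{Res}_{\vec T}\,\Omega$ has at most a simple pole along $t_1=t_p$ for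 every $p>\ell$; 3. $\mathrm{Res}_{\vec T}\,\Omega$ has at most a simple pole along $t_1=z_j$ for every $j=1,\dots,N$. -/

import Mathlib

open MeasureTheory LieAlgebra.IsKilling Module

noncomputable section

namespace ConfPoles

/-! ### Lie-theoretic data -/

section Lie

variable {𝔤 : Type*} [LieRing 𝔤] [LieAlgebra ℂ 𝔤] [FiniteDimensional ℂ 𝔤]
  [LieAlgebra.IsSimple ℂ 𝔤] (H : LieSubalgebra ℂ 𝔤) [H.IsCartanSubalgebra]

/-- The simple Lie algebra has Dynkin type `A_n`, `B_n`, `C_n`, `D_n` (classical) or `G₂`: its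
Cartan matrix, for the chosen simple roots and some numbering of them, is the standard one. -/
def IsClassicalOrG2 (b : (rootSystem H).Base) : Prop :=
  (∃ (n : ℕ) (e : b.support ≃ Fin n),
      b.cartanMatrix.reindex e e = CartanMatrix.A n ∨
      b.cartanMatrix.reindex e e = CartanMatrix.B n ∨
      b.cartanMatrix.reindex e e = CartanMatrix.C n ∨
      b.cartanMatrix.reindex e e = CartanMatrix.D n) ∨
  ∃ e : b.support ≃ Fin 2, b.cartanMatrix.reindex e e = CartanMatrix.G₂

/-- The bilinear form on `𝔥*` induced by the Killing form: `x (h_y)`, where `h_y ∈ 𝔥` is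
determined by `Killing (h_y, h) = y h` for all `h ∈ 𝔥`. -/
def killingDual (x y : Dual ℂ H) : ℂ := x ((cartanEquivDual H).symm y)

/-- `θ` is the highest root: `θ - γ` is a sum of simple roots for every root `γ`. -/
def IsHighestRoot (b : (rootSystem H).Base) (θ : H.root) : Prop :=
  ∀ γ : H.root, (rootSystem H).root θ - (rootSystem H).root γ ∈
    AddSubmonoid.closure ((rootSystem H).root '' b.support)

/-- The Killing form on `𝔥*`, normalized so that `(θ, θ) = 2`. It takes rational values on
integral weights, which is all it is used on; hence the real part. -/
def normForm (θ : H.root) (x y : Dual ℂ H) : ℝ :=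
  (2 * killingDual H x y /
    killingDual H ((rootSystem H).root θ) ((rootSystem H).root θ)).re

open Classical in
/-- The dual Coxeter number `g* = 1 + ρ(θ^∨)`, with `ρ` half the sum of the positive roots. -/
def dualCoxeter (b : (rootSystem H).Base) (θ : H.root) : ℝ :=
  1 + (∑ γ : H.root with b.IsPos γ, ((rootSystem H).pairingIn ℤ γ θ : ℝ)) / 2

/-- Dominant integral weights of level `k`: `λ(α^∨) ∈ ℕ` for each simple root `α`, and
`(λ, θ) ≤ k`. -/
def levelWeights (b : (rootSystem H).Base) (θ : H.root) (k : ℕ) : Set (Dual ℂ H) :=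
  {lam | (∀ i ∈ b.support, ∃ m : ℕ, lam ((rootSystem H).coroot i) = m) ∧
    normForm H θ lam ((rootSystem H).root θ) ≤ k}

end Lie

/-! ### The configuration space, the master function, top degree forms -/

section Forms

variable {M N : ℕ}

/-- The configuration space `X_z`. -/
def confSpace (M : ℕ) (z : Fin N → ℂ) : Set (Fin M → ℂ) :=
  {t | (∀ a b, a ≠ b → t a ≠ t b) ∧ ∀ a j, t a ≠ z j}

/-- The absolute value of the (multivalued) master function, whose exponents are real. Here `B` is
the bilinear form, `lam j` the weight at `z j`, and `α a` the simple root attached to `t a`. -/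
def masterAbs {V : Type*} (B : V → V → ℝ) (κ : ℝ) (lam : Fin N → V) (α : Fin M → V)
    (z : Fin N → ℂ) (t : Fin M → ℂ) : ℝ :=
  (∏ i : Fin N, ∏ j ∈ Finset.Ioi i, ‖z i - z j‖ ^ (-B (lam i) (lam j) / κ)) *
  (∏ a : Fin M, ∏ j : Fin N, ‖t a - z j‖ ^ (B (lam j) (α a) / κ)) *
  ∏ a : Fin M, ∏ c ∈ Finset.Ioi a, ‖t a - t c‖ ^ (-B (α a) (α c) / κ)

/-- The polynomial `∏_{a<c} (t_a - t_c) ∏_{a,j} (t_a - z_j)`, whose non-vanishing locus is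
`X_z`. -/
def discr (M : ℕ) (z : Fin N → ℂ) : MvPolynomial (Fin M) ℂ :=
  (∏ a : Fin M, ∏ c ∈ Finset.Ioi a, (MvPolynomial.X a - MvPolynomial.X c)) *
  ∏ a : Fin M, ∏ j : Fin N, (MvPolynomial.X a - MvPolynomial.C (z j))

/-- The field of rational functions in `t_1, …, t_M`. -/
abbrev RatFun (M : ℕ) : Type := FractionRing (MvPolynomial (Fin M) ℂ)

/-- The inclusion of polynomials in rational functions. -/
abbrev toRat (F : MvPolynomial (Fin M) ℂ) : RatFun M := algebraMap _ (RatFun M) F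

/-- The regular functions on `X_z` are the `Q = F / discr ^ n`, with `F` a polynomial and `n ∈ ℕ`.
This is `Q` as a rational function; it stands for the form `Ω = Q dt_1 ∧ ⋯ ∧ dt_M`. -/
def coeffRat (z : Fin N → ℂ) (F : MvPolynomial (Fin M) ℂ) (n : ℕ) : RatFun M :=
  toRat F / toRat (discr M z) ^ n

/-- The same `Q = F / discr ^ n`, as a function on `X_z`. -/
def coeffFun (z : Fin N → ℂ) (F : MvPolynomial (Fin M) ℂ) (n : ℕ) (t : Fin M → ℂ) : ℂ :=
  MvPolynomial.eval t F / MvPolynomial.eval t (discr M z) ^ n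

/-- `∫_{X_z} |R|² |Q|² < ∞`, that is, `R Ω` is square integrable on `X_z`. -/
def IsSquareIntegrable (R : (Fin M → ℂ) → ℝ) (z : Fin N → ℂ) (F : MvPolynomial (Fin M) ℂ)
    (n : ℕ) : Prop :=
  IntegrableOn (fun t => (R t * ‖coeffFun z F n t‖) ^ 2) (confSpace M z) volume

/-! ### Poles and residues -/

/-- `Q` is regular at the generic point of the divisor `f = 0` (for `f` irreducible): it can be
written with a denominator that is not divisible by `f`. -/
def RegularAlong (f : MvPolynomial (Fin M) ℂ) (Q : RatFun M) : Prop :=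
  ∃ g h : MvPolynomial (Fin M) ℂ, ¬ f ∣ h ∧ Q = toRat g / toRat h

/-- `Q` has at most a simple pole along `f = 0` (for `f` irreducible). -/
def AtMostSimplePole (f : MvPolynomial (Fin M) ℂ) (Q : RatFun M) : Prop :=
  RegularAlong f (toRat f * Q)

/-- The substitution `t_a ↦ t_c` in polynomials. -/
def substPoly (a c : Fin M) : MvPolynomial (Fin M) ℂ →ₐ[ℂ] MvPolynomial (Fin M) ℂ :=
  MvPolynomial.aeval (fun i => if i = a then MvPolynomial.X c else MvPolynomial.X i)

/-- The restriction of a rational function to the diagonal `t_a = t_c`, which is parametrized by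
the variables other than `t_a`; the function is written in lowest terms first. If it is not
regular along the diagonal, the denominator restricts to zero and the value is `0`. -/
def restrictDiag (a c : Fin M) (Q : RatFun M) : RatFun M :=
  toRat (substPoly a c (IsFractionRing.num (MvPolynomial (Fin M) ℂ) Q)) /
    toRat (substPoly a c (IsFractionRing.den (MvPolynomial (Fin M) ℂ) Q :
      MvPolynomial (Fin M) ℂ))

open Classical in
/-- The coefficient of the Poincaré residue `Res_{t_a = t_c}` of the form with coefficient `Q`, in
variables (in increasing order) among which are `t_a`, `t_c` and all the `t_i` with `i > a`. If
`Ω = Ω' ∧ d(t_a - t_c) / (t_a - t_c)` then the residue is `Ω'` restricted to `t_a = t_c`; the sign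
comes from moving `dt_a` past the later differentials. The residue is defined for at most simple
poles only; in the other case the value here is `0`. -/
def residue (a c : Fin M) (Q : RatFun M) : RatFun M :=
  if AtMostSimplePole (MvPolynomial.X a - MvPolynomial.X c) Q then
    (-1) ^ (M - 1 - (a : ℕ)) *
      restrictDiag a c (toRat (MvPolynomial.X a - MvPolynomial.X c) * Q)
  else 0

/-- The iterated residue `Res_{t_ℓ = t_1} ⋯ Res_{t_2 = t_1}` for `1 ≤ ℓ ≤ M` (no residue is taken
if `ℓ = 1`); it is a rational function of `t_1, t_{ℓ+1}, …, t_M`. The variables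
`t_1, t_2, …, t_M` have the indices `0, 1, …, M - 1` in `Fin M`. -/
def iterRes [NeZero M] (Q : RatFun M) : ℕ → RatFun M
  | 0 => Q
  | 1 => Q
  | ℓ + 2 => residue (Fin.ofNat M (ℓ + 1)) 0 (iterRes Q (ℓ + 1))

end Forms

end ConfPoles

end

/-! Call logarithmic order of Ω along the diagonal of a set A of variables the order of Q there plus
|A| - 1. Each residue raises the order of the coefficient by at least one (`OrderGE.residue`). Hence
logarithmic order at least 1 along t_1 = ... = t_ℓ makes the iterated residue vanish, and
logarithmic order at least 0 along t_1 = ... = t_ℓ = t_p leaves at most a simple pole along t_1 =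
t_p.

Square integrability bounds these orders from below. Contracting a ball towards the diagonal of A
shows that the logarithmic order exceeds s(A)/κ, where s(A) is the sum of (β(a), β(c)) over the
pairs in A; there is a similar bound at z_j (`order_diag`, `order_point`). If w is the sum of the
β(a), then 2 s(A) = (w, w) - Σ (β(a), β(a)), and (w, w) > 0. If w is a root, then Σ (β(a), β(a)) / 2
= (ρ, w) ≤ (ρ, θ) = g* - 1, and one more simple root adds at most 1 because θ is long. So s(A) > -g*
≥ -κ for "light" sets, those with half length sum at most g*, and their logarithmic order is at
least 0. This gives the second claim; the third follows in the same way from (λ_j, w) ≤ k.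

The first claim goes by induction on ℓ. If the first ℓ simple roots add up to a root, then the first
ℓ + 1 variables form a light set, and it remains to see that a light set whose weight w is not a
root has logarithmic order at least 1 (`logOrderGE_one_of_not_root`). For s(A) ≥ 0 this is
integrability. Otherwise take a simple root α in A with k = w(α^∨) > 0. Removing any k variables
with root α leaves the weight s_α w, again not a root, so by induction the logarithmic order is at
least 1 along these smaller diagonals.

Now divide F by the powers of t_a - t_b that are forced and consider the leading term along A as a
function of the set S of variables with root α, the variables y in the set Y of neighbours of α
being nodes. It is symmetric, of degree less than |Y| in each variable, it vanishes when p_y + 1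
variables meet the node y, where p_y = -β(y)(α^∨), and its top coefficient in any k variables is
zero. Lagrange interpolation turns it into a vector in a tensor product of irreducible sl₂-modules
with highest weights p_y, and the top coefficients in k variables into the k-th power of the
lowering operator. As 2|S| = Σ p_y + k, this power is injective by hard Lefschetz, and the leading
term is zero (`eq_zero_of_wheel`, `logOrderGE_one_of_reflection`). -/

namespace ConfPoles

/-! ### Lowering and raising operators on tensor products of irreducible `sl₂`-modules -/

section StringOperators

variable {J : Type*} [Fintype J] [DecidableEq J]

/-- The lowering operator on functions of multi-indices. -/
def lowerOp (φ : (J → ℕ) → ℂ) : (J → ℕ) → ℂ := fun a => ∑ j, φ (a + Pi.single j 1)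

/-- The raising operator on functions of multi-indices bounded by `p`. -/
def raiseOp (p : J → ℕ) (φ : (J → ℕ) → ℂ) : (J → ℕ) → ℂ :=
  fun a => ∑ j, (a j : ℂ) * (p j + 1 - a j) * φ (a - Pi.single j 1)

/-- The functions supported on multi-indices of degree `r` bounded by `p`. -/
def IsWeightVector (p : J → ℕ) (r : ℤ) (φ : (J → ℕ) → ℂ) : Prop :=
  ∀ a, φ a ≠ 0 → (∀ j, a j ≤ p j) ∧ ∑ j, (a j : ℤ) = r

lemma lowerOp_add (φ ψ : (J → ℕ) → ℂ) : lowerOp (φ + ψ) = lowerOp φ + lowerOp ψ := by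
  funext a; simp [lowerOp, Finset.sum_add_distrib]

lemma lowerOp_smul (c : ℂ) (φ : (J → ℕ) → ℂ) : lowerOp (c • φ) = c • lowerOp φ := by
  funext a; simp [lowerOp, Finset.mul_sum]

lemma lowerOp_zero : lowerOp (0 : (J → ℕ) → ℂ) = 0 := by
  funext a; simp [lowerOp]

lemma raiseOp_zero (p : J → ℕ) : raiseOp p (0 : (J → ℕ) → ℂ) = 0 := by
  funext a; simp [raiseOp]

lemma sum_add_single (a : J → ℕ) (j : J) :
    ∑ i, ((a + Pi.single j 1 : J → ℕ) i : ℤ) = ∑ i, (a i : ℤ) + 1 := by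
  simp [Finset.sum_add_distrib, Pi.single_apply]

lemma IsWeightVector.lowerOp {p : J → ℕ} {r : ℤ} {φ : (J → ℕ) → ℂ} (h : IsWeightVector p r φ) :
    IsWeightVector p (r - 1) (lowerOp φ) := by
  intro a ha
  obtain ⟨j, -, hj⟩ := Finset.exists_ne_zero_of_sum_ne_zero ha
  obtain ⟨h1, h2⟩ := h _ hj
  refine ⟨fun i => le_trans ?_ (h1 i), ?_⟩
  · simp
  · rw [sum_add_single] at h2; linarith

lemma IsWeightVector.raiseOp {p : J → ℕ} {r : ℤ} {φ : (J → ℕ) → ℂ} (h : IsWeightVector p r φ) :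
    IsWeightVector p (r + 1) (raiseOp p φ) := by
  intro a ha
  obtain ⟨j, -, hj⟩ := Finset.exists_ne_zero_of_sum_ne_zero ha
  obtain ⟨h1, h2⟩ := h _ (right_ne_zero_of_mul hj)
  have hc := left_ne_zero_of_mul hj
  have h0 : a j ≠ 0 := fun h0 => hc (by simp [h0])
  have h3 : a j ≠ p j + 1 := fun h0 => hc (by simp [h0])
  have hadd : (a - Pi.single j 1) + Pi.single j 1 = a := by
    funext i
    by_cases hi : i = j
    · subst hi; simp; omega
    · simp [hi]
  refine ⟨fun i => ?_, ?_⟩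
  · have := h1 i
    by_cases hi : i = j
    · subst hi; simp at this; omega
    · simpa [hi] using this
  · rw [← hadd, sum_add_single, h2]

/-- The `sl₂` relation. Terms with i ≠ j cancel in the commutator, and in one factor (a + 1)(p - a)
- a(p + 1 - a) = p - 2a; these add up to the weight. -/
lemma lowerOp_raiseOp {p : J → ℕ} {r : ℤ} {φ : (J → ℕ) → ℂ} (h : IsWeightVector p r φ) :
    lowerOp (raiseOp p φ) = raiseOp p (lowerOp φ) + (((∑ j, (p j : ℤ)) - 2 * r : ℤ) : ℂ) • φ := by
  funext a
  have key : ∀ i j, (((a + Pi.single i 1 : J → ℕ) j : ℂ) * (p j + 1 - (a + Pi.single i 1 : J → ℕ) j)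
      * φ (a + Pi.single i 1 - Pi.single j 1)) =
      (a j : ℂ) * (p j + 1 - a j) * φ (a - Pi.single j 1 + Pi.single i 1) +
      if i = j then ((p j : ℂ) - 2 * a j) * φ a else 0 := by
    intro i j
    by_cases hij : i = j
    · subst hij
      have h1 : a + Pi.single i 1 - Pi.single i 1 = a := by funext l; simp
      -- Natural subtraction is undone by addition only if a i ≠ 0; otherwise the coefficient a i
      -- kills the term.
      by_cases h0 : a i = 0
      · simp [h1, h0]
      · have h2 : a - Pi.single i 1 + Pi.single i 1 = a := by
          funext l
          by_cases hl : l = i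
          · subst hl; simp; omega
          · simp [hl]
        rw [h1, h2]; simp; ring
    · by_cases h0 : a j = 0
      · simp [hij, Ne.symm hij, h0]
      · have h2 : a + Pi.single i 1 - Pi.single j 1 = a - Pi.single j 1 + Pi.single i 1 := by
          funext l
          by_cases hl : l = j
          · subst hl; simp [Ne.symm hij]
          · simp [hl]
        rw [h2]; simp [hij, Ne.symm hij]
  simp only [lowerOp, raiseOp, key, Finset.sum_add_distrib]
  rw [Pi.add_apply, Pi.smul_apply]
  congr 1
  · rw [Finset.sum_comm]
    exact Finset.sum_congr rfl fun j _ => (Finset.mul_sum _ _ _).symm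
  · simp only [Finset.sum_ite_eq, Finset.mem_univ, if_true, ← Finset.sum_mul, smul_eq_mul]
    by_cases ha : φ a = 0
    · simp [ha]
    · rw [← (h a ha).2]; push_cast
      rw [Finset.sum_sub_distrib, Finset.mul_sum]

lemma IsWeightVector.iterate_lowerOp {p : J → ℕ} {r : ℤ} {φ : (J → ℕ) → ℂ}
    (h : IsWeightVector p r φ) (i : ℕ) : IsWeightVector p (r - i) (ConfPoles.lowerOp^[i] φ) := by
  induction i with
  | zero => simpa using h
  | succ i ih =>
    rw [Function.iterate_succ_apply']
    convert ih.lowerOp using 1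
    push_cast; ring

/-- The commutators met on the way contribute the weights Σ p - 2(r - l) for l = 0, ..., i, whose
sum is the scalar displayed. -/
lemma iterate_lowerOp_raiseOp {p : J → ℕ} {r : ℤ} {φ : (J → ℕ) → ℂ} (h : IsWeightVector p r φ)
    (i : ℕ) : lowerOp^[i + 1] (raiseOp p φ) = raiseOp p (lowerOp^[i + 1] φ) +
      (((i + 1 : ℤ) * ((∑ j, (p j : ℤ)) - 2 * r + i) : ℤ) : ℂ) • lowerOp^[i] φ := by
  induction i with
  | zero => simpa using lowerOp_raiseOp h
  | succ i ih =>
    rw [Function.iterate_succ_apply', ih, lowerOp_add, lowerOp_smul,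
      lowerOp_raiseOp (h.iterate_lowerOp (i + 1)), ← Function.iterate_succ_apply' lowerOp (i + 1),
      ← Function.iterate_succ_apply' lowerOp i, add_assoc, ← add_smul]
    congr 2
    push_cast; ring

/-- The injectivity half of the hard Lefschetz property for tensor products of irreducible
`sl₂`-modules. -/
theorem eq_zero_of_iterate_lowerOp_eq_zero {p : J → ℕ} (m : ℕ) :
    ∀ (r : ℤ) (φ : (J → ℕ) → ℂ) (j : ℕ), (∑ i, (p i : ℤ)) + 1 - r ≤ m → IsWeightVector p r φ →
      (j : ℤ) ≤ 2 * r - ∑ i, (p i : ℤ) → lowerOp^[j] φ = 0 → φ = 0 := by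
  induction m with
  | zero =>
    intro r φ j hr h _ _
    funext a
    by_contra ha
    obtain ⟨h1, h2⟩ := h a ha
    have : ∑ i, (a i : ℤ) ≤ ∑ i, (p i : ℤ) :=
      Finset.sum_le_sum fun i _ => by exact_mod_cast h1 i
    push_cast at hr; linarith
  | succ m ih =>
    intro r φ j hr h hj hφ
    -- Induction on the codegree: by the commutator formula the power j + 1 of the lowering operator
    -- kills the raised vector, which therefore vanishes.
    have hG : raiseOp p φ = 0 := by
      refine ih (r + 1) _ (j + 1) (by push_cast at hr; linarith) h.raiseOp
        (by push_cast; linarith) ?_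
      rw [iterate_lowerOp_raiseOp h, Function.iterate_succ_apply', hφ, lowerOp_zero, raiseOp_zero]
      simp
    clear hr ih
    -- Once φ is killed by raising, the formula reads 0 = (j + 1)(Σ p - 2r + j) times the j-th
    -- lowering of φ. The scalar is negative in the given range, so j can be decreased to 0.
    induction j with
    | zero => simpa using hφ
    | succ j ihj =>
      refine ihj (by push_cast at hj; linarith) ?_
      have h1 := iterate_lowerOp_raiseOp h j
      have h2 : lowerOp^[j + 1] (0 : (J → ℕ) → ℂ) = 0 := by
        clear * -
        induction j with
        | zero => simp [lowerOp_zero]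
        | succ j ih => rw [Function.iterate_succ_apply', ih, lowerOp_zero]
      rw [hG, hφ, raiseOp_zero, zero_add, h2] at h1
      refine (smul_eq_zero.mp h1.symm).resolve_left ?_
      push_cast at hj
      refine Int.cast_ne_zero.mpr ?_
      refine mul_ne_zero (by positivity) (by linarith)

lemma iterate_lowerOp_apply (k : ℕ) (φ : (J → ℕ) → ℂ) (a : J → ℕ) :
    lowerOp^[k] φ a = ∑ t : Fin k → J, φ (a + ∑ i, Pi.single (t i) 1) := by
  induction k generalizing φ a with
  | zero => simp
  | succ k ih =>
    rw [Function.iterate_succ_apply, ih]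
    simp only [lowerOp]
    rw [← (Fin.consEquiv (fun _ : Fin (k + 1) => J)).sum_comp, Fintype.sum_prod_type,
      Finset.sum_comm]
    refine Finset.sum_congr rfl fun j _ => Finset.sum_congr rfl fun t _ => ?_
    simp [Fin.consEquiv, Fin.sum_univ_succ, add_assoc, add_comm (Pi.single _ _)]

end StringOperators

/-! ### Interpolation of symmetric functions vanishing on wheels -/

section Interpolation

open Polynomial

variable {J : Type*} [Fintype J] [DecidableEq J]

/-- `g` is a polynomial of degree less than `q` in each of its variables. -/
def DegreeLtInEach {ι : Type*} [DecidableEq ι] (q : ℕ) (g : (ι → ℂ) → ℂ) : Prop :=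
  ∀ i x, ∃ P : ℂ[X], P.degree < q ∧ ∀ u, g (Function.update x i u) = P.eval u

/-- Lagrange interpolation one variable at a time: the tail by induction, then the first variable
for each tuple of nodes. -/
lemma eq_sum_lagrange {v : J → ℂ} (hv : Function.Injective v) (k : ℕ) :
    ∀ h : (Fin k → ℂ) → ℂ, DegreeLtInEach (Fintype.card J) h → ∀ w, h w =
      ∑ t : Fin k → J, (∏ i, (Lagrange.basis Finset.univ v (t i)).eval (w i)) * h (v ∘ t) := by
  induction k with
  | zero =>
    intro h _ w
    simp only [Finset.univ_unique, Finset.univ_eq_empty, Finset.prod_empty, one_mul,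
      Finset.sum_singleton]
    congr 1; exact Subsingleton.elim _ _
  | succ k ih =>
    intro h hh w
    obtain ⟨w0, w', rfl⟩ : ∃ w0 w', w = Fin.cons w0 w' := ⟨w 0, Fin.tail w, by simp⟩
    have h1 := ih (fun x => h (Fin.cons w0 x)) (fun i x => by
      obtain ⟨P, hP, hP'⟩ := hh i.succ (Fin.cons w0 x)
      exact ⟨P, hP, fun u => by rw [← hP' u, ← Fin.cons_update]⟩) w'
    rw [h1, ← (Fin.consEquiv (fun _ : Fin (k + 1) => J)).sum_comp, Fintype.sum_prod_type,
      Finset.sum_comm]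
    refine Finset.sum_congr rfl fun t _ => ?_
    obtain ⟨P, hP, hP'⟩ := hh 0 (Fin.cons w0 (v ∘ t))
    have h2 : h (Fin.cons w0 (v ∘ t)) =
        ∑ j, (Lagrange.basis Finset.univ v j).eval w0 * h (Fin.cons (v j) (v ∘ t)) := by
      have h3 : ∀ u, h (Fin.cons u (v ∘ t)) = P.eval u := fun u => by
        rw [← hP', Fin.update_cons_zero]
      simp only [h3]
      conv_lhs => rw [Lagrange.eq_interpolate (s := Finset.univ) hv.injOn (f := P) (by simpa using hP)]
      rw [Lagrange.interpolate_apply, eval_finsetSum]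
      exact Finset.sum_congr rfl fun j _ => by rw [eval_mul, eval_C, mul_comm]
    rw [h2, Finset.mul_sum]
    refine Finset.sum_congr rfl fun j _ => ?_
    have h4 : v ∘ (Fin.cons j t : Fin (k + 1) → J) = Fin.cons (v j) (v ∘ t) := by
      rw [Fin.comp_cons]
    rw [show (Fin.consEquiv fun _ : Fin (k + 1) => J) (j, t) = Fin.cons j t from rfl, h4]
    simp only [Fin.prod_univ_succ, Fin.cons_zero, Fin.cons_succ]
    ring

/-- The multi-index counting the values of a tuple. -/
def tupleCount {ι : Type*} [Fintype ι] (t : ι → J) : J → ℕ := ∑ i, Pi.single (t i) 1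

lemma tupleCount_apply {ι J : Type*} [Fintype ι] [DecidableEq J] (t : ι → J) (j : J) :
    tupleCount t j = (Finset.univ.filter fun i => t i = j).card := by
  rw [Finset.card_filter, tupleCount, Finset.sum_apply]
  exact Finset.sum_congr rfl fun i _ => by rw [Pi.single_apply]; simp [eq_comm]

lemma sum_tupleCount {ι : Type*} [Fintype ι] (t : ι → J) :
    ∑ j, tupleCount t j = Fintype.card ι := by
  simp only [tupleCount, Finset.sum_apply]
  rw [Finset.sum_comm]; simp

lemma exists_perm_of_tupleCount_eq {J : Type*} [DecidableEq J] {ι : Type*} [Fintype ι] {t t' : ι → J}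
    (h : tupleCount t = tupleCount t') : ∃ σ : Equiv.Perm ι, t' = t ∘ σ := by
  have hf : ∀ j, Nonempty ({i // t' i = j} ≃ {i // t i = j}) := fun j => by
    rw [← Fintype.card_eq, Fintype.card_subtype, Fintype.card_subtype, ← tupleCount_apply,
      ← tupleCount_apply, h]
  refine ⟨Equiv.ofFiberEquiv fun j => (hf j).some, ?_⟩
  funext i
  exact (Equiv.ofFiberEquiv_map _ i).symm

lemma exists_tupleCount_eq {s : ℕ} {a : J → ℕ} (ha : ∑ j, a j = s) :
    ∃ t : Fin s → J, tupleCount t = a := by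
  have e : Fin s ≃ Σ j, Fin (a j) := Fintype.equivOfCardEq (by simp [ha])
  refine ⟨fun i => (e i).1, funext fun j => ?_⟩
  rw [tupleCount_apply, ← Fintype.card_subtype]
  have e2 : {i // (e i).1 = j} ≃ {x : Σ j, Fin (a j) // x.1 = j} := e.subtypeEquiv fun _ => Iff.rfl
  rw [Fintype.card_congr (e2.trans (Equiv.sigmaSubtype j))]
  simp

/-- On the diagonal, interpolation writes P as a combination of products of k basis polynomials,
each of degree |J| - 1. The sum is its coefficient of degree k(|J| - 1). -/
lemma sum_top_coeff_eq_zero {v : J → ℂ} (hv : Function.Injective v) {k : ℕ}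
    (h : (Fin k → ℂ) → ℂ) (hh : DegreeLtInEach (Fintype.card J) h) (P : ℂ[X])
    (hP : P.coeff (k * (Fintype.card J - 1)) = 0) (hP' : ∀ u, h (fun _ => u) = P.eval u) :
    ∑ t : Fin k → J, (∏ i, (Lagrange.basis Finset.univ v (t i)).leadingCoeff) * h (v ∘ t) = 0 := by
  have hb : ∀ j : J, (Lagrange.basis Finset.univ v j).natDegree = Fintype.card J - 1 := fun j =>
    natDegree_eq_of_degree_eq_some (Lagrange.degree_basis hv.injOn (Finset.mem_univ j))
  have h1 : P = ∑ t : Fin k → J, (∏ i, Lagrange.basis Finset.univ v (t i)) * C (h (v ∘ t)) := by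
    refine Polynomial.funext fun u => ?_
    rw [← hP', eq_sum_lagrange hv k h hh, eval_finsetSum]
    simp [eval_prod]
  rw [h1, finsetSum_coeff] at hP
  rw [← hP]
  refine Finset.sum_congr rfl fun t _ => ?_
  rw [coeff_mul_C]
  congr 1
  have := coeff_prod_of_natDegree_le (s := Finset.univ)
    (f := fun i => Lagrange.basis Finset.univ v (t i)) (Fintype.card J - 1)
    (fun i _ => (hb _).le)
  rw [Finset.card_univ, Fintype.card_fin] at this
  rw [this]
  exact Finset.prod_congr rfl fun i _ => by rw [leadingCoeff, hb]

lemma basis_leadingCoeff_ne_zero {v : J → ℂ} (hv : Function.Injective v) (j : J) :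
    (Lagrange.basis Finset.univ v j).leadingCoeff ≠ 0 := by
  rw [leadingCoeff_ne_zero]
  exact Lagrange.basis_ne_zero hv.injOn (Finset.mem_univ j)

open Classical in
/-- The function of multi-indices which describes a symmetric function of tuples. -/
noncomputable def indexFun {r : ℕ} (ψ : (Fin r → J) → ℂ) (a : J → ℕ) : ℂ :=
  if h : ∃ t, tupleCount t = a then ψ h.choose else 0

lemma indexFun_tupleCount {r : ℕ} {ψ : (Fin r → J) → ℂ}
    (hψ : ∀ (σ : Equiv.Perm (Fin r)) t, ψ (t ∘ σ) = ψ t) (t : Fin r → J) :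
    indexFun ψ (tupleCount t) = ψ t := by
  have h : ∃ t', tupleCount t' = tupleCount t := ⟨t, rfl⟩
  rw [indexFun, dif_pos h]
  obtain ⟨σ, hσ⟩ := exists_perm_of_tupleCount_eq h.choose_spec
  conv_rhs => rw [hσ, hψ]

lemma exists_of_indexFun_ne_zero {r : ℕ} {ψ : (Fin r → J) → ℂ} {a : J → ℕ}
    (ha : indexFun ψ a ≠ 0) : ∃ t, tupleCount t = a ∧ ψ t ≠ 0 := by
  unfold indexFun at ha
  split_ifs at ha with h
  · exact ⟨_, h.choose_spec, ha⟩
  · exact absurd rfl ha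

/-- The values at tuples of nodes, weighted by the leading coefficients of the basis polynomials,
depend only on the multiplicities of the nodes. The wheel condition makes them a weight vector, and
the condition on leading coefficients says that the k-th power of the lowering operator kills it. -/
lemma eq_zero_of_wheel_fin {v : J → ℂ} (hv : Function.Injective v) (p : J → ℕ) {r k : ℕ}
    (hrk : 2 * r = ∑ j, p j + k) (g : (Fin r → ℂ) → ℂ) (hdeg : DegreeLtInEach (Fintype.card J) g)
    (hsymm : ∀ (σ : Equiv.Perm (Fin r)) x, g (x ∘ σ) = g x)
    (hwheel : ∀ j (S : Finset (Fin r)), S.card = p j + 1 → ∀ x, (∀ i ∈ S, x i = v j) → g x = 0)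
    (htop : ∀ K : Finset (Fin r), K.card = k → ∀ x : _ → ℂ, ∃ P : ℂ[X],
      P.coeff (k * (Fintype.card J - 1)) = 0 ∧
        ∀ u, g (fun i => if i ∈ K then u else x i) = P.eval u) :
    ∀ x, g x = 0 := by
  set ψ : (Fin r → J) → ℂ := fun t =>
    (∏ i, (Lagrange.basis Finset.univ v (t i)).leadingCoeff) * g (v ∘ t) with hψdef
  have hψ : ∀ (σ : Equiv.Perm (Fin r)) t, ψ (t ∘ σ) = ψ t := fun σ t => by
    simp only [hψdef, ← Function.comp_assoc, hsymm]
    congr 1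
    exact Equiv.prod_comp σ fun i => (Lagrange.basis Finset.univ v (t i)).leadingCoeff
  have hweight : IsWeightVector p r (indexFun ψ) := by
    intro a ha
    obtain ⟨t, rfl, ht⟩ := exists_of_indexFun_ne_zero ha
    refine ⟨fun j => ?_, by exact_mod_cast (by simpa using sum_tupleCount t)⟩
    by_contra! hj
    rw [tupleCount_apply] at hj
    obtain ⟨S, hS, hS'⟩ := Finset.exists_subset_card_eq (Nat.succ_le_of_lt hj)
    refine ht (mul_eq_zero_of_right _ (hwheel j S hS' _ fun i hi => ?_))
    simp [(Finset.mem_filter.mp (hS hi)).2]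
  have hlow : lowerOp^[k] (indexFun ψ) = 0 := by
    funext a
    rw [iterate_lowerOp_apply]
    -- With r - k variables fixed at the nodes counted by a, the iterated lowering is, up to a
    -- factor, the leading coefficient in the other k variables. In other degrees no tuple of length
    -- r contributes.
    by_cases har : ∑ j, a j + k = r
    · obtain ⟨s, hs⟩ : ∃ s, ∑ j, a j = s := ⟨_, rfl⟩
      rw [hs] at har
      subst har
      obtain ⟨t₁, rfl⟩ := exists_tupleCount_eq hs
      have h1 : ∀ t : Fin k → J, indexFun ψ (tupleCount t₁ + ∑ i, Pi.single (t i) 1) =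
          (∏ i, (Lagrange.basis Finset.univ v (t₁ i)).leadingCoeff) *
          ((∏ i, (Lagrange.basis Finset.univ v (t i)).leadingCoeff) *
            g (Fin.append (v ∘ t₁) (v ∘ t))) := by
        intro t
        have h2 : tupleCount t₁ + ∑ i, Pi.single (t i) 1 = tupleCount (Fin.append t₁ t) := by
          simp [tupleCount, Fin.sum_univ_add]
        have h3 : v ∘ Fin.append t₁ t = Fin.append (v ∘ t₁) (v ∘ t) := by
          funext i
          refine Fin.addCases (fun i => ?_) (fun i => ?_) i <;> simp
        rw [h2, indexFun_tupleCount hψ]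
        simp only [hψdef, h3, Fin.prod_univ_add, Fin.append_left, Fin.append_right]
        ring
      simp only [h1, ← Finset.mul_sum, Pi.zero_apply]
      refine mul_eq_zero_of_right _ ?_
      obtain ⟨P, hP, hP'⟩ := htop (Finset.univ.map (Fin.natAddEmb s)) (by simp)
        (Fin.append (v ∘ t₁) 0)
      refine sum_top_coeff_eq_zero hv (fun w => g (Fin.append (v ∘ t₁) w)) (fun i x => ?_) P hP
        fun u => ?_
      · obtain ⟨Q, hQ, hQ'⟩ := hdeg (Fin.natAdd s i) (Fin.append (v ∘ t₁) x)
        refine ⟨Q, hQ, fun u => ?_⟩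
        rw [← hQ' u]
        refine congrArg g (funext fun l => ?_)
        refine Fin.addCases (fun l => ?_) (fun l => ?_) l
        · rw [Fin.append_left, Function.update_of_ne, Fin.append_left]
          intro h
          have := congrArg Fin.val h
          simp at this; omega
        · simp [Function.update_apply]
      · rw [← hP' u]
        congr 1
        funext l
        refine Fin.addCases (fun l => ?_) (fun l => ?_) l
        · have : ∀ x : Fin k, Fin.natAdd s x ≠ Fin.castAdd k l := fun x h => by
            have := congrArg Fin.val h
            simp at this; omega
          simp [this]
        · simp
    · refine Finset.sum_eq_zero fun t _ => ?_
      by_contra hne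
      obtain ⟨t', ht', -⟩ := exists_of_indexFun_ne_zero hne
      have h1 := sum_tupleCount t'
      have h2 := sum_tupleCount t
      rw [ht'] at h1
      simp only [Pi.add_apply, Finset.sum_add_distrib, Fintype.card_fin, tupleCount] at h1 h2
      omega
  have hzero := eq_zero_of_iterate_lowerOp_eq_zero _ r (indexFun ψ) k
    (Int.self_le_toNat _) hweight (by push_cast [← Nat.cast_sum]; omega) hlow
  intro x
  rw [eq_sum_lagrange hv r g hdeg]
  refine Finset.sum_eq_zero fun t _ => mul_eq_zero_of_right _ ?_
  have h1 := congrFun hzero (tupleCount t)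
  rw [indexFun_tupleCount hψ] at h1
  exact (mul_eq_zero.mp h1).resolve_left
    (Finset.prod_ne_zero_iff.mpr fun i _ => basis_leadingCoeff_ne_zero hv _)

/-- A symmetric function, polynomial of degree less than the number of nodes in each variable,
which vanishes as soon as more than `p j` variables are equal to the node `v j`, is zero if its
leading coefficient in any `k` variables is zero, where `k` is twice the number of variables minus
the sum of the `p j`. -/
theorem eq_zero_of_wheel {ι : Type*} [Fintype ι] [DecidableEq ι] {v : J → ℂ}
    (hv : Function.Injective v) (p : J → ℕ) {k : ℕ} (hk : 2 * Fintype.card ι = ∑ j, p j + k)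
    (g : (ι → ℂ) → ℂ) (hdeg : DegreeLtInEach (Fintype.card J) g)
    (hsymm : ∀ (σ : Equiv.Perm ι) x, g (x ∘ σ) = g x)
    (hwheel : ∀ j (S : Finset ι), S.card = p j + 1 → ∀ x, (∀ i ∈ S, x i = v j) → g x = 0)
    (htop : ∀ K : Finset ι, K.card = k → ∀ x : _ → ℂ, ∃ P : ℂ[X],
      P.coeff (k * (Fintype.card J - 1)) = 0 ∧
        ∀ u, g (fun i => if i ∈ K then u else x i) = P.eval u) :
    ∀ x, g x = 0 := by
  let e := Fintype.equivFin ι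
  have h := eq_zero_of_wheel_fin hv p hk (fun x => g (x ∘ e)) (fun i x => ?_) (fun σ x => ?_)
    (fun j S hS x hx => ?_) (fun K hK x => ?_)
  · intro x
    have := h (x ∘ e.symm)
    simpa [Function.comp_assoc] using this
  · obtain ⟨P, hP, hP'⟩ := hdeg (e.symm i) (x ∘ e)
    refine ⟨P, hP, fun u => ?_⟩
    rw [← hP' u]
    refine congrArg g (funext fun l => ?_)
    simp [Function.update_apply, Equiv.eq_symm_apply]
  · have := hsymm ((e.trans σ).trans e.symm) (x ∘ e)
    rw [← this]
    congr 1
    funext l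
    simp
  · exact hwheel j (S.map e.symm.toEmbedding) (by simpa using hS) _ fun i hi => by
      obtain ⟨l, hl, rfl⟩ := Finset.mem_map.mp hi
      simpa using hx l hl
  · obtain ⟨P, hP, hP'⟩ := htop (K.map e.symm.toEmbedding) (by simpa using hK) (x ∘ e)
    refine ⟨P, hP, fun u => ?_⟩
    rw [← hP' u]
    congr 1
    funext l
    simp

end Interpolation

/-! ### Orders of vanishing of polynomials along linear subspaces -/

section Orders

variable {σ : Type*} [DecidableEq σ]

/-- Scaling by `ε = Polynomial.X` of the variables in `A` towards the center `c`. -/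
noncomputable def scaleHom (A : Finset σ) (c : MvPolynomial σ ℂ) :
    MvPolynomial σ ℂ →ₐ[ℂ] Polynomial (MvPolynomial σ ℂ) :=
  MvPolynomial.aeval fun a => if a ∈ A then
    Polynomial.C c + Polynomial.X * Polynomial.C (MvPolynomial.X a - c)
    else Polynomial.C (MvPolynomial.X a)

lemma scaleHom_X (A : Finset σ) (c : MvPolynomial σ ℂ) (a : σ) :
    scaleHom A c (MvPolynomial.X a) = if a ∈ A then
      Polynomial.C c + Polynomial.X * Polynomial.C (MvPolynomial.X a - c)
      else Polynomial.C (MvPolynomial.X a) := by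
  simp [scaleHom]

lemma scaleHom_C (A : Finset σ) (c : MvPolynomial σ ℂ) (w : ℂ) :
    scaleHom A c (MvPolynomial.C w) = Polynomial.C (MvPolynomial.C w) := by
  simp [scaleHom]

lemma scaleHom_X_self (A : Finset σ) (c : σ) :
    scaleHom A (MvPolynomial.X c) (MvPolynomial.X c) = Polynomial.C (MvPolynomial.X c) := by
  rw [scaleHom_X]; split_ifs <;> simp

lemma eval_one_scaleHom (A : Finset σ) (c P : MvPolynomial σ ℂ) :
    (scaleHom A c P).eval 1 = P := by
  induction P using MvPolynomial.induction_on with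
  | C w => simp
  | add p q hp hq => simp [hp, hq]
  | mul_X p a hp => rw [map_mul, Polynomial.eval_mul, hp, scaleHom_X]; split_ifs <;> simp

/-- The ideal of the subspace where all the variables in `A` are equal to `c`. -/
noncomputable def centerIdeal (A : Finset σ) (c : MvPolynomial σ ℂ) : Ideal (MvPolynomial σ ℂ) :=
  Ideal.span {f | ∃ a ∈ A, f = MvPolynomial.X a - c}

/-- The ideal of the subspace where all the variables in `A` are equal. -/
noncomputable def diagIdeal (A : Finset σ) : Ideal (MvPolynomial σ ℂ) :=
  Ideal.span {f | ∃ a ∈ A, ∃ b ∈ A, f = MvPolynomial.X a - MvPolynomial.X b}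

lemma X_sub_X_mem_diagIdeal {σ : Type*} {A : Finset σ} {a b : σ} (ha : a ∈ A) (hb : b ∈ A) :
    MvPolynomial.X a - MvPolynomial.X b ∈ diagIdeal A :=
  Ideal.subset_span ⟨a, ha, b, hb, rfl⟩

lemma diagIdeal_eq_centerIdeal {σ : Type*} {A : Finset σ} {c : σ} (hc : c ∈ A) :
    diagIdeal A = centerIdeal A (MvPolynomial.X c) := by
  refine le_antisymm (Ideal.span_le.mpr ?_) (Ideal.span_le.mpr ?_)
  · rintro _ ⟨a, ha, b, hb, rfl⟩
    rw [← sub_sub_sub_cancel_right _ _ (MvPolynomial.X c)]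
    exact Ideal.sub_mem _ (Ideal.subset_span ⟨a, ha, rfl⟩) (Ideal.subset_span ⟨b, hb, rfl⟩)
  · rintro _ ⟨a, ha, rfl⟩
    exact X_sub_X_mem_diagIdeal ha hc

/-- The scaled polynomial lies in the Rees algebra: its coefficient of degree i is in the i-th power
of the ideal. Setting ε = 1 gives back P as the sum of the coefficients of degree at least m. -/
lemma mem_centerIdeal_pow_of_dvd {A : Finset σ} {c P : MvPolynomial σ ℂ} {m : ℕ}
    (h : Polynomial.X ^ m ∣ scaleHom A c P) : P ∈ centerIdeal A c ^ m := by
  have h1 : ∀ Q, scaleHom A c Q ∈ reesAlgebra (centerIdeal A c) := by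
    intro Q
    induction Q using MvPolynomial.induction_on with
    | C w =>
      rw [scaleHom_C]
      exact Subalgebra.algebraMap_mem (reesAlgebra (centerIdeal A c)) (MvPolynomial.C w)
    | add p q hp hq => rw [map_add]; exact add_mem hp hq
    | mul_X p a hp =>
      rw [map_mul, scaleHom_X]
      refine mul_mem hp ?_
      split_ifs with ha
      · refine add_mem (Subalgebra.algebraMap_mem (reesAlgebra (centerIdeal A c)) c) ?_
        rw [mul_comm, Polynomial.C_mul_X_eq_monomial, reesAlgebra.monomial_mem, pow_one]
        exact Ideal.subset_span ⟨a, ha, rfl⟩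
      · exact Subalgebra.algebraMap_mem (reesAlgebra (centerIdeal A c)) (MvPolynomial.X a)
  rw [← eval_one_scaleHom A c P, Polynomial.eval_eq_sum_range]
  refine Ideal.sum_mem _ fun i _ => ?_
  rw [one_pow, mul_one]
  by_cases hi : i < m
  · rw [Polynomial.X_pow_dvd_iff.mp h i hi]; exact Ideal.zero_mem _
  · exact Ideal.pow_le_pow_right (not_lt.mp hi) ((mem_reesAlgebra_iff _ _).mp (h1 P) i)

/-- The scaling has to fix the center, so that every generator of the ideal acquires a factor ε. -/
lemma dvd_scaleHom_of_mem {A : Finset σ} {c P : MvPolynomial σ ℂ} {m : ℕ}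
    (hc : scaleHom A c c = Polynomial.C c) (h : P ∈ centerIdeal A c ^ m) :
    Polynomial.X ^ m ∣ scaleHom A c P := by
  rw [← Ideal.mem_span_singleton, ← Ideal.span_singleton_pow]
  have h1 : centerIdeal A c ≤ (Ideal.span {Polynomial.X}).comap (scaleHom A c) := by
    refine Ideal.span_le.mpr ?_
    rintro _ ⟨a, ha, rfl⟩
    rw [SetLike.mem_coe, Ideal.mem_comap, map_sub, hc, scaleHom_X, if_pos ha, add_sub_cancel_left]
    exact Ideal.mul_mem_right _ _ (Ideal.mem_span_singleton_self _)
  have h2 := Ideal.pow_right_mono h1 m h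
  exact Ideal.le_comap_pow _ _ h2

lemma mem_diagIdeal_pow_iff {A : Finset σ} {c : σ} (hc : c ∈ A) {P : MvPolynomial σ ℂ} {m : ℕ} :
    P ∈ diagIdeal A ^ m ↔ Polynomial.X ^ m ∣ scaleHom A (MvPolynomial.X c) P := by
  rw [diagIdeal_eq_centerIdeal hc]
  exact ⟨dvd_scaleHom_of_mem (scaleHom_X_self _ _), mem_centerIdeal_pow_of_dvd⟩

lemma scaleHom_X_sub_X {A : Finset σ} {c : MvPolynomial σ ℂ} {a b : σ} (ha : a ∈ A) (hb : b ∈ A) :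
    scaleHom A c (MvPolynomial.X a - MvPolynomial.X b) =
      Polynomial.X * Polynomial.C (MvPolynomial.X a - MvPolynomial.X b) := by
  rw [map_sub, scaleHom_X, scaleHom_X, if_pos ha, if_pos hb]
  simp only [Polynomial.C_sub]; ring

lemma X_sub_X_ne_zero {σ : Type*} {a b : σ} (hab : a ≠ b) :
    (MvPolynomial.X a - MvPolynomial.X b : MvPolynomial σ ℂ) ≠ 0 :=
  sub_ne_zero.mpr fun h => hab (MvPolynomial.X_injective h)

lemma not_X_dvd_of_coeff_zero_ne {R : Type*} [CommRing R] {P : Polynomial R}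
    (h : P.coeff 0 ≠ 0) : ¬ Polynomial.X ∣ P := fun h1 => h (Polynomial.X_dvd_iff.mp h1)

/-- The forms `t_a - t_b` which are not constant along the scaling do not vanish at the center. -/
lemma not_X_dvd_scaleHom_X_sub_X {A : Finset σ} {c : σ} (hc : c ∈ A) {a b : σ} (hab : a ≠ b)
    (h : ¬ (a ∈ A ∧ b ∈ A)) :
    ¬ Polynomial.X ∣ scaleHom A (MvPolynomial.X c) (MvPolynomial.X a - MvPolynomial.X b) := by
  refine not_X_dvd_of_coeff_zero_ne ?_
  rw [map_sub, scaleHom_X, scaleHom_X]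
  split_ifs with ha hb hb
  · exact absurd ⟨ha, hb⟩ h
  · simpa using X_sub_X_ne_zero (a := c) (b := b) fun e => hb (e ▸ hc)
  · simpa using X_sub_X_ne_zero (a := a) (b := c) fun e => ha (e ▸ hc)
  · simpa using X_sub_X_ne_zero hab

/-- The number of times that `t_a - t_b` vanishes along the diagonal of `B`. -/
def pairOrder (B : Finset σ) (u : σ × σ) : ℕ := if u.1 ∈ B ∧ u.2 ∈ B then 1 else 0

/-- Orders are additive because ε is prime, and t_a - t_b scales to ε times a nonzero constant
polynomial in ε, or to something prime to ε. -/
lemma mem_diagIdeal_pow_of_mul_mem {B : Finset σ} (hB : B.Nonempty) {a b : σ} (hab : a ≠ b)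
    (e : ℕ) {m : ℕ} {G : MvPolynomial σ ℂ}
    (h : (MvPolynomial.X a - MvPolynomial.X b) ^ e * G ∈ diagIdeal B ^ (m + e * pairOrder B (a, b))) :
    G ∈ diagIdeal B ^ m := by
  obtain ⟨c, hc⟩ := hB
  rw [mem_diagIdeal_pow_iff hc] at h ⊢
  unfold pairOrder at h
  rw [map_mul, map_pow] at h
  split_ifs at h with hu
  · rw [scaleHom_X_sub_X hu.1 hu.2, mul_pow, mul_one, add_comm, pow_add, mul_assoc] at h
    have h1 := (mul_dvd_mul_iff_left (pow_ne_zero e Polynomial.X_ne_zero)).mp h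
    refine Polynomial.prime_X.pow_dvd_of_dvd_mul_left _ (fun h2 => ?_) h1
    have h3 := Polynomial.prime_X.dvd_of_dvd_pow h2
    exact X_sub_X_ne_zero hab (by simpa using Polynomial.X_dvd_iff.mp h3)
  · rw [mul_zero, add_zero] at h
    exact Polynomial.prime_X.pow_dvd_of_dvd_mul_left _ (fun h2 =>
      not_X_dvd_scaleHom_X_sub_X hc hab hu (Polynomial.prime_X.dvd_of_dvd_pow h2)) h

lemma mem_diagIdeal_pow_of_prod_mul_mem {B : Finset σ} (hB : B.Nonempty) (U : Finset (σ × σ))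
    (hU : ∀ u ∈ U, u.1 ≠ u.2) (e : σ × σ → ℕ) {m : ℕ} {G : MvPolynomial σ ℂ}
    (h : (∏ u ∈ U, (MvPolynomial.X u.1 - MvPolynomial.X u.2) ^ e u) * G ∈
      diagIdeal B ^ (m + ∑ u ∈ U, e u * pairOrder B u)) :
    G ∈ diagIdeal B ^ m := by
  induction U using Finset.induction_on generalizing m G with
  | empty => simpa using h
  | insert u U hu ih =>
    rw [Finset.prod_insert hu, Finset.sum_insert hu, mul_assoc, add_comm (_ * _), ← add_assoc] at h
    exact ih (fun u hu => hU u (Finset.mem_insert_of_mem hu))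
      (mem_diagIdeal_pow_of_mul_mem hB (hU u (Finset.mem_insert_self _ _)) _ h)

lemma diagIdeal_pair (a b : σ) :
    diagIdeal {a, b} = Ideal.span {(MvPolynomial.X a - MvPolynomial.X b : MvPolynomial σ ℂ)} := by
  rw [diagIdeal_eq_centerIdeal (c := b) (by simp)]
  refine le_antisymm (Ideal.span_le.mpr ?_) (Ideal.span_le.mpr ?_)
  · rintro _ ⟨i, hi, rfl⟩
    rcases Finset.mem_insert.mp hi with rfl | hi
    · exact Ideal.mem_span_singleton_self _
    · rw [Finset.mem_singleton.mp hi, sub_self]; exact Ideal.zero_mem _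
  · rintro _ rfl
    exact Ideal.subset_span ⟨a, by simp, rfl⟩

/-- Along the diagonal of one pair the factors of the other pairs have order 0, so they can be
divided out without losing the order of F. Reversed pairs are excluded since they give associated
factors. -/
lemma prod_X_sub_X_pow_dvd (U : Finset (σ × σ)) (hU : ∀ u ∈ U, u.1 ≠ u.2)
    (hU' : ∀ u ∈ U, u.swap ∉ U) (e : σ × σ → ℕ) {F : MvPolynomial σ ℂ}
    (h : ∀ u ∈ U, F ∈ diagIdeal {u.1, u.2} ^ e u) :
    ∏ u ∈ U, (MvPolynomial.X u.1 - MvPolynomial.X u.2) ^ e u ∣ F := by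
  induction U using Finset.induction_on with
  | empty => simp
  | insert u U hu ih =>
    obtain ⟨G, rfl⟩ := ih (fun w hw => hU w (Finset.mem_insert_of_mem hw))
      (fun w hw h => hU' w (Finset.mem_insert_of_mem hw) (Finset.mem_insert_of_mem h))
      (fun w hw => h w (Finset.mem_insert_of_mem hw))
    rw [Finset.prod_insert hu, mul_comm]
    refine mul_dvd_mul_left _ ?_
    have h1 : ∑ w ∈ U, e w * pairOrder {u.1, u.2} w = 0 := by
      refine Finset.sum_eq_zero fun w hw => ?_
      have h1 := hU w (Finset.mem_insert_of_mem hw)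
      have h2 := hU' w (Finset.mem_insert_of_mem hw)
      rw [Finset.mem_insert, not_or] at h2
      unfold pairOrder
      rw [if_neg, mul_zero]
      rintro ⟨h3, h4⟩
      simp only [Finset.mem_insert, Finset.mem_singleton] at h3 h4
      rcases h3 with h3 | h3 <;> rcases h4 with h4 | h4
      · exact h1 (h3.trans h4.symm)
      · exact hu ((Prod.ext h3 h4 : w = u) ▸ hw)
      · exact h2.1 (Prod.ext h4 h3)
      · exact h1 (h3.trans h4.symm)
    have h2 := h u (Finset.mem_insert_self _ _)
    have h3 := mem_diagIdeal_pow_of_prod_mul_mem (B := {u.1, u.2}) (by simp) U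
      (fun w hw => hU w (Finset.mem_insert_of_mem hw)) e (m := e u) (by rwa [h1, add_zero])
    rwa [diagIdeal_pair, Ideal.span_singleton_pow, Ideal.mem_span_singleton] at h3

/-- The coefficients of the expansion around the diagonal of `A` vanish along the diagonal of a
subset at least as much as the polynomial. -/
lemma coeff_scaleHom_mem {A B : Finset σ} (hBA : B ⊆ A) (c : MvPolynomial σ ℂ)
    {P : MvPolynomial σ ℂ} {m : ℕ} (h : P ∈ diagIdeal B ^ m) (i : ℕ) :
    (scaleHom A c P).coeff i ∈ diagIdeal B ^ m := by
  have h1 : diagIdeal B ≤ ((diagIdeal B).map Polynomial.C).comap (scaleHom A c) := by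
    refine Ideal.span_le.mpr ?_
    rintro _ ⟨a, ha, b, hb, rfl⟩
    rw [SetLike.mem_coe, Ideal.mem_comap, scaleHom_X_sub_X (hBA ha) (hBA hb)]
    exact Ideal.mul_mem_left _ _ (Ideal.mem_map_of_mem _ (X_sub_X_mem_diagIdeal ha hb))
  have h2 := Ideal.le_comap_pow _ _ (Ideal.pow_right_mono h1 m h)
  rw [Ideal.mem_comap, ← Ideal.map_pow] at h2
  exact Ideal.mem_map_C_iff.mp h2 i

/-- The part of degree D in the differences t_a - t_c has degree at most D in any subset of the
variables. This starts the induction on m in the next statement. -/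
lemma coeff_scaleHom_coeff_scaleHom_eq_zero_of_lt {A K : Finset σ} (hK : K ⊆ A) (c : σ)
    (G : MvPolynomial σ ℂ) : ∀ i D : ℕ, D < i → (scaleHom K (MvPolynomial.X c)
      ((scaleHom A (MvPolynomial.X c) G).coeff D)).coeff i = 0 := by
  induction G using MvPolynomial.induction_on with
  | C w =>
    intro i D hi
    rw [scaleHom_C, Polynomial.coeff_C]
    split_ifs
    · rw [scaleHom_C, Polynomial.coeff_C, if_neg (by omega)]
    · simp
  | add p q hp hq =>
    intro i D hi
    rw [map_add, Polynomial.coeff_add, map_add, Polynomial.coeff_add, hp i D hi, hq i D hi, add_zero]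
  | mul_X p a hp =>
    intro i D hi
    have hX : ∀ b, (b ∈ K → b = c) → (scaleHom K (MvPolynomial.X c)
        ((scaleHom A (MvPolynomial.X c) p).coeff D * MvPolynomial.X b)).coeff i = 0 := by
      intro b hb
      have : scaleHom K (MvPolynomial.X c) (MvPolynomial.X b) = Polynomial.C (MvPolynomial.X b) := by
        by_cases h : b ∈ K
        · rw [hb h, scaleHom_X_self]
        · rw [scaleHom_X, if_neg h]
      rw [map_mul, this, Polynomial.coeff_mul_C, hp i D hi, zero_mul]
    rw [map_mul, scaleHom_X]
    split_ifs with ha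
    · rw [mul_add, ← mul_assoc, Polynomial.coeff_add, Polynomial.coeff_mul_C,
        Polynomial.coeff_mul_C, map_add, Polynomial.coeff_add, hX c fun _ => rfl, zero_add]
      cases D with
      | zero => simp
      | succ D =>
        obtain ⟨i, rfl⟩ : ∃ i', i = i' + 1 := ⟨i - 1, by omega⟩
        rw [Polynomial.coeff_mul_X, map_mul, map_sub, scaleHom_X_self, scaleHom_X]
        split_ifs
        · rw [add_sub_cancel_left, ← mul_assoc, Polynomial.coeff_mul_C, Polynomial.coeff_mul_X,
            hp i D (by omega), zero_mul]
        · rw [← Polynomial.C_sub, Polynomial.coeff_mul_C, hp (i + 1) D (by omega), zero_mul]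
    · rw [Polynomial.coeff_mul_C, hX a fun h => absurd (hK h) ha]

/-- If `G` vanishes to order `m` along the diagonal of `B`, then the part of degree `D` of its
expansion around the diagonal of `A ⊇ B` has degree at most `D - m` in the variables of `A \ B`. -/
lemma coeff_scaleHom_coeff_scaleHom_eq_zero {A K B : Finset σ} (hK : K ⊆ A) (hB : B ⊆ A)
    (hBK : Disjoint B K) (c : σ) {m : ℕ} {G : MvPolynomial σ ℂ} (hG : G ∈ diagIdeal B ^ m) :
    ∀ i D : ℕ, D < i + m → (scaleHom K (MvPolynomial.X c)
      ((scaleHom A (MvPolynomial.X c) G).coeff D)).coeff i = 0 := by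
  induction m generalizing G with
  | zero => exact coeff_scaleHom_coeff_scaleHom_eq_zero_of_lt hK c G
  | succ m ih =>
    rw [pow_succ'] at hG
    refine Submodule.mul_induction_on hG (fun f hf h hh => ?_) (fun p q hp hq i D hi => ?_)
    · refine Submodule.span_induction (p := fun f _ => ∀ h ∈ diagIdeal B ^ m, ∀ i D : ℕ,
        D < i + (m + 1) → (scaleHom K (MvPolynomial.X c)
          ((scaleHom A (MvPolynomial.X c) (f * h)).coeff D)).coeff i = 0)
        ?_ ?_ ?_ ?_ hf h hh
      -- A factor t_a - t_b with a and b in B uses up one unit of D and is not affected by the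
      -- scaling of K.
      · rintro _ ⟨a, ha, b, hb, rfl⟩ h hh i D hi
        rw [map_mul, scaleHom_X_sub_X (hB ha) (hB hb), mul_assoc]
        cases D with
        | zero => simp
        | succ D =>
          rw [Polynomial.coeff_X_mul, Polynomial.coeff_C_mul, map_mul, map_sub, scaleHom_X,
            scaleHom_X, if_neg (Finset.disjoint_left.mp hBK ha),
            if_neg (Finset.disjoint_left.mp hBK hb), ← Polynomial.C_sub, Polynomial.coeff_C_mul,
            ih hh i D (by omega), mul_zero]
      · intro h _ i D _; simp
      · intro f g _ _ hf hg h hh i D hi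
        rw [add_mul, map_add, Polynomial.coeff_add, map_add, Polynomial.coeff_add, hf h hh i D hi,
          hg h hh i D hi, add_zero]
      · intro r f _ hf h hh i D hi
        rw [smul_eq_mul, mul_comm r, mul_assoc]
        exact hf _ (Ideal.mul_mem_left _ r hh) i D hi
    · rw [map_add, Polynomial.coeff_add, map_add, Polynomial.coeff_add, hp i D hi, hq i D hi,
        add_zero]

end Orders

/-! ### Vanishing of leading terms by reflection in a node -/

section Reflection

variable {σ : Type*}

lemma eval_map_scaleHom_center [DecidableEq σ] (K : Finset σ) (c P : MvPolynomial σ ℂ)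
    (t : σ → ℂ) (u : ℂ) : ((scaleHom K c P).map (MvPolynomial.eval t)).eval u =
      MvPolynomial.eval (fun a => if a ∈ K then MvPolynomial.eval t c +
        u * (t a - MvPolynomial.eval t c) else t a) P := by
  induction P using MvPolynomial.induction_on with
  | C w => simp
  | add p q hp hq => simp only [map_add, Polynomial.map_add, Polynomial.eval_add, hp, hq]
  | mul_X p a hp =>
    rw [map_mul, Polynomial.map_mul, Polynomial.eval_mul, hp, map_mul, scaleHom_X,
      MvPolynomial.eval_X]
    split_ifs <;> simp

lemma eval_map_scaleHom [DecidableEq σ] (K : Finset σ) (c : σ) (P : MvPolynomial σ ℂ) (t : σ → ℂ)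
    (u : ℂ) : ((scaleHom K (MvPolynomial.X c) P).map (MvPolynomial.eval t)).eval u =
      MvPolynomial.eval (fun a => if a ∈ K then t c + u * (t a - t c) else t a) P := by
  rw [eval_map_scaleHom_center, MvPolynomial.eval_X]

lemma scaleHom_rename [DecidableEq σ] {A : Finset σ} {c : σ} {τ : Equiv.Perm σ}
    (hA : ∀ a, τ a ∈ A ↔ a ∈ A) (hc : τ c = c) (P : MvPolynomial σ ℂ) :
    scaleHom A (MvPolynomial.X c) (MvPolynomial.rename τ P) =
      (scaleHom A (MvPolynomial.X c) P).map (MvPolynomial.rename τ : _ →ₐ[ℂ] _).toRingHom := by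
  induction P using MvPolynomial.induction_on with
  | C w => simp
  | add p q hp hq => simp only [map_add, Polynomial.map_add, hp, hq]
  | mul_X p a hp =>
    rw [map_mul, map_mul, map_mul, Polynomial.map_mul, hp, MvPolynomial.rename_X, scaleHom_X,
      scaleHom_X]
    simp only [hA]
    split_ifs <;> simp [hc]

lemma eval_eq_zero_of_mem_diagIdeal {B : Finset σ} {P : MvPolynomial σ ℂ} (hP : P ∈ diagIdeal B)
    {t : σ → ℂ} (w : ℂ) (ht : ∀ a ∈ B, t a = w) : MvPolynomial.eval t P = 0 := by
  have : diagIdeal B ≤ RingHom.ker (MvPolynomial.eval t) := by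
    refine Ideal.span_le.mpr ?_
    rintro _ ⟨a, ha, b, hb, rfl⟩
    simp [RingHom.mem_ker, ht a ha, ht b hb]
  exact this hP

lemma prod_X_sub_X_mem {B : Finset σ} (U : Finset (σ × σ)) (hU : ∀ u ∈ U, u.1 ∈ B ∧ u.2 ∈ B)
    (e : σ × σ → ℕ) :
    ∏ u ∈ U, (MvPolynomial.X u.1 - MvPolynomial.X u.2 : MvPolynomial σ ℂ) ^ e u ∈
      diagIdeal B ^ ∑ u ∈ U, e u := by
  classical
  induction U using Finset.induction_on with
  | empty => simp
  | insert u U hu ih =>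
    rw [Finset.prod_insert hu, Finset.sum_insert hu, pow_add]
    refine Ideal.mul_mem_mul (Ideal.pow_mem_pow ?_ _)
      (ih fun w hw => hU w (Finset.mem_insert_of_mem hw))
    exact X_sub_X_mem_diagIdeal (hU u (Finset.mem_insert_self _ _)).1
      (hU u (Finset.mem_insert_self _ _)).2

variable [LinearOrder σ]

/-- The pairs of distinct elements of `A`, at least one of which is in `S`. -/
def pairsMeeting (A S : Finset σ) : Finset (σ × σ) :=
  S ×ˢ (A \ S) ∪ (S ×ˢ S).filter fun u => u.1 < u.2

lemma mem_pairsMeeting {A S : Finset σ} {u : σ × σ} : u ∈ pairsMeeting A S ↔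
    (u.1 ∈ S ∧ u.2 ∈ A ∧ u.2 ∉ S) ∨ (u.1 ∈ S ∧ u.2 ∈ S ∧ u.1 < u.2) := by
  simp [pairsMeeting, and_assoc]

lemma pairsMeeting_disjoint (A S : Finset σ) :
    Disjoint (S ×ˢ (A \ S)) ((S ×ˢ S).filter fun u => u.1 < u.2) := by
  rw [Finset.disjoint_left]
  intro u h1 h2
  simp only [Finset.mem_product, Finset.mem_sdiff, Finset.mem_filter] at h1 h2
  exact h1.2.2 h2.1.2

lemma card_filter_lt (S : Finset σ) :
    ((S ×ˢ S).filter fun u => u.1 < u.2).card = S.card.choose 2 := by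
  have h1 : S.offDiag = ((S ×ˢ S).filter fun u => u.1 < u.2) ∪
      ((S ×ˢ S).filter fun u => u.2 < u.1) := by
    ext u; simp only [Finset.mem_offDiag, Finset.mem_union, Finset.mem_filter, Finset.mem_product]
    constructor
    · rintro ⟨h1, h2, h3⟩
      rcases lt_or_gt_of_ne h3 with h | h
      · exact Or.inl ⟨⟨h1, h2⟩, h⟩
      · exact Or.inr ⟨⟨h1, h2⟩, h⟩
    · rintro (⟨⟨h1, h2⟩, h⟩ | ⟨⟨h1, h2⟩, h⟩)
      · exact ⟨h1, h2, h.ne⟩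
      · exact ⟨h1, h2, h.ne'⟩
  have h2 : ((S ×ˢ S).filter fun u => u.2 < u.1).card =
      ((S ×ˢ S).filter fun u => u.1 < u.2).card :=
    Finset.card_bij' (fun u _ => u.swap) (fun u _ => u.swap) (by simp; tauto) (by simp; tauto)
      (by simp) (by simp)
  have h3 := congrArg Finset.card h1
  rw [Finset.card_union_of_disjoint (Finset.disjoint_left.mpr fun u h h' =>
    lt_asymm (Finset.mem_filter.mp h).2 (Finset.mem_filter.mp h').2), h2, Finset.offDiag_card] at h3
  rw [Nat.choose_two_right, Nat.mul_sub_one, h3]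
  omega

lemma choose_two_add (a b : ℕ) : (a + b).choose 2 = a.choose 2 + b.choose 2 + a * b := by
  have h := Nat.add_choose_eq a b 2
  rw [h, Finset.Nat.antidiagonal_succ]
  simp [Finset.Nat.antidiagonal_succ]
  ring

/-- The exponent `n`, lowered by one if the second element of the pair is in `Y`. -/
def pairExp (Y : Finset σ) (n : ℕ) (u : σ × σ) : ℕ := if u.2 ∈ Y then n - 1 else n

lemma pairOrder_of_mem {B : Finset σ} {u : σ × σ} (h1 : u.1 ∈ B) (h2 : u.2 ∈ B) :
    pairOrder B u = 1 := if_pos ⟨h1, h2⟩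

lemma pairOrder_of_not {B : Finset σ} {u : σ × σ} (h : ¬ (u.1 ∈ B ∧ u.2 ∈ B)) :
    pairOrder B u = 0 := if_neg h

/-- The order along the diagonal of B of the forced factors: exponent n for every pair meeting S,
minus one for each pair of B made of an element of S and one of Y. The correction stands on the left
to avoid natural subtraction. -/
lemma sum_pairOrder {A S Y B : Finset σ} (hB : B ⊆ A) (hY : Disjoint Y S) {n : ℕ} (hn : 1 ≤ n) :
    ∑ u ∈ pairsMeeting A S, pairExp Y n u * pairOrder B u +
      (B ∩ S).card * (B ∩ Y).card =
      n * ((B ∩ S).card * (B \ S).card + (B ∩ S).card.choose 2) := by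
  rw [pairsMeeting, Finset.sum_union (pairsMeeting_disjoint A S)]
  have h1 : ∑ u ∈ S ×ˢ (A \ S), pairExp Y n u * pairOrder B u =
      (B ∩ S).card * ∑ b ∈ B \ S, (if b ∈ Y then n - 1 else n) := by
    have hf : ∀ u ∈ S ×ˢ (A \ S), u ∉ (B ∩ S) ×ˢ (B \ S) →
        pairExp Y n u * pairOrder B u = 0 := by
      intro u hu hu'
      rw [pairOrder_of_not, mul_zero]
      rintro ⟨h1, h2⟩
      simp only [Finset.mem_product, Finset.mem_sdiff, Finset.mem_inter] at hu hu'
      exact hu' ⟨⟨h1, hu.1⟩, h2, hu.2.2⟩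
    rw [← Finset.sum_subset (Finset.product_subset_product Finset.inter_subset_right
      (Finset.sdiff_subset_sdiff hB le_rfl)) hf, Finset.sum_product]
    rw [Finset.sum_congr rfl (g := fun _ => ∑ b ∈ B \ S, (if b ∈ Y then n - 1 else n))]
    · rw [Finset.sum_const, smul_eq_mul]
    · intro a ha
      refine Finset.sum_congr rfl fun b hb => ?_
      rw [pairOrder_of_mem (Finset.mem_inter.mp ha).1 (Finset.mem_sdiff.mp hb).1, mul_one, pairExp]
  have h2 : ∑ u ∈ (S ×ˢ S).filter (fun u => u.1 < u.2),
      pairExp Y n u * pairOrder B u = n * (B ∩ S).card.choose 2 := by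
    rw [← card_filter_lt, mul_comm, Finset.card_eq_sum_ones, Finset.sum_mul]
    have : ((B ∩ S) ×ˢ (B ∩ S)).filter (fun u => u.1 < u.2) ⊆
        (S ×ˢ S).filter (fun u => u.1 < u.2) :=
      Finset.filter_subset_filter _ (Finset.product_subset_product Finset.inter_subset_right
        Finset.inter_subset_right)
    rw [← Finset.sum_subset this]
    · refine Finset.sum_congr rfl fun u hu => ?_
      simp only [Finset.mem_filter, Finset.mem_product, Finset.mem_inter] at hu
      rw [pairOrder_of_mem hu.1.1.1 hu.1.2.1, pairExp,
        if_neg (Finset.disjoint_right.mp hY hu.1.2.2)]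
      ring
    · intro u hu hu'
      simp only [Finset.mem_filter, Finset.mem_product, Finset.mem_inter] at hu hu'
      rw [pairOrder_of_not, mul_zero]
      rintro ⟨h1, h2⟩
      exact hu' ⟨⟨⟨h1, hu.1.1⟩, h2, hu.1.2⟩, hu.2⟩
  have h3 : ∑ b ∈ B \ S, (if b ∈ Y then n - 1 else n) + (B ∩ Y).card = n * (B \ S).card := by
    have : B ∩ Y = (B \ S).filter (· ∈ Y) := by
      ext b
      simp only [Finset.mem_inter, Finset.mem_filter, Finset.mem_sdiff]
      exact ⟨fun h => ⟨⟨h.1, Finset.disjoint_left.mp hY h.2⟩, h.2⟩, fun h => ⟨h.1.1, h.2⟩⟩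
    rw [this, Finset.card_filter, ← Finset.sum_add_distrib, mul_comm, Finset.card_eq_sum_ones,
      Finset.sum_mul]
    refine Finset.sum_congr rfl fun b _ => ?_
    split_ifs <;> omega
  rw [h1, h2, mul_add, mul_left_comm n, ← h3]
  ring

/-- A permutation of S may reverse a pair inside S, changing the sign of its factor. The exponent of
such a pair is even, as Y is disjoint from S. The pairs with one element outside S are only
permuted. -/
lemma rename_prod_pairsMeeting {A S Y : Finset σ} (hY : Disjoint Y S) {n' : ℕ}
    {τ : Equiv.Perm σ} (hτ : ∀ a ∉ S, τ a = a) :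
    MvPolynomial.rename τ (∏ u ∈ pairsMeeting A S, (MvPolynomial.X u.1 - MvPolynomial.X u.2 :
      MvPolynomial σ ℂ) ^ pairExp Y (2 * n') u) =
    ∏ u ∈ pairsMeeting A S, (MvPolynomial.X u.1 - MvPolynomial.X u.2 :
      MvPolynomial σ ℂ) ^ pairExp Y (2 * n') u := by
  have hS : ∀ a, τ a ∈ S ↔ a ∈ S := by
    intro a
    by_cases ha : a ∈ S
    · refine iff_of_true ?_ ha
      by_contra h
      exact h (by rwa [τ.injective (hτ _ h)])
    · rw [hτ a ha]
  rw [pairsMeeting, Finset.prod_union (pairsMeeting_disjoint A S), map_mul]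
  simp only [map_prod, map_pow, map_sub, MvPolynomial.rename_X]
  congr 1
  · refine Finset.prod_equiv (τ.prodCongr (Equiv.refl σ)) ?_ ?_
    · intro u; simp [hS]
    · intro u hu
      rw [Finset.mem_product, Finset.mem_sdiff] at hu
      simp [hτ u.2 hu.2.2, pairExp]
  · have hσ : ∀ a, τ.symm a ∈ S ↔ a ∈ S := fun a => by rw [← hS, Equiv.apply_symm_apply]
    refine Finset.prod_bij'
      (fun u _ => if τ u.1 < τ u.2 then (τ u.1, τ u.2) else (τ u.2, τ u.1))
      (fun u _ => if τ.symm u.1 < τ.symm u.2 then (τ.symm u.1, τ.symm u.2)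
        else (τ.symm u.2, τ.symm u.1)) ?_ ?_ ?_ ?_ ?_
    · intro u hu
      simp only [Finset.mem_filter, Finset.mem_product] at hu ⊢
      split_ifs with h
      · simp [hS, hu.1, h]
      · exact ⟨by simp [hS, hu.1], lt_of_le_of_ne (not_lt.mp h)
          fun h => hu.2.ne' (τ.injective h)⟩
    · intro u hu
      simp only [Finset.mem_filter, Finset.mem_product] at hu ⊢
      split_ifs with h
      · simp [hσ, hu.1, h]
      · exact ⟨by simp [hσ, hu.1], lt_of_le_of_ne (not_lt.mp h)
          fun h => hu.2.ne' (τ.symm.injective h)⟩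
    · intro u hu
      have := (Finset.mem_filter.mp hu).2
      by_cases h : τ u.1 < τ u.2 <;> simp [h, this, this.not_gt]
    · intro u hu
      have := (Finset.mem_filter.mp hu).2
      by_cases h : τ.symm u.1 < τ.symm u.2 <;> simp [h, this, this.not_gt]
    · intro u hu
      simp only [Finset.mem_filter, Finset.mem_product] at hu
      have hn : ∀ a, ∀ b ∈ S, pairExp Y (2 * n') (a, b) = 2 * n' := fun a b hb =>
        if_neg (Finset.disjoint_right.mp hY hb)
      have hn' := hn u.1 u.2 hu.1.2
      rw [Prod.mk.eta] at hn'
      by_cases h : τ u.1 < τ u.2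
      · rw [if_pos h, hn', hn _ _ ((hS _).mpr hu.1.2)]
      · rw [if_neg h, hn', hn _ _ ((hS _).mpr hu.1.1), pow_mul, pow_mul]
        congr 1; ring

end Reflection

/-! ### Logarithmic orders and the reflection argument -/

section Reflection

variable {σ : Type*}

/-- The form with coefficient `F / ∏_{a < b} (t_a - t_b) ^ n` has logarithmic order at least `δ`
along the diagonal of `B`. -/
def LogOrderGE (n : ℕ) (F : MvPolynomial σ ℂ) (B : Finset σ) (δ : ℕ) : Prop :=
  ∀ m, m + B.card ≤ 1 + δ + n * B.card.choose 2 → F ∈ diagIdeal B ^ m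

variable [LinearOrder σ]

/-- Freeze the variables outside S, with distinct values on Y, and measure those in S from t_c.
Scaling towards t_c becomes scaling towards 0, and `eq_zero_of_wheel` applies with the differences
t_y - t_c as nodes. -/
lemma eq_zero_of_leading_conditions {S Y : Finset σ} {c : σ} {p : σ → ℕ} {k : ℕ}
    {G₀ : MvPolynomial σ ℂ}
    (hcS : c ∉ S)
    (hY : Disjoint Y S)
    (hsymm : ∀ τ : Equiv.Perm σ, (∀ a ∉ S, τ a = a) → MvPolynomial.rename τ G₀ = G₀)
    (hdeg : ∀ x ∈ S, ∀ i, Y.card ≤ i → (scaleHom {x} (MvPolynomial.X c) G₀).coeff i = 0)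
    (hwheel : ∀ y ∈ Y, ∀ T ⊆ S, T.card = p y + 1 → G₀ ∈ diagIdeal (insert y T))
    (hk : 2 * S.card = ∑ y ∈ Y, p y + k)
    (htop : ∀ K ⊆ S, K.card = k →
      (scaleHom K (MvPolynomial.X c) G₀).coeff (k * (Y.card - 1)) = 0) : G₀ = 0 := by
  have main : ∀ t : σ → ℂ, Set.InjOn t Y → MvPolynomial.eval t G₀ = 0 := by
    intro t ht
    let pt : (S → ℂ) → σ → ℂ := fun x a => if h : a ∈ S then t c + x ⟨a, h⟩ else t a
    have hpt_mem : ∀ x (i : S), pt x i = t c + x i := fun x i => by simp [pt]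
    have hpt_not : ∀ x a, a ∉ S → pt x a = t a := fun x a ha => by simp [pt, ha]
    have hzero := eq_zero_of_wheel (J := Y) (ι := S) (v := fun j => t j - t c)
      (fun i j hij => Subtype.ext (ht i.2 j.2 (by simpa using hij))) (fun j => p j) (k := k)
      (by rw [Fintype.card_coe, hk, ← Finset.sum_coe_sort Y p])
      (fun x => MvPolynomial.eval (pt x) G₀) ?_ ?_ ?_ ?_
    · have := hzero (fun i => t i - t c)
      have h2 : pt (fun i => t i - t c) = t := by
        funext a
        by_cases ha : a ∈ S <;> simp [pt, ha]
      simpa only [h2] using this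
    · intro i x
      -- The moving coordinate is put at distance 1 from t_c, so that the scaling parameter is the
      -- coordinate itself.
      refine ⟨(scaleHom {(i : σ)} (MvPolynomial.X c) G₀).map
        (MvPolynomial.eval (pt (Function.update x i 1))), ?_, fun u => ?_⟩
      · rw [Polynomial.degree_lt_iff_coeff_zero]
        intro l hl
        rw [Polynomial.coeff_map, hdeg i i.2 l (by simpa using hl), map_zero]
      · rw [eval_map_scaleHom]
        refine congrArg (fun t => MvPolynomial.eval t G₀) (funext fun a => ?_)
        by_cases hai : a = i
        · subst hai
          simp [hpt_mem, hpt_not _ c hcS]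
        · rw [if_neg (by simpa using hai)]
          by_cases ha : a ∈ S
          · have : (⟨a, ha⟩ : S) ≠ i := fun h => hai (by rw [← h])
            simp [pt, ha, Function.update_of_ne this]
          · simp [pt, ha]
    · intro τ x
      have h1 := hsymm (Equiv.Perm.ofSubtype τ) (fun a ha =>
        Equiv.Perm.ofSubtype_apply_of_not_mem τ ha)
      conv_rhs => rw [← h1]
      rw [MvPolynomial.eval_rename]
      refine congrArg (fun t => MvPolynomial.eval t G₀) (funext fun a => ?_)
      by_cases ha : a ∈ S
      · have h2 : Equiv.Perm.ofSubtype τ a = τ ⟨a, ha⟩ :=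
          Equiv.Perm.ofSubtype_apply_of_mem τ ha
        rw [Function.comp_apply, h2, hpt_mem]
        simp [pt, ha]
      · rw [Function.comp_apply, Equiv.Perm.ofSubtype_apply_of_not_mem τ ha, hpt_not _ _ ha,
          hpt_not _ _ ha]
    · intro j T hT x hx
      refine eval_eq_zero_of_mem_diagIdeal (hwheel j j.2 (T.map (Function.Embedding.subtype _))
        (fun a ha => ?_) (by simpa using hT)) (t j) fun a ha => ?_
      · obtain ⟨i, -, rfl⟩ := Finset.mem_map.mp ha
        exact i.2
      · rcases Finset.mem_insert.mp ha with rfl | ha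
        · exact hpt_not _ _ (Finset.disjoint_left.mp hY j.2)
        · obtain ⟨i, hi, rfl⟩ := Finset.mem_map.mp ha
          have := hpt_mem x i
          rw [hx i hi, add_sub_cancel] at this
          exact this
    · intro K hK x
      have hmemK : ∀ (a : σ) (ha : a ∈ S), a ∈ K.map (Function.Embedding.subtype _) ↔
          (⟨a, ha⟩ : S) ∈ K := by
        intro a ha; simp [ha]
      refine ⟨(scaleHom (K.map (Function.Embedding.subtype _)) (MvPolynomial.X c) G₀).map
        (MvPolynomial.eval (pt fun i => if i ∈ K then 1 else x i)), ?_, fun u => ?_⟩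
      · rw [Polynomial.coeff_map, Fintype.card_coe, htop _ (fun a ha => ?_) (by simpa using hK),
          map_zero]
        obtain ⟨i, -, rfl⟩ := Finset.mem_map.mp ha
        exact i.2
      · rw [eval_map_scaleHom]
        refine congrArg (fun t => MvPolynomial.eval t G₀) (funext fun a => ?_)
        by_cases ha : a ∈ S
        · by_cases haK : (⟨a, ha⟩ : S) ∈ K
          · rw [if_pos ((hmemK a ha).mpr haK)]
            simp [pt, ha, haK, hcS]
          · rw [if_neg (fun h => haK ((hmemK a ha).mp h))]
            simp [pt, ha, haK]
        · rw [if_neg]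
          · simp [pt, ha]
          intro h
          obtain ⟨i, -, rfl⟩ := Finset.mem_map.mp h
          exact ha i.2
  -- Points where two nodes collide are removed by a nonzero polynomial factor vanishing there.
  have h1 : G₀ * ∏ u ∈ Y.offDiag, (MvPolynomial.X u.1 - MvPolynomial.X u.2) = 0 := by
    refine MvPolynomial.funext fun t => ?_
    rw [map_mul, map_zero, map_prod]
    by_cases ht : Set.InjOn t Y
    · rw [main t ht, zero_mul]
    · simp only [Set.InjOn, not_forall] at ht
      obtain ⟨a, ha, b, hb, hab, hne⟩ := ht
      refine mul_eq_zero_of_right _ (Finset.prod_eq_zero (i := (a, b)) ?_ ?_)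
      · exact Finset.mem_offDiag.mpr ⟨ha, hb, hne⟩
      · simp [hab]
  refine (mul_eq_zero.mp h1).resolve_right (Finset.prod_ne_zero_iff.mpr fun u hu => ?_)
  exact X_sub_X_ne_zero (Finset.mem_offDiag.mp hu).2.2

/-- Write F = W G with W the product of the forced factors; n is even, so W is symmetric in S and G
inherits the symmetry of F. Logarithmic order 0 along A puts G in the D-th power of the ideal, and
the task is to show that its part of degree D vanishes. The orders along A \ K bound the degree of
this part in the variables of K: order 0 for one variable gives degree less than |Y|, order 1 for k
variables removes the top coefficient. -/
theorem logOrderGE_one_of_reflection {n n' : ℕ} (hn : n = 2 * n') (hn' : 1 ≤ n')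
    {F : MvPolynomial σ ℂ} {A S Y : Finset σ} (hSA : S ⊆ A) (hYA : Y ⊆ A) (hY : Disjoint Y S)
    {c : σ} (hcA : c ∈ A) (hcS : c ∉ S) {p : σ → ℕ} {k : ℕ}
    (hsymm : ∀ τ : Equiv.Perm σ, (∀ a ∉ S, τ a = a) → MvPolynomial.rename τ F = F)
    (hnbr : ∀ a ∈ S, ∀ b ∈ Y, LogOrderGE n F {a, b} 0)
    (hpair : ∀ a ∈ S, ∀ b ∈ A, b ∉ Y → a ≠ b → LogOrderGE n F {a, b} 1)
    (hA : LogOrderGE n F A 0)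
    (herase : ∀ x ∈ S, LogOrderGE n F (A.erase x) 0)
    (hwheel : ∀ y ∈ Y, ∀ T ⊆ S, T.card = p y + 1 → LogOrderGE n F (insert y T) 1)
    (hk : 2 * S.card = ∑ y ∈ Y, p y + k)
    (htop : ∀ K ⊆ S, K.card = k → LogOrderGE n F (A \ K) 1) : LogOrderGE n F A 1 := by
  classical
  have hU : ∀ u ∈ pairsMeeting A S, u.1 ≠ u.2 := by
    intro u hu h
    rcases mem_pairsMeeting.mp hu with ⟨h1, -, h2⟩ | ⟨-, -, h1⟩
    · exact h2 (h ▸ h1)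
    · exact h1.ne h
  have hU' : ∀ u ∈ pairsMeeting A S, u.1 ∈ A ∧ u.2 ∈ A := by
    intro u hu
    rcases mem_pairsMeeting.mp hu with ⟨h1, h2, -⟩ | ⟨h1, h2, -⟩
    · exact ⟨hSA h1, h2⟩
    · exact ⟨hSA h1, hSA h2⟩
  obtain ⟨G, hG⟩ := prod_X_sub_X_pow_dvd (pairsMeeting A S) hU (fun u hu h => by
      rw [mem_pairsMeeting] at hu h
      simp only [Prod.fst_swap, Prod.snd_swap] at h
      rcases hu with ⟨h1, h2, h3⟩ | ⟨h1, h2, h3⟩ <;> rcases h with ⟨h4, h5, h6⟩ | ⟨h4, h5, h6⟩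
      · exact h3 h4
      · exact h3 h4
      · exact h6 h1
      · exact lt_asymm h3 h6) (pairExp Y n) (F := F) (fun u hu => by
      have hne := hU u hu
      have hcard : ({u.1, u.2} : Finset σ).card = 2 := Finset.card_pair hne
      have hu1 : u.1 ∈ S := by rcases mem_pairsMeeting.mp hu with h | h <;> exact h.1
      unfold pairExp
      split_ifs with huY
      · refine hnbr u.1 hu1 u.2 huY _ ?_
        rw [hcard]; simp; omega
      · refine hpair u.1 hu1 u.2 (hU' u hu).2 huY hne _ ?_
        rw [hcard]; simp; omega)
  set W := ∏ u ∈ pairsMeeting A S, (MvPolynomial.X u.1 - MvPolynomial.X u.2 : MvPolynomial σ ℂ) ^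
    pairExp Y n u with hW
  have hW0 : W ≠ 0 := Finset.prod_ne_zero_iff.mpr fun u hu => pow_ne_zero _ (X_sub_X_ne_zero (hU u hu))
  have hGsymm : ∀ τ : Equiv.Perm σ, (∀ a ∉ S, τ a = a) → MvPolynomial.rename τ G = G := by
    intro τ hτ
    have h1 := hsymm τ hτ
    rw [hG, map_mul, hW, hn, rename_prod_pairsMeeting hY hτ, ← hn, ← hW] at h1
    exact mul_left_cancel₀ hW0 h1
  have hsplit : ∀ B : Finset σ, B.card = (B ∩ S).card + (B \ S).card := fun B =>
    (Finset.card_inter_add_card_sdiff B S).symm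
  -- Order of F minus order of W: of the n * C(|B|, 2) only the pairs inside B \ S remain, and each
  -- pair of B from S and Y gives back one.
  have hGB : ∀ B ⊆ A, B.Nonempty → ∀ δ m, LogOrderGE n F B δ →
      m + B.card ≤ 1 + δ + n * (B \ S).card.choose 2 + (B ∩ S).card * (B ∩ Y).card →
      G ∈ diagIdeal B ^ m := by
    intro B hB hBne δ m hF hm
    refine mem_diagIdeal_pow_of_prod_mul_mem hBne (pairsMeeting A S) hU (pairExp Y n) ?_
    rw [← hW, ← hG]
    refine hF _ ?_
    have h1 := sum_pairOrder hB hY (n := n) (by omega)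
    have h2 := congrArg (n * ·) (choose_two_add (B ∩ S).card (B \ S).card)
    simp only [← hsplit B, mul_add] at h2 h1
    rw [h2]; linarith
  have hsub : A ∩ S = S := Finset.inter_eq_right.mpr hSA
  have hsubY : A ∩ Y = Y := Finset.inter_eq_right.mpr hYA
  have hAc := hsplit A
  rw [hsub] at hAc
  -- The order of G that corresponds to logarithmic order 1 of F along A. If the natural subtraction
  -- yields 0, membership is trivial.
  obtain ⟨D₁, hD₁⟩ : ∃ D₁, D₁ = 2 + n * (A \ S).card.choose 2 + S.card * Y.card - A.card := ⟨_, rfl⟩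
  suffices hGA : G ∈ diagIdeal A ^ D₁ by
    intro m hm
    have h1 := sum_pairOrder (subset_refl A) hY (n := n) (by omega)
    have h2 := congrArg (n * ·) (choose_two_add S.card (A \ S).card)
    have h3 : ∑ u ∈ pairsMeeting A S, pairExp Y n u * pairOrder A u =
        ∑ u ∈ pairsMeeting A S, pairExp Y n u := Finset.sum_congr rfl fun u hu => by
      rw [pairOrder_of_mem (hU' u hu).1 (hU' u hu).2, mul_one]
    rw [hsub, hsubY, h3] at h1
    simp only [← hAc, mul_add] at h2 h1
    refine Ideal.pow_le_pow_right (I := diagIdeal A) (n := ∑ u ∈ pairsMeeting A S, pairExp Y n u + D₁) ?_ ?_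
    · omega
    · rw [hG, pow_add]
      exact Ideal.mul_mem_mul (prod_X_sub_X_mem _ hU' _) hGA
  rcases Nat.eq_zero_or_pos D₁ with h0 | hpos
  · rw [h0]; simp
  obtain ⟨D, rfl⟩ : ∃ D, D₁ = D + 1 := ⟨D₁ - 1, by omega⟩
  have hD : D + A.card = 1 + n * (A \ S).card.choose 2 + S.card * Y.card := by omega
  have hGD : G ∈ diagIdeal A ^ D := hGB A subset_rfl ⟨c, hcA⟩ 0 D hA (by rw [hsub, hsubY]; omega)
  rw [mem_diagIdeal_pow_iff hcA] at hGD ⊢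
  suffices h0 : (scaleHom A (MvPolynomial.X c) G).coeff D = 0 by
    rw [Polynomial.X_pow_dvd_iff] at hGD ⊢
    intro d hd
    rcases Nat.lt_succ_iff_lt_or_eq.mp hd with h | h
    · exact hGD d h
    · rw [h, h0]
  -- Logarithmic order δ along A \ K gives G the order D + |K| + δ - |K||Y| there, so the part of
  -- degree D has degree at most |K||Y| - |K| - δ in the variables of K.
  have hremove : ∀ K ⊆ S, ∀ δ i, LogOrderGE n F (A \ K) δ →
      K.card * Y.card + 1 ≤ i + K.card + δ →
      (scaleHom K (MvPolynomial.X c) ((scaleHom A (MvPolynomial.X c) G).coeff D)).coeff i = 0 := by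
    intro K hK δ i hF hi
    have hne : (A \ K).Nonempty := ⟨c, Finset.mem_sdiff.mpr ⟨hcA, fun h => hcS (hK h)⟩⟩
    have h1 : (A \ K) \ S = A \ S := by
      ext a; simp only [Finset.mem_sdiff]
      exact ⟨fun h => ⟨h.1.1, h.2⟩, fun h => ⟨⟨h.1, fun h' => h.2 (hK h')⟩, h.2⟩⟩
    have h2 : (A \ K) ∩ S = S \ K := by
      ext a; simp only [Finset.mem_sdiff, Finset.mem_inter]
      exact ⟨fun h => ⟨h.2, h.1.2⟩, fun h => ⟨⟨hSA h.1, h.2⟩, h.1⟩⟩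
    have h3 : (A \ K) ∩ Y = Y := by
      ext a; simp only [Finset.mem_sdiff, Finset.mem_inter]
      exact ⟨fun h => h.2, fun h => ⟨⟨hYA h, fun h' => Finset.disjoint_left.mp hY h (hK h')⟩, h⟩⟩
    have h4 : (A \ K).card + K.card = A.card := Finset.card_sdiff_add_card_eq_card (hK.trans hSA)
    have h5 : (S \ K).card + K.card = S.card := Finset.card_sdiff_add_card_eq_card hK
    have h6 : S.card * Y.card = (S \ K).card * Y.card + K.card * Y.card := by rw [← h5]; ring
    have h7 : G ∈ diagIdeal (A \ K) ^ (D + K.card + δ - K.card * Y.card) := by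
      rcases Nat.eq_zero_or_pos (D + K.card + δ - K.card * Y.card) with h | h
      · rw [h]; simp
      · refine hGB _ Finset.sdiff_subset hne δ _ hF ?_
        rw [h1, h2, h3]
        omega
    refine coeff_scaleHom_coeff_scaleHom_eq_zero (hK.trans hSA) Finset.sdiff_subset
      Finset.sdiff_disjoint c h7 i D ?_
    omega
  refine eq_zero_of_leading_conditions (Y := Y) (p := p) (k := k) hcS hY ?_ ?_ ?_ hk ?_
  · intro τ hτ
    have hτA : ∀ a, τ a ∈ A ↔ a ∈ A := by
      have hS : ∀ a ∈ S, τ a ∈ S := fun a ha => by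
        by_contra h
        exact h (by rwa [τ.injective (hτ _ h)])
      intro a
      by_cases ha : a ∈ S
      · exact iff_of_true (hSA (hS a ha)) (hSA ha)
      · rw [hτ a ha]
    have h1 := scaleHom_rename hτA (hτ c hcS) G
    rw [hGsymm τ hτ] at h1
    conv_rhs => rw [h1]
    rw [Polynomial.coeff_map]
    rfl
  · intro x hx i hi
    refine hremove {x} (Finset.singleton_subset_iff.mpr hx) 0 i ?_ (by simpa using hi)
    rw [Finset.sdiff_singleton_eq_erase]
    exact herase x hx
  · intro y hy T hT hTc
    have hyS := Finset.disjoint_left.mp hY hy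
    have hyT : y ∉ T := fun h => hyS (hT h)
    have hB : insert y T ⊆ A := Finset.insert_subset (hYA hy) (hT.trans hSA)
    have h1 : insert y T ∩ S = T := by
      rw [Finset.insert_inter_of_notMem hyS, Finset.inter_eq_left.mpr hT]
    have h2 : insert y T \ S = {y} := by
      rw [Finset.insert_sdiff_of_notMem _ hyS, Finset.sdiff_eq_empty_iff_subset.mpr hT]; rfl
    have h3 : insert y T ∩ Y = {y} := by
      rw [Finset.insert_inter_of_mem hy, Finset.disjoint_iff_inter_eq_empty.mp
        (Finset.disjoint_of_subset_left hT hY.symm)]; rfl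
    have h4 := hGB _ hB ⟨y, Finset.mem_insert_self _ _⟩ 1 1 (hwheel y hy T hT hTc) (by
      rw [h1, h2, h3, Finset.card_insert_of_notMem hyT, hTc]; simp; omega)
    have h5 := coeff_scaleHom_mem hB (MvPolynomial.X c) h4 D
    rwa [pow_one] at h5
  · intro K hK hKc
    refine hremove K hK 1 _ (htop K hK hKc) ?_
    rw [hKc]
    -- For empty Y the exponent k * (|Y| - 1) is 0 by truncation, and the bound still holds.
    rcases Nat.eq_zero_or_pos Y.card with h | h
    · simp [h]
    · obtain ⟨q, hq⟩ : ∃ q, Y.card = q + 1 := ⟨Y.card - 1, by omega⟩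
      rw [hq]; simp [mul_add]

end Reflection

/-! ### The normalized Killing form on roots and weights -/

section Roots

variable {𝔤 : Type*} [LieRing 𝔤] [LieAlgebra ℂ 𝔤] [FiniteDimensional ℂ 𝔤]
  [LieAlgebra.IsSimple ℂ 𝔤] (H : LieSubalgebra ℂ 𝔤) [H.IsCartanSubalgebra]

lemma killingDual_add_left (x y w : Dual ℂ H) :
    killingDual H (x + y) w = killingDual H x w + killingDual H y w := rfl

lemma killingDual_comm (x y : Dual ℂ H) : killingDual H x y = killingDual H y x := by
  have h : ∀ x y : Dual ℂ H, killingDual H x y =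
      LieModule.traceForm ℂ H 𝔤 ((cartanEquivDual H).symm x) ((cartanEquivDual H).symm y) := by
    intro x y
    conv_lhs => rw [← (cartanEquivDual H).apply_symm_apply x]
    unfold killingDual
    rw [cartanEquivDual_apply_apply]; rfl
  rw [h, h, LieModule.traceForm_comm]

/-- The Killing form is a trace: on 𝔥 it is the sum of γ ⊗ γ over the roots. -/
lemma killingDual_eq_sum (x y : Dual ℂ H) : killingDual H x y =
    ∑ γ : H.root, killingDual H ((rootSystem H).root γ) x * killingDual H ((rootSystem H).root γ) y := by
  have h1 : killingDual H x y = (killingForm ℂ 𝔤).restrict H ((cartanEquivDual H).symm x)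
      ((cartanEquivDual H).symm y) := by
    conv_lhs => rw [← (cartanEquivDual H).apply_symm_apply x]
    unfold killingDual
    rw [cartanEquivDual_apply_apply]
    rfl
  rw [h1, restrict_killingForm_eq_sum, ← Finset.sum_coe_sort]
  simp only [LinearMap.sum_apply]
  rfl

lemma killingDual_root_self_ne_zero (α : H.root) :
    killingDual H ((rootSystem H).root α) ((rootSystem H).root α) ≠ 0 :=
  root_apply_cartanEquivDual_symm_ne_zero (LieSubalgebra.isNonZero_coe_root α)

lemma killingDual_root (x : Dual ℂ H) (α : H.root) :
    killingDual H x ((rootSystem H).root α) = x ((rootSystem H).coroot α) *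
      killingDual H ((rootSystem H).root α) ((rootSystem H).root α) / 2 := by
  have h0 := killingDual_root_self_ne_zero H α
  have h1 : (rootSystem H).coroot α =
      2 • (killingDual H ((rootSystem H).root α) ((rootSystem H).root α))⁻¹ •
        (cartanEquivDual H).symm ((rootSystem H).root α) := rfl
  rw [h1, map_nsmul, map_smul]
  change killingDual H x _ = _
  rw [smul_eq_mul]
  change _ = (2 • (_ * killingDual H x _)) * _ / 2
  rw [nsmul_eq_mul]
  field_simp
  push_cast; ring

/-- The sum of the squares of the pairings of the roots with a coroot. -/
noncomputable def corootNorm (α : H.root) : ℝ := ∑ γ : H.root, ((rootSystem H).pairingIn ℤ γ α : ℝ) ^ 2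

lemma pairingIn_eq_apply (γ α : H.root) :
    (rootSystem H).root γ ((rootSystem H).coroot α) = ((rootSystem H).pairingIn ℤ γ α : ℂ) := by
  have := (rootSystem H).algebraMap_pairingIn ℤ γ α
  exact this.symm

/-- Expand (α, α) as the sum of the (γ, α)² and write (γ, α) = γ(α^∨)(α, α)/2: one factor (α, α)
cancels. In particular (α, α) is a positive real number. -/
lemma corootNorm_mul (α : H.root) : (corootNorm H α : ℂ) *
    killingDual H ((rootSystem H).root α) ((rootSystem H).root α) = 4 := by
  have h0 := killingDual_root_self_ne_zero H α
  have h := killingDual_eq_sum H ((rootSystem H).root α) ((rootSystem H).root α)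
  have h2 : ∀ γ : H.root, killingDual H ((rootSystem H).root γ) ((rootSystem H).root α) *
      killingDual H ((rootSystem H).root γ) ((rootSystem H).root α) =
      (((rootSystem H).pairingIn ℤ γ α : ℂ)) ^ 2 *
      (killingDual H ((rootSystem H).root α) ((rootSystem H).root α) ^ 2 / 4) := fun γ => by
    rw [killingDual_root H _ α, pairingIn_eq_apply H _ α]; ring
  rw [Finset.sum_congr rfl fun γ _ => h2 γ, ← Finset.sum_mul] at h
  have h3 : (corootNorm H α : ℂ) = ∑ γ : H.root, (((rootSystem H).pairingIn ℤ γ α : ℂ)) ^ 2 := by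
    unfold corootNorm; push_cast; rfl
  rw [h3]
  set C := ∑ γ : H.root, (((rootSystem H).pairingIn ℤ γ α : ℂ)) ^ 2
  set q := killingDual H ((rootSystem H).root α) ((rootSystem H).root α)
  have h4 : q * (C * q - 4) = 0 := by linear_combination -4 * h
  have := (mul_eq_zero.mp h4).resolve_left h0
  linear_combination this

lemma corootNorm_pos (α : H.root) : 0 < corootNorm H α := by
  refine Finset.sum_pos' (fun _ _ => sq_nonneg _) ⟨α, Finset.mem_univ _, ?_⟩
  rw [RootPairing.pairingIn_same]; norm_num

lemma killingDual_root_self (α : H.root) :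
    killingDual H ((rootSystem H).root α) ((rootSystem H).root α) = ((4 / corootNorm H α : ℝ) : ℂ) := by
  have h := corootNorm_mul H α
  have h1 : (corootNorm H α : ℂ) ≠ 0 := Complex.ofReal_ne_zero.mpr (corootNorm_pos H α).ne'
  push_cast
  rw [eq_div_iff h1, mul_comm, h]

variable (θ : H.root)

lemma normForm_eq (x y : Dual ℂ H) :
    normForm H θ x y = corootNorm H θ / 2 * (killingDual H x y).re := by
  unfold normForm
  rw [killingDual_root_self]
  have h1 : (corootNorm H θ : ℂ) ≠ 0 := Complex.ofReal_ne_zero.mpr (corootNorm_pos H θ).ne'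
  have : 2 * killingDual H x y / ((4 / corootNorm H θ : ℝ) : ℂ) =
      ((corootNorm H θ / 2 : ℝ) : ℂ) * killingDual H x y := by
    push_cast; field_simp; ring
  rw [this, Complex.re_ofReal_mul]

lemma normForm_comm (x y : Dual ℂ H) : normForm H θ x y = normForm H θ y x := by
  rw [normForm_eq, normForm_eq, killingDual_comm]

lemma normForm_add_left (x y w : Dual ℂ H) :
    normForm H θ (x + y) w = normForm H θ x w + normForm H θ y w := by
  simp only [normForm_eq, killingDual_add_left, Complex.add_re]; ring

lemma normForm_zero_left (w : Dual ℂ H) : normForm H θ 0 w = 0 := by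
  have := normForm_add_left H θ 0 0 w
  rw [add_zero] at this; linarith

lemma normForm_sub_left (x y w : Dual ℂ H) :
    normForm H θ (x - y) w = normForm H θ x w - normForm H θ y w := by
  have := normForm_add_left H θ (x - y) y w
  rw [sub_add_cancel] at this; linarith

lemma normForm_add_right (x y w : Dual ℂ H) :
    normForm H θ w (x + y) = normForm H θ w x + normForm H θ w y := by
  simp only [normForm_comm H θ w, normForm_add_left]

lemma normForm_sub_right (x y w : Dual ℂ H) :
    normForm H θ w (x - y) = normForm H θ w x - normForm H θ w y := by
  simp only [normForm_comm H θ w, normForm_sub_left]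

lemma normForm_sum_left {ι : Type*} (A : Finset ι) (f : ι → Dual ℂ H) (w : Dual ℂ H) :
    normForm H θ (∑ a ∈ A, f a) w = ∑ a ∈ A, normForm H θ (f a) w := by
  classical
  induction A using Finset.induction_on with
  | empty => simp [normForm_zero_left]
  | insert a A ha ih => rw [Finset.sum_insert ha, Finset.sum_insert ha, normForm_add_left, ih]

lemma normForm_sum_right {ι : Type*} (A : Finset ι) (f : ι → Dual ℂ H) (w : Dual ℂ H) :
    normForm H θ w (∑ a ∈ A, f a) = ∑ a ∈ A, normForm H θ w (f a) := by
  simp only [normForm_comm H θ w, normForm_sum_left]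

/-- The squared length of a root. -/
noncomputable def rootLen (α : H.root) : ℝ :=
  normForm H θ ((rootSystem H).root α) ((rootSystem H).root α)

lemma rootLen_eq (α : H.root) : rootLen H θ α = 2 * corootNorm H θ / corootNorm H α := by
  rw [rootLen, normForm_eq, killingDual_root_self, Complex.ofReal_re]; ring

lemma rootLen_pos (α : H.root) : 0 < rootLen H θ α := by
  rw [rootLen_eq]
  have := corootNorm_pos H θ
  have := corootNorm_pos H α
  positivity

lemma rootLen_self : rootLen H θ θ = 2 := by
  rw [rootLen_eq]
  have := corootNorm_pos H θ
  field_simp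

lemma normForm_root {x : Dual ℂ H} {α : H.root} {m : ℝ}
    (hm : x ((rootSystem H).coroot α) = m) :
    normForm H θ x ((rootSystem H).root α) = m * rootLen H θ α / 2 := by
  rw [normForm_eq, killingDual_root, killingDual_root_self, hm, rootLen_eq]
  rw [show ((m : ℂ) * ((4 / corootNorm H α : ℝ) : ℂ) / 2) = ((m * (4 / corootNorm H α) / 2 : ℝ) : ℂ) by
    push_cast; ring, Complex.ofReal_re]
  ring

lemma normForm_root_root (γ α : H.root) :
    normForm H θ ((rootSystem H).root γ) ((rootSystem H).root α) =
      (rootSystem H).pairingIn ℤ γ α * rootLen H θ α / 2 :=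
  normForm_root H θ (by rw [pairingIn_eq_apply]; simp)

/-- The elements of `𝔥*` with integral values on the coroots. -/
def IsIntegralWeight (x : Dual ℂ H) : Prop :=
  ∀ α : H.root, ∃ m : ℤ, x ((rootSystem H).coroot α) = m

lemma isIntegralWeight_sum {ι : Type*} (A : Finset ι) (f : ι → H.root) :
    IsIntegralWeight H (∑ a ∈ A, (rootSystem H).root (f a)) := fun α =>
  ⟨∑ a ∈ A, (rootSystem H).pairingIn ℤ (f a) α, by
    rw [LinearMap.sum_apply]; push_cast
    exact Finset.sum_congr rfl fun a _ => pairingIn_eq_apply H _ _⟩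

/-- For integral x all (γ, x) are real, so (x, x) is a sum of real squares. It vanishes only if x
kills every coroot, and the coroots span 𝔥. -/
lemma normForm_self_pos {x : Dual ℂ H} (hx : IsIntegralWeight H x) (h0 : x ≠ 0) :
    0 < normForm H θ x x := by
  choose m hm using hx
  have h1 : ∀ γ, killingDual H ((rootSystem H).root γ) x =
      ((m γ * (4 / corootNorm H γ) / 2 : ℝ) : ℂ) := by
    intro γ
    rw [killingDual_comm, killingDual_root, killingDual_root_self, hm]; push_cast; ring
  have h2 : (killingDual H x x).re = ∑ γ : H.root, (m γ * (4 / corootNorm H γ) / 2 : ℝ) ^ 2 := by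
    rw [killingDual_eq_sum]
    simp only [h1, ← Complex.ofReal_mul, ← Complex.ofReal_sum, Complex.ofReal_re, sq]
  have h3 : ∃ γ, m γ ≠ 0 := by
    by_contra! h
    refine h0 ?_
    have hspan : ∀ v ∈ Submodule.span ℂ (Set.range (rootSystem H).coroot), x v = 0 := by
      intro v hv
      induction hv using Submodule.span_induction with
      | mem v hv => obtain ⟨γ, rfl⟩ := hv; rw [hm, h]; simp
      | zero => simp
      | add v w _ _ hv hw => rw [map_add, hv, hw, add_zero]
      | smul c v _ hv => rw [map_smul, hv, smul_zero]
    ext v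
    exact hspan v (by rw [RootPairing.IsRootSystem.span_coroot_eq_top]; trivial)
  obtain ⟨γ, hγ⟩ := h3
  rw [normForm_eq, h2]
  have hC := corootNorm_pos H θ
  refine mul_pos (by positivity) (Finset.sum_pos' (fun _ _ => sq_nonneg _) ⟨γ, Finset.mem_univ _, ?_⟩)
  have h4 := corootNorm_pos H γ
  have h5 : (m γ : ℝ) ≠ 0 := by exact_mod_cast hγ
  positivity

lemma rootLen_reflectionPerm (i γ : H.root) :
    rootLen H θ ((rootSystem H).reflectionPerm i γ) = rootLen H θ γ := by
  have h := RootPairing.root_reflectionPerm (rootSystem H) i γ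
  have h1 : (rootSystem H).root ((rootSystem H).reflectionPerm i γ) = (rootSystem H).root γ -
      ((rootSystem H).pairingIn ℤ γ i : ℂ) • (rootSystem H).root i := by
    rw [h, RootPairing.reflection_apply, ← pairingIn_eq_apply]; rfl
  have h2 : rootLen H θ ((rootSystem H).reflectionPerm i γ) = corootNorm H θ / 2 *
      (killingDual H ((rootSystem H).root ((rootSystem H).reflectionPerm i γ))
        ((rootSystem H).root ((rootSystem H).reflectionPerm i γ))).re := normForm_eq H θ _ _
  have h3 : rootLen H θ γ = corootNorm H θ / 2 *
      (killingDual H ((rootSystem H).root γ) ((rootSystem H).root γ)).re := normForm_eq H θ _ _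
  rw [h2, h3]
  congr 2
  set u := (rootSystem H).root γ
  set v := (rootSystem H).root i
  set m : ℂ := ((rootSystem H).pairingIn ℤ γ i : ℂ)
  have hs : ∀ x w : Dual ℂ H, killingDual H (x - m • v) w = killingDual H x w - m * killingDual H v w :=
    fun x w => by
      simp [killingDual]
  have huv : killingDual H u v = m * killingDual H v v / 2 := by
    rw [killingDual_root, pairingIn_eq_apply]
  rw [h1, hs, killingDual_comm H u, hs, killingDual_comm H v (u - m • v), hs, killingDual_comm H v u,
    huv]
  ring

end Roots

/-! ### The highest root and the dual Coxeter number -/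

section HighestRoot

variable {𝔤 : Type*} [LieRing 𝔤] [LieAlgebra ℂ 𝔤] [FiniteDimensional ℂ 𝔤]
  [LieAlgebra.IsSimple ℂ 𝔤] (H : LieSubalgebra ℂ 𝔤) [H.IsCartanSubalgebra]
  (b : (rootSystem H).Base) (θ : H.root)

/-- The cone generated by the simple roots. -/
abbrev simpleCone : AddSubmonoid (Dual ℂ H) :=
  AddSubmonoid.closure ((rootSystem H).root '' b.support)

/-- The functional is the height. It shows that negative multiples of a simple root are outside the
cone. -/
lemma exists_nat_of_mem_simpleCone {v : Dual ℂ H} (hv : v ∈ simpleCone H b) :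
    ∃ n : ℕ, b.toWeightBasis.constr ℂ (fun _ => (1 : ℂ)) v = n := by
  induction hv using AddSubmonoid.closure_induction with
  | mem v hv =>
    obtain ⟨i, hi, rfl⟩ := hv
    refine ⟨1, ?_⟩
    have := b.toWeightBasis.constr_basis ℂ (fun _ => (1 : ℂ)) ⟨i, hi⟩
    rw [RootPairing.Base.toWeightBasis_apply] at this
    rw [this, Nat.cast_one]
  | zero => exact ⟨0, by simp⟩
  | add v w _ _ hv hw =>
    obtain ⟨n, hn⟩ := hv
    obtain ⟨m, hm⟩ := hw
    exact ⟨n + m, by rw [map_add, hn, hm, Nat.cast_add]⟩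

lemma normForm_nonneg_of_mem_simpleCone {w v : Dual ℂ H}
    (hw : ∀ i ∈ b.support, 0 ≤ normForm H θ w ((rootSystem H).root i)) (hv : v ∈ simpleCone H b) :
    0 ≤ normForm H θ w v := by
  induction hv using AddSubmonoid.closure_induction with
  | mem v hv => obtain ⟨i, hi, rfl⟩ := hv; exact hw i hi
  | zero => rw [normForm_comm, normForm_zero_left]
  | add v u _ _ hv hu => rw [normForm_add_right]; exact add_nonneg hv hu

lemma root_reflectionPerm_eq (i γ : H.root) :
    (rootSystem H).root ((rootSystem H).reflectionPerm i γ) =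
      (rootSystem H).root γ + (-(rootSystem H).pairingIn ℤ γ i) • (rootSystem H).root i := by
  rw [RootPairing.root_reflectionPerm, RootPairing.reflection_apply_root' ℤ, neg_smul,
    sub_eq_add_neg]

variable {H b θ}

/-- If the pairing were negative, θ - s_i θ would be a negative multiple of the simple root,
although it lies in the simple cone. -/
lemma IsHighestRoot.pairingIn_nonneg (hθ : IsHighestRoot H b θ) {i : H.root} (hi : i ∈ b.support) :
    0 ≤ (rootSystem H).pairingIn ℤ θ i := by
  by_contra! hneg
  have h1 := hθ ((rootSystem H).reflectionPerm i θ)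
  rw [root_reflectionPerm_eq, sub_add_cancel_left] at h1
  obtain ⟨n, hn⟩ := exists_nat_of_mem_simpleCone H b h1
  have := b.toWeightBasis.constr_basis ℂ (fun _ => (1 : ℂ)) ⟨i, hi⟩
  rw [RootPairing.Base.toWeightBasis_apply] at this
  rw [map_neg, map_zsmul, this] at hn
  have h2 : (((rootSystem H).pairingIn ℤ θ i : ℤ) : ℂ) = ((n : ℤ) : ℂ) := by
    rw [Int.cast_natCast, ← hn]; simp
  have h3 : (rootSystem H).pairingIn ℤ θ i = n := by exact_mod_cast h2
  omega

lemma normForm_root_nonneg {γ i : H.root} (h : 0 ≤ (rootSystem H).pairingIn ℤ γ i) :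
    0 ≤ normForm H θ ((rootSystem H).root γ) ((rootSystem H).root i) := by
  rw [normForm_root_root]
  have := rootLen_pos H θ i
  have : (0 : ℝ) ≤ (rootSystem H).pairingIn ℤ γ i := by exact_mod_cast h
  positivity

/-- The highest root is long. -/
lemma IsHighestRoot.rootLen_le_two (hθ : IsHighestRoot H b θ) (α : H.root) :
    rootLen H θ α ≤ 2 := by
  classical
  -- Among the roots as long as α one of maximal height is dominant: a simple reflection with
  -- negative pairing would raise the height and keep the length.
  obtain ⟨γ, hγ, hmax⟩ := Finset.exists_max_image
    (Finset.univ.filter fun γ : H.root => rootLen H θ γ = rootLen H θ α) b.height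
    ⟨α, by simp⟩
  simp only [Finset.mem_filter, Finset.mem_univ, true_and] at hγ hmax
  have hdom : ∀ i ∈ b.support, 0 ≤ (rootSystem H).pairingIn ℤ γ i := by
    intro i hi
    by_contra! hneg
    have h1 := hmax _ ((rootLen_reflectionPerm H θ i γ).trans hγ)
    rw [b.height_add_zsmul (root_reflectionPerm_eq H i γ),
      RootPairing.Base.height_one_of_mem_support hi] at h1
    simp at h1
    omega
  -- Pairing θ - γ with the dominant γ and θ gives (γ, γ) ≤ (γ, θ) ≤ (θ, θ) = 2.
  have h1 := normForm_nonneg_of_mem_simpleCone H b θ (w := (rootSystem H).root γ)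
    (fun i hi => normForm_root_nonneg (hdom i hi)) (hθ γ)
  have h2 := normForm_nonneg_of_mem_simpleCone H b θ (w := (rootSystem H).root θ)
    (fun i hi => normForm_root_nonneg (hθ.pairingIn_nonneg hi)) (hθ γ)
  rw [normForm_sub_right] at h1 h2
  have h3 := rootLen_self H θ
  rw [← hγ]
  unfold rootLen at h3 ⊢
  rw [normForm_comm H θ ((rootSystem H).root γ) ((rootSystem H).root θ)] at h1
  linarith

variable (H b) in
open Classical in
/-- The sum of the positive roots. -/
noncomputable def twoRho : Dual ℂ H :=
  ∑ γ : H.root with b.IsPos γ, (rootSystem H).root γ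

open Classical in
-- The simple reflection permutes the positive roots other than the simple root i and negates their
-- pairings with its coroot, so only the term of i survives.
lemma sum_pairingIn_simple {i : H.root} (hi : i ∈ b.support) :
    ∑ γ : H.root with b.IsPos γ, (rootSystem H).pairingIn ℤ γ i = 2 := by
  have hipos : b.IsPos i := RootPairing.Base.isPos_of_mem_support hi
  rw [← Finset.add_sum_erase _ _ (a := i) (by simpa using hipos), RootPairing.pairingIn_same]
  have hneg : ∀ γ, (rootSystem H).pairingIn ℤ ((rootSystem H).reflectionPerm i γ) i =
      - (rootSystem H).pairingIn ℤ γ i := fun γ => by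
    have h1 := pairingIn_eq_apply H ((rootSystem H).reflectionPerm i γ) i
    rw [root_reflectionPerm_eq, LinearMap.add_apply, pairingIn_eq_apply, LinearMap.smul_apply,
      pairingIn_eq_apply, RootPairing.pairingIn_same] at h1
    have h2 : (rootSystem H).pairingIn ℤ γ i + -(rootSystem H).pairingIn ℤ γ i * 2 =
      (rootSystem H).pairingIn ℤ ((rootSystem H).reflectionPerm i γ) i := by
      have h3 : (((rootSystem H).pairingIn ℤ γ i + -(rootSystem H).pairingIn ℤ γ i * 2 : ℤ) : ℂ) =
        (((rootSystem H).pairingIn ℤ ((rootSystem H).reflectionPerm i γ) i : ℤ) : ℂ) := by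
        rw [← h1]; push_cast; simp
      exact_mod_cast h3
    rw [← h2]; ring
  have hinv : ∀ γ, (rootSystem H).reflectionPerm i ((rootSystem H).reflectionPerm i γ) = γ :=
    fun γ => by simp
  have hmem : ∀ γ ∈ (Finset.univ.filter fun γ : H.root => b.IsPos γ).erase i,
      (rootSystem H).reflectionPerm i γ ∈
        (Finset.univ.filter fun γ : H.root => b.IsPos γ).erase i := by
    intro γ hγ
    simp only [Finset.mem_erase, Finset.mem_filter, Finset.mem_univ, true_and] at hγ ⊢
    refine ⟨fun h => ?_, hγ.2.reflectionPerm hi hγ.1⟩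
    have h1 := root_reflectionPerm_eq H i γ
    have h2 := b.height_add_zsmul h1
    have h3 := hneg γ
    rw [h, RootPairing.pairingIn_same] at h3
    rw [h, RootPairing.Base.height_one_of_mem_support hi] at h2
    have h4 : 0 < b.height γ := hγ.2
    simp at h2
    omega
  have hsum := Finset.sum_nbij' (s := (Finset.univ.filter fun γ : H.root => b.IsPos γ).erase i)
    (t := (Finset.univ.filter fun γ : H.root => b.IsPos γ).erase i)
    (f := fun γ => (rootSystem H).pairingIn ℤ γ i)
    (g := fun γ => - (rootSystem H).pairingIn ℤ γ i)
    ((rootSystem H).reflectionPerm i) ((rootSystem H).reflectionPerm i) hmem hmem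
    (fun γ _ => hinv γ) (fun γ _ => hinv γ) (fun γ _ => by rw [hneg, neg_neg])
  rw [Finset.sum_neg_distrib] at hsum
  omega

lemma normForm_twoRho_simple {i : H.root} (hi : i ∈ b.support) :
    normForm H θ (twoRho H b) ((rootSystem H).root i) = rootLen H θ i := by
  classical
  have h : (twoRho H b) ((rootSystem H).coroot i) = ((2 : ℝ) : ℂ) := by
    rw [twoRho, LinearMap.sum_apply, Finset.sum_congr rfl fun γ _ => pairingIn_eq_apply H γ i,
      ← Int.cast_sum, sum_pairingIn_simple hi]
    simp
  rw [normForm_root H θ h]; ring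

/-- As (θ, θ) = 2, pairing with the coroot of θ is the form with θ. -/
lemma dualCoxeter_eq : dualCoxeter H b θ =
    1 + normForm H θ (twoRho H b) ((rootSystem H).root θ) / 2 := by
  classical
  rw [twoRho, normForm_sum_left, dualCoxeter]
  simp only [normForm_root_root, rootLen_self]
  congr 2
  refine Finset.sum_congr rfl fun γ _ => by ring

/-- From (2ρ, α_i) = (α_i, α_i) the sum of squared lengths is (2ρ, γ). It is at most (2ρ, θ) = 2(g*
- 1), since θ - γ is in the simple cone. -/
lemma IsHighestRoot.half_sum_rootLen_le (hθ : IsHighestRoot H b θ) {ι : Type*} (A : Finset ι)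
    (β : ι → b.support) {γ : H.root}
    (hγ : (rootSystem H).root γ = ∑ a ∈ A, (rootSystem H).root (β a)) :
    (∑ a ∈ A, rootLen H θ (β a)) / 2 ≤ dualCoxeter H b θ - 1 := by
  have h1 := normForm_nonneg_of_mem_simpleCone H b θ (w := twoRho H b)
    (fun i hi => by rw [normForm_twoRho_simple hi]; exact (rootLen_pos H θ i).le) (hθ γ)
  rw [normForm_sub_right, hγ, normForm_sum_right,
    Finset.sum_congr rfl fun a _ => normForm_twoRho_simple (θ := θ) (β a).2] at h1
  rw [dualCoxeter_eq]
  linarith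

lemma IsHighestRoot.one_le_dualCoxeter (hθ : IsHighestRoot H b θ) (i : b.support) :
    1 ≤ dualCoxeter H b θ := by
  have h := hθ.half_sum_rootLen_le {()} (fun _ => i) (γ := i) (by simp)
  have := rootLen_pos H θ i
  simp only [Finset.sum_singleton] at h
  linarith

lemma IsHighestRoot.normForm_levelWeight_le (hθ : IsHighestRoot H b θ) {k : ℕ} {lam : Dual ℂ H}
    (hlam : lam ∈ levelWeights H b θ k) (γ : H.root) :
    normForm H θ lam ((rootSystem H).root γ) ≤ k := by
  have h1 := normForm_nonneg_of_mem_simpleCone H b θ (w := lam) (fun i hi => by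
    obtain ⟨m, hm⟩ := hlam.1 i hi
    rw [normForm_root H θ (m := m) (by rw [hm]; simp)]
    have := rootLen_pos H θ i
    positivity) (hθ γ)
  rw [normForm_sub_right] at h1
  linarith [hlam.2]

end HighestRoot

/-! ### Square integrability and orders of vanishing -/

section Integrability

variable {M : ℕ}

/-- Scaling of the coordinates in `A` towards the center `c`. -/
noncomputable def scaleMap (A : Finset (Fin M)) (c : MvPolynomial (Fin M) ℂ) (ε : ℝ)
    (t : Fin M → ℂ) : Fin M → ℂ :=
  fun a => if a ∈ A then MvPolynomial.eval t c + ε * (t a - MvPolynomial.eval t c) else t a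

lemma continuous_scaleMap (A : Finset (Fin M)) (c : MvPolynomial (Fin M) ℂ) (ε : ℝ) :
    Continuous (scaleMap A c ε) := by
  refine continuous_pi fun a => ?_
  unfold scaleMap
  have := MvPolynomial.continuous_eval c
  split_ifs <;> fun_prop

lemma continuous_eval_map (P : Polynomial (MvPolynomial (Fin M) ℂ)) :
    Continuous fun x : ℝ × (Fin M → ℂ) => (P.map (MvPolynomial.eval x.2)).eval (x.1 : ℂ) := by
  simp only [Polynomial.eval_map, Polynomial.eval₂_eq_sum_range]
  refine continuous_finsetSum _ fun k _ => ?_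
  have := MvPolynomial.continuous_eval (P.coeff k)
  fun_prop

open Topology Filter in
-- On the image of a small ball under scaling by ε the integrand is at least a constant times ε to
-- the power 2 Σ r_i v_i, and this image has volume proportional to ε^(2w). If Σ r_i v_i + w ≤ 0,
-- the integrals over the images stay bounded below while the volumes tend to 0, against absolute
-- continuity of the integral.
theorem sum_order_pos_of_integrableOn {ι : Type*} [Fintype ι] {A : Finset (Fin M)}
    {c : MvPolynomial (Fin M) ℂ} (L : ι → MvPolynomial (Fin M) ℂ) (r : ι → ℝ) (v : ι → ℕ)
    (L' : ι → Polynomial (MvPolynomial (Fin M) ℂ))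
    (hL : ∀ i, scaleHom A c (L i) = Polynomial.X ^ v i * L' i) (hL0 : ∀ i, (L' i).coeff 0 ≠ 0)
    {Ω : Set (Fin M → ℂ)} (hΩ : ∀ t, (∀ i, MvPolynomial.eval t (L i) ≠ 0) → t ∈ Ω)
    (hint : IntegrableOn (fun t => (∏ i, ‖MvPolynomial.eval t (L i)‖ ^ r i) ^ 2) Ω volume)
    {w : ℕ} (hw : 1 ≤ w)
    (hvol : ∀ ε : ℝ, 0 < ε → ∀ U, volume (scaleMap A c ε '' U) =
      ENNReal.ofReal (ε ^ (2 * w)) * volume U) :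
    0 < ∑ i, r i * v i + w := by
  by_contra! hS
  set g : (Fin M → ℂ) → ℝ := fun t => ∏ i, ‖MvPolynomial.eval t (L i)‖ ^ r i with hg
  let Q : ι → ℝ × (Fin M → ℂ) → ℂ := fun i x => ((L' i).map (MvPolynomial.eval x.2)).eval (x.1 : ℂ)
  have hQc : ∀ i, Continuous (Q i) := fun i => continuous_eval_map (L' i)
  -- A point where the leading coefficients of all factors are nonzero; the ball is taken around it.
  obtain ⟨t₀, ht₀⟩ : ∃ t₀, ∀ i, Q i (0, t₀) ≠ 0 := by
    have h1 : ∏ i, (L' i).coeff 0 ≠ 0 := Finset.prod_ne_zero_iff.mpr fun i _ => hL0 i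
    obtain ⟨t₀, ht₀⟩ : ∃ t₀, MvPolynomial.eval t₀ (∏ i, (L' i).coeff 0) ≠ 0 := by
      by_contra! h
      exact h1 (MvPolynomial.funext fun t => by rw [h, map_zero])
    rw [map_prod, Finset.prod_ne_zero_iff] at ht₀
    refine ⟨t₀, fun i => ?_⟩
    have : Q i (0, t₀) = MvPolynomial.eval t₀ ((L' i).coeff 0) := by
      simp only [Q, Complex.ofReal_zero]
      rw [← Polynomial.coeff_zero_eq_eval_zero, Polynomial.coeff_map]
    rw [this]
    exact ht₀ i (Finset.mem_univ i)
  let G : ℝ × (Fin M → ℂ) → ℝ := fun x => ∏ i, ‖Q i x‖ ^ r i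
  have hG0 : 0 < G (0, t₀) := Finset.prod_pos fun i _ =>
    Real.rpow_pos_of_pos (norm_pos_iff.mpr (ht₀ i)) _
  have hGc : ContinuousAt G (0, t₀) := by
    refine tendsto_finsetProd _ fun i _ => ?_
    exact (hQc i).norm.continuousAt.rpow_const (Or.inl (norm_ne_zero_iff.mpr (ht₀ i)))
  have hev : ∀ᶠ x in 𝓝 ((0 : ℝ), t₀), G (0, t₀) / 2 < G x ∧ ∀ i, Q i x ≠ 0 := by
    refine (hGc.eventually (lt_mem_nhds (half_lt_self hG0))).and ?_
    rw [eventually_all]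
    exact fun i => (hQc i).continuousAt.eventually_ne (ht₀ i)
  rw [nhds_prod_eq] at hev
  obtain ⟨P₁, hP₁, P₂, hP₂, hP⟩ := eventually_prod_iff.mp hev
  obtain ⟨δ, hδ, hball⟩ := Metric.nhds_basis_closedBall.eventually_iff.mp hP₂
  set U := Metric.closedBall t₀ δ
  set C := G (0, t₀) / 2
  have hC : 0 < C := half_pos hG0
  have hU0 : volume U ≠ 0 := (Metric.measure_closedBall_pos volume t₀ hδ).ne'
  have hUtop : volume U ≠ ⊤ := measure_closedBall_lt_top.ne
  -- the value of `g` on the image of the scaling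
  have hval : ∀ ε : ℝ, 0 < ε → ∀ t i, MvPolynomial.eval (scaleMap A c ε t) (L i) =
      (ε : ℂ) ^ v i * Q i (ε, t) := by
    intro ε hε t i
    have h1 := eval_map_scaleHom_center A c (L i) t (ε : ℂ)
    rw [hL, Polynomial.map_mul, Polynomial.eval_mul] at h1
    simp only [Polynomial.map_pow, Polynomial.map_X, Polynomial.eval_pow, Polynomial.eval_X] at h1
    exact h1.symm
  have hgval : ∀ ε : ℝ, 0 < ε → ∀ t, g (scaleMap A c ε t) = ε ^ (∑ i, r i * v i) * G (ε, t) := by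
    intro ε hε t
    simp only [hg, G, hval ε hε t]
    rw [Real.rpow_sum_of_pos hε, ← Finset.prod_mul_distrib]
    refine Finset.prod_congr rfl fun i _ => ?_
    rw [norm_mul, norm_pow, Complex.norm_real, Real.norm_of_nonneg hε.le,
      Real.mul_rpow (by positivity) (norm_nonneg _), ← Real.rpow_natCast, ← Real.rpow_mul hε.le,
      mul_comm (r i)]
  have hfin : ∫⁻ t, ENNReal.ofReal (g t ^ 2) ∂(volume.restrict Ω) ≠ ⊤ := by
    have := hint.2
    rw [hasFiniteIntegral_iff_ofReal (ae_of_all _ fun t => sq_nonneg _)] at this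
    exact this.ne
  have hbound : ENNReal.ofReal (C ^ 2) * volume U ≠ 0 :=
    mul_ne_zero (by simpa using hC.ne') hU0
  obtain ⟨η, hη, hsmall⟩ := exists_pos_setLIntegral_lt_of_measure_lt hfin hbound
  -- choose a small scaling parameter
  have hlim : Tendsto (fun ε : ℝ => ENNReal.ofReal (ε ^ (2 * w)) * volume U) (𝓝 0) (𝓝 0) := by
    have h1 : Tendsto (fun ε : ℝ => ENNReal.ofReal (ε ^ (2 * w))) (𝓝 0) (𝓝 0) := by
      have : Continuous fun ε : ℝ => ENNReal.ofReal (ε ^ (2 * w)) :=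
        ENNReal.continuous_ofReal.comp (continuous_pow _)
      have h2 := this.tendsto 0
      rwa [zero_pow (by omega), ENNReal.ofReal_zero] at h2
    have h2 := ENNReal.Tendsto.mul_const (b := volume U) h1 (Or.inr hUtop)
    rwa [zero_mul] at h2
  have hev2 : ∀ᶠ ε : ℝ in 𝓝[>] 0, 0 < ε ∧ ε < 1 ∧ P₁ ε ∧
      ENNReal.ofReal (ε ^ (2 * w)) * volume U < η := by
    refine eventually_mem_nhdsWithin.and ?_
    refine Filter.Eventually.filter_mono nhdsWithin_le_nhds ?_
    exact (gt_mem_nhds one_pos).and (hP₁.and (hlim.eventually (gt_mem_nhds hη)))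
  obtain ⟨ε, hε, hε1, hεP, hεη⟩ := hev2.exists
  set s := scaleMap A c ε '' U
  have hsΩ : s ⊆ Ω := by
    rintro _ ⟨t, ht, rfl⟩
    refine hΩ _ fun i => ?_
    rw [hval ε hε]
    exact mul_ne_zero (pow_ne_zero _ (Complex.ofReal_ne_zero.mpr hε.ne'))
      ((hP hεP (hball ht)).2 i)
  have hsmeas : MeasurableSet s :=
    ((isCompact_closedBall t₀ δ).image (continuous_scaleMap A c ε)).measurableSet
  have h1 := hsmall s (lt_of_le_of_lt (Measure.restrict_apply_le _ _) (by rwa [hvol ε hε]))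
  rw [Measure.restrict_restrict_of_subset hsΩ] at h1
  refine absurd h1 (not_lt.mpr ?_)
  set S := ∑ i, r i * (v i : ℝ)
  have hlow : ∀ t ∈ s, ENNReal.ofReal (ε ^ (2 * S) * C ^ 2) ≤ ENNReal.ofReal (g t ^ 2) := by
    rintro _ ⟨t, ht, rfl⟩
    refine ENNReal.ofReal_le_ofReal ?_
    rw [hgval ε hε, mul_pow, ← Real.rpow_natCast (ε ^ S), ← Real.rpow_mul hε.le, mul_comm S]
    have h2 := (hP hεP (hball ht)).1.le
    have := Real.rpow_pos_of_pos hε (2 * S)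
    push_cast
    gcongr
  calc ENNReal.ofReal (C ^ 2) * volume U
      ≤ ENNReal.ofReal (ε ^ (2 * S) * C ^ 2) * (ENNReal.ofReal (ε ^ (2 * w)) * volume U) := by
        rw [← mul_assoc]
        refine mul_le_mul_left ?_ _
        rw [← ENNReal.ofReal_mul (by positivity)]
        refine ENNReal.ofReal_le_ofReal ?_
        have h3 : (1 : ℝ) ≤ ε ^ (2 * S) * ε ^ (2 * w) := by
          rw [← Real.rpow_natCast, ← Real.rpow_add hε]
          refine Real.one_le_rpow_of_pos_of_le_one_of_nonpos hε hε1.le ?_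
          push_cast; linarith
        nlinarith [sq_nonneg C]
    _ = ∫⁻ _ in s, ENNReal.ofReal (ε ^ (2 * S) * C ^ 2) := by
        rw [setLIntegral_const, hvol ε hε]
    _ ≤ ∫⁻ t in s, ENNReal.ofReal (g t ^ 2) := setLIntegral_mono' hsmeas hlow

lemma volume_image_restrictScalars (f : (Fin M → ℂ) →ₗ[ℂ] (Fin M → ℂ)) (U : Set (Fin M → ℂ)) :
    volume (f '' U) = ENNReal.ofReal (‖LinearMap.det f‖ ^ 2) * volume U := by
  have h := Measure.addHaar_image_linearMap volume (f.restrictScalars ℝ) U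
  have h2 : LinearMap.det (f.restrictScalars ℝ) = ‖LinearMap.det f‖ ^ 2 := by
    rw [LinearMap.det_restrictScalars, Algebra.norm_complex_eq]
    exact Complex.normSq_eq_norm_sq _
  rw [h2, abs_of_nonneg (by positivity)] at h
  exact h

lemma det_diag_scale (A : Finset (Fin M)) (ε : ℂ) :
    LinearMap.det (Matrix.toLin' (Matrix.diagonal fun a : Fin M => if a ∈ A then ε else 1)) =
      ε ^ A.card := by
  rw [LinearMap.det_toLin', Matrix.det_diagonal, Finset.prod_ite_mem]
  simp

lemma volume_image_scaleMap_const (A : Finset (Fin M)) (z : ℂ) {ε : ℝ} (hε : 0 < ε)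
    (U : Set (Fin M → ℂ)) : volume (scaleMap A (MvPolynomial.C z) ε '' U) =
      ENNReal.ofReal (ε ^ (2 * A.card)) * volume U := by
  have h1 : scaleMap A (MvPolynomial.C z) ε '' U =
      (fun x => (fun a => if a ∈ A then z - ε * z else 0) + x) ''
      (Matrix.toLin' (Matrix.diagonal fun a : Fin M => if a ∈ A then (ε : ℂ) else 1) '' U) := by
    rw [Set.image_image]
    refine Set.image_congr fun t _ => ?_
    funext a
    simp only [scaleMap, MvPolynomial.eval_C, Pi.add_apply, Matrix.toLin'_apply,
      Matrix.mulVec_diagonal]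
    split_ifs <;> ring
  rw [h1, Set.image_add_left, measure_preimage_add, volume_image_restrictScalars, det_diag_scale,
    norm_pow, Complex.norm_real, Real.norm_of_nonneg hε.le, ← pow_mul, mul_comm A.card]

/-- The change of coordinates to the differences with the coordinate `c`. -/
def shearEquiv (A : Finset (Fin M)) {c : Fin M} (hc : c ∉ A) :
    (Fin M → ℂ) ≃ₗ[ℂ] (Fin M → ℂ) where
  toFun t := fun a => if a ∈ A then t a + t c else t a
  invFun t := fun a => if a ∈ A then t a - t c else t a
  map_add' s t := by
    funext a; simp only [Pi.add_apply]; split_ifs <;> ring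
  map_smul' s t := by
    funext a; simp only [Pi.smul_apply, smul_eq_mul, RingHom.id_apply]; split_ifs <;> ring
  left_inv t := by
    funext a; by_cases h : a ∈ A <;> simp [h, hc]
  right_inv t := by
    funext a; by_cases h : a ∈ A <;> simp [h, hc]

/-- The coordinate c is the center and does not move, hence |A| - 1. A shear conjugates the scaling
to a diagonal map. -/
lemma volume_image_scaleMap_X {A : Finset (Fin M)} {c : Fin M} (hc : c ∈ A) {ε : ℝ} (hε : 0 < ε)
    (U : Set (Fin M → ℂ)) : volume (scaleMap A (MvPolynomial.X c) ε '' U) =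
      ENNReal.ofReal (ε ^ (2 * (A.card - 1))) * volume U := by
  have hc' : c ∉ A.erase c := Finset.notMem_erase c A
  set e := shearEquiv (A.erase c) hc'
  set D := Matrix.toLin' (Matrix.diagonal fun a : Fin M => if a ∈ A.erase c then (ε : ℂ) else 1)
  have h1 : scaleMap A (MvPolynomial.X c) ε = ((e : (Fin M → ℂ) →ₗ[ℂ] (Fin M → ℂ)) ∘ₗ D ∘ₗ
      (e.symm : (Fin M → ℂ) →ₗ[ℂ] (Fin M → ℂ))) := by
    funext t a
    simp only [scaleMap, MvPolynomial.eval_X, LinearMap.comp_apply, D, Matrix.toLin'_apply]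
    change _ = if a ∈ A.erase c then _ + _ else _
    simp only [Matrix.mulVec_diagonal]
    change _ = if a ∈ A.erase c then _ * (if a ∈ A.erase c then _ else _) +
      _ * (if c ∈ A.erase c then _ else _) else _ * (if a ∈ A.erase c then _ else _)
    simp only [hc', if_false]
    by_cases hac : a = c
    · subst hac; simp [hc]
    · by_cases haA : a ∈ A <;> simp [haA, hac]
      ring
  rw [h1, volume_image_restrictScalars, LinearMap.det_conj, det_diag_scale,
    norm_pow, Complex.norm_real, Real.norm_of_nonneg hε.le, ← pow_mul, mul_comm _ 2,
    Finset.card_erase_of_mem hc]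

end Integrability

/-! ### Orders of square integrable forms -/

section Orders

lemma exists_eq_X_pow_mul {R : Type*} [CommRing R] {P : Polynomial R} (hP : P ≠ 0) :
    ∃ (v : ℕ) (P' : Polynomial R), P = Polynomial.X ^ v * P' ∧ P'.coeff 0 ≠ 0 := by
  obtain ⟨P', hP'⟩ := Polynomial.X_pow_dvd_iff.mpr
    fun d hd => Polynomial.coeff_eq_zero_of_lt_natTrailingDegree (p := P) hd
  refine ⟨P.natTrailingDegree, P', hP', ?_⟩
  have h := congrArg (fun p => Polynomial.coeff p P.natTrailingDegree) hP'
  simp only [Polynomial.coeff_X_pow_mul', le_refl, if_true, Nat.sub_self] at h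
  rw [← h]
  exact Polynomial.trailingCoeff_nonzero_iff_nonzero.mpr hP

variable {M N : ℕ}

/-- The ordered pairs of indices in `A`. -/
def pairsIn (A : Finset (Fin M)) : Finset (Fin M × Fin M) := (A ×ˢ A).filter fun u => u.1 < u.2

lemma mem_pairsIn {A : Finset (Fin M)} {u : Fin M × Fin M} :
    u ∈ pairsIn A ↔ u.1 ∈ A ∧ u.2 ∈ A ∧ u.1 < u.2 := by
  simp [pairsIn, and_assoc]

lemma card_pairsIn (A : Finset (Fin M)) : (pairsIn A).card = A.card.choose 2 := card_filter_lt A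

lemma eval_discr_ne_zero_iff (z : Fin N → ℂ) (t : Fin M → ℂ) :
    MvPolynomial.eval t (discr M z) ≠ 0 ↔ t ∈ confSpace M z := by
  simp only [discr, map_mul, map_prod, map_sub, MvPolynomial.eval_X, MvPolynomial.eval_C,
    mul_ne_zero_iff, Finset.prod_ne_zero_iff, Finset.mem_univ, true_implies, Finset.mem_Ioi,
    sub_ne_zero, confSpace, Set.mem_ofPred_eq]
  refine and_congr_left fun _ => ⟨fun h a c hac => ?_, fun h a c hac => h a c hac.ne⟩
  rcases lt_or_gt_of_ne hac with h1 | h1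
  · exact h a c h1
  · exact (h c a h1).symm

lemma discr_ne_zero (z : Fin N → ℂ) : discr M z ≠ 0 := by
  simp only [discr, mul_ne_zero_iff, Finset.prod_ne_zero_iff, Finset.mem_univ, true_implies,
    Finset.mem_Ioi]
  refine ⟨fun a c hac => X_sub_X_ne_zero hac.ne, fun a j h => ?_⟩
  have := congrArg (MvPolynomial.eval fun _ => z j + 1) h
  simp at this

lemma measurableSet_confSpace (z : Fin N → ℂ) : MeasurableSet (confSpace M z) := by
  have : confSpace M z = {t | MvPolynomial.eval t (discr M z) ≠ 0} := by
    ext t; exact (eval_discr_ne_zero_iff z t).symm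
  rw [this]
  exact (isOpen_ne_fun (MvPolynomial.continuous_eval _) continuous_const).measurableSet

/-- The linear forms whose powers make up the integrand, and the polynomial `F`. -/
noncomputable def factor (z : Fin N → ℂ) (F : MvPolynomial (Fin M) ℂ) :
    Option (Fin M × Fin M ⊕ Fin M × Fin N) → MvPolynomial (Fin M) ℂ
  | none => F
  | some (.inl u) => if u.1 < u.2 then MvPolynomial.X u.1 - MvPolynomial.X u.2 else 1
  | some (.inr u) => MvPolynomial.X u.1 - MvPolynomial.C (z u.2)

/-- The exponents of the factors of the integrand. -/
noncomputable def factorExp {V : Type*} (B : V → V → ℝ) (κ : ℝ) (lam : Fin N → V) (α : Fin M → V)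
    (n : ℕ) : Option (Fin M × Fin M ⊕ Fin M × Fin N) → ℝ
  | none => 1
  | some (.inl u) => if u.1 < u.2 then -B (α u.1) (α u.2) / κ - n else 0
  | some (.inr u) => B (lam u.2) (α u.1) / κ - n

lemma prod_prod_Ioi (f : Fin M → Fin M → ℝ) : ∏ a, ∏ c ∈ Finset.Ioi a, f a c =
    ∏ u : Fin M × Fin M, if u.1 < u.2 then f u.1 u.2 else 1 := by
  rw [Fintype.prod_prod_type]
  refine Finset.prod_congr rfl fun a _ => ?_
  rw [← Finset.prod_filter]
  exact Finset.prod_congr (by ext; simp) fun _ _ => rfl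

lemma masterAbs_mul_norm_coeffFun {V : Type*} (B : V → V → ℝ) (κ : ℝ) (lam : Fin N → V)
    (α : Fin M → V) (z : Fin N → ℂ) (F : MvPolynomial (Fin M) ℂ) (n : ℕ) {t : Fin M → ℂ}
    (ht : t ∈ confSpace M z) :
    masterAbs B κ lam α z t * ‖coeffFun z F n t‖ =
      (∏ i : Fin N, ∏ j ∈ Finset.Ioi i, ‖z i - z j‖ ^ (-B (lam i) (lam j) / κ)) *
        ∏ i, ‖MvPolynomial.eval t (factor z F i)‖ ^ factorExp B κ lam α n i := by
  rw [Fintype.prod_option, Fintype.prod_sum_type]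
  simp only [factor, factorExp, Real.rpow_one, map_sub, MvPolynomial.eval_X, MvPolynomial.eval_C]
  have h1 : ∏ u : Fin M × Fin M, ‖MvPolynomial.eval t (if u.1 < u.2 then
      MvPolynomial.X u.1 - MvPolynomial.X u.2 else 1)‖ ^
        (if u.1 < u.2 then -B (α u.1) (α u.2) / κ - n else 0) =
      (∏ a : Fin M, ∏ c ∈ Finset.Ioi a, ‖t a - t c‖ ^ (-B (α a) (α c) / κ)) /
      (∏ a : Fin M, ∏ c ∈ Finset.Ioi a, ‖t a - t c‖) ^ n := by
    rw [prod_prod_Ioi, prod_prod_Ioi, ← Finset.prod_pow, ← Finset.prod_div_distrib]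
    refine Finset.prod_congr rfl fun u _ => ?_
    split_ifs with h
    · rw [map_sub, MvPolynomial.eval_X, MvPolynomial.eval_X, Real.rpow_sub_natCast]
      exact norm_ne_zero_iff.mpr (sub_ne_zero.mpr (ht.1 _ _ h.ne))
    · simp
  have h2 : ∏ u : Fin M × Fin N, ‖t u.1 - z u.2‖ ^ (B (lam u.2) (α u.1) / κ - n) =
      (∏ a : Fin M, ∏ j : Fin N, ‖t a - z j‖ ^ (B (lam j) (α a) / κ)) /
      (∏ a : Fin M, ∏ j : Fin N, ‖t a - z j‖) ^ n := by
    rw [Fintype.prod_prod_type, ← Finset.prod_pow, ← Finset.prod_div_distrib]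
    refine Finset.prod_congr rfl fun a _ => ?_
    rw [← Finset.prod_pow, ← Finset.prod_div_distrib]
    refine Finset.prod_congr rfl fun j _ => ?_
    rw [Real.rpow_sub_natCast]
    exact norm_ne_zero_iff.mpr (sub_ne_zero.mpr (ht.2 _ _))
  rw [h1, h2, masterAbs, coeffFun, norm_div, norm_pow, discr, map_mul, norm_mul, map_prod, map_prod,
    norm_prod, norm_prod]
  simp only [map_prod, norm_prod, map_sub, MvPolynomial.eval_X, MvPolynomial.eval_C, mul_pow]
  rw [div_eq_mul_inv, div_eq_mul_inv, div_eq_mul_inv, mul_inv]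
  ring

/-- The integrability condition along the locus where the variables in `A` meet at `c`. -/
theorem IsSquareIntegrable.sum_order_pos {V : Type*} {B : V → V → ℝ} {κ : ℝ} {lam : Fin N → V}
    {α : Fin M → V} {z : Fin N → ℂ} (hz : Function.Injective z) {F : MvPolynomial (Fin M) ℂ} {n : ℕ}
    (hsq : IsSquareIntegrable (masterAbs B κ lam α z) z F n) {A : Finset (Fin M)}
    {c : MvPolynomial (Fin M) ℂ} {w : ℕ} (hw : 1 ≤ w)
    (hvol : ∀ ε : ℝ, 0 < ε → ∀ U, volume (scaleMap A c ε '' U) =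
      ENNReal.ofReal (ε ^ (2 * w)) * volume U)
    (hX : ∀ a b, ¬ (a ∈ A ∧ b ∈ A) → a ≠ b →
      (scaleHom A c (MvPolynomial.X a - MvPolynomial.X b)).coeff 0 ≠ 0)
    (q : Fin N → ℕ)
    (hq : ∀ a j, ∃ L', scaleHom A c (MvPolynomial.X a - MvPolynomial.C (z j)) =
      Polynomial.X ^ (if a ∈ A then q j else 0) * L' ∧ L'.coeff 0 ≠ 0)
    {v : ℕ} (hv : ¬ Polynomial.X ^ (v + 1) ∣ scaleHom A c F) :
    0 < v + ∑ u ∈ pairsIn A, (-B (α u.1) (α u.2) / κ - n) +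
      ∑ a ∈ A, ∑ j, (B (lam j) (α a) / κ - n) * q j + w := by
  obtain ⟨v', F', hF', hF0⟩ := exists_eq_X_pow_mul (P := scaleHom A c F) fun h => hv (h ▸ dvd_zero _)
  have hvv : v' ≤ v := by
    by_contra! h
    exact hv (hF' ▸ Dvd.dvd.mul_right (pow_dvd_pow _ h) _)
  set P := ∏ i : Fin N, ∏ j ∈ Finset.Ioi i, ‖z i - z j‖ ^ (-B (lam i) (lam j) / κ)
  have hP : P ≠ 0 := by
    refine Finset.prod_ne_zero_iff.mpr fun i _ => Finset.prod_ne_zero_iff.mpr fun j hj => ?_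
    refine (Real.rpow_pos_of_pos (norm_pos_iff.mpr (sub_ne_zero.mpr fun h => ?_)) _).ne'
    exact (Finset.mem_Ioi.mp hj).ne (hz h)
  have hint : IntegrableOn (fun t => (∏ i, ‖MvPolynomial.eval t (factor z F i)‖ ^
      factorExp B κ lam α n i) ^ 2) (confSpace M z) volume := by
    have h1 : IntegrableOn (fun t => (P⁻¹ ^ 2) * (masterAbs B κ lam α z t * ‖coeffFun z F n t‖) ^ 2)
      (confSpace M z) volume := Integrable.const_mul hsq _
    refine h1.congr_fun (fun t ht => ?_) (measurableSet_confSpace z)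
    simp only
    rw [masterAbs_mul_norm_coeffFun B κ lam α z F n ht, ← mul_pow, inv_mul_cancel_left₀ hP]
  choose Lz hLz hLz0 using hq
  have hpair : ∀ u : Fin M × Fin M, ∃ L' : Polynomial (MvPolynomial (Fin M) ℂ),
      scaleHom A c (factor z F (some (.inl u))) =
        Polynomial.X ^ (if u ∈ pairsIn A then 1 else 0) * L' ∧ L'.coeff 0 ≠ 0 := by
    intro u
    simp only [factor, mem_pairsIn]
    by_cases h : u.1 < u.2
    · by_cases hA : u.1 ∈ A ∧ u.2 ∈ A
      · refine ⟨Polynomial.C (MvPolynomial.X u.1 - MvPolynomial.X u.2), ?_, ?_⟩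
        · rw [if_pos h, if_pos ⟨hA.1, hA.2, h⟩, scaleHom_X_sub_X hA.1 hA.2, pow_one]
        · rw [Polynomial.coeff_C_zero]; exact X_sub_X_ne_zero h.ne
      · refine ⟨scaleHom A c (MvPolynomial.X u.1 - MvPolynomial.X u.2), ?_, hX _ _ hA h.ne⟩
        rw [if_pos h, if_neg (fun h' => hA ⟨h'.1, h'.2.1⟩), pow_zero, one_mul]
    · refine ⟨1, ?_, by simp⟩
      rw [if_neg h, if_neg (fun h' => h h'.2.2), map_one, pow_zero, one_mul]
  choose Lp hLp hLp0 using hpair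
  have key := sum_order_pos_of_integrableOn (A := A) (c := c) (factor z F) (factorExp B κ lam α n)
    (fun i => match i with
      | none => v'
      | some (.inl u) => if u ∈ pairsIn A then 1 else 0
      | some (.inr u) => if u.1 ∈ A then q u.2 else 0)
    (fun i => match i with
      | none => F'
      | some (.inl u) => Lp u
      | some (.inr u) => Lz u.1 u.2)
    (by
      rintro (_ | u | u)
      · exact hF'
      · exact hLp u
      · exact hLz u.1 u.2)
    (by
      rintro (_ | u | u)
      · exact hF0
      · exact hLp0 u
      · exact hLz0 u.1 u.2)
    (Ω := confSpace M z)
    (by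
      intro t ht
      constructor
      · intro a b hab heq
        rcases lt_or_gt_of_ne hab with h | h
        · have := ht (some (.inl (a, b)))
          simp [factor, h, heq] at this
        · have := ht (some (.inl (b, a)))
          simp [factor, h, heq] at this
      · intro a j heq
        have := ht (some (.inr (a, j)))
        simp [factor, heq] at this)
    hint hw hvol
  rw [Fintype.sum_option, Fintype.sum_sum_type] at key
  simp only [factorExp, one_mul, Nat.cast_ite, Nat.cast_one, Nat.cast_zero, mul_ite, mul_one,
    mul_zero] at key
  have h1 : ∑ u : Fin M × Fin M, (if u ∈ pairsIn A then
      (if u.1 < u.2 then -B (α u.1) (α u.2) / κ - n else 0) else 0) =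
      ∑ u ∈ pairsIn A, (-B (α u.1) (α u.2) / κ - n) := by
    rw [Finset.sum_ite_mem, Finset.univ_inter]
    exact Finset.sum_congr rfl fun u hu => if_pos (mem_pairsIn.mp hu).2.2
  have h2 : ∑ u : Fin M × Fin N, (if u.1 ∈ A then (B (lam u.2) (α u.1) / κ - n) * q u.2 else 0) =
      ∑ a ∈ A, ∑ j, (B (lam j) (α a) / κ - n) * q j := by
    rw [Fintype.sum_prod_type, ← Finset.sum_filter_add_sum_filter_not Finset.univ (· ∈ A)]
    have h3 : ∑ a : Fin M with a ∉ A, ∑ j,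
        (if a ∈ A then (B (lam j) (α a) / κ - n) * (q j : ℝ) else 0) = 0 :=
      Finset.sum_eq_zero fun a ha => Finset.sum_eq_zero fun j _ => if_neg (Finset.mem_filter.mp ha).2
    simp only at h3 ⊢
    rw [h3, add_zero, Finset.filter_mem_eq_inter, Finset.univ_inter]
    exact Finset.sum_congr rfl fun a ha => Finset.sum_congr rfl fun j _ => if_pos ha
  rw [h1, h2] at key
  have : (v' : ℝ) ≤ v := by exact_mod_cast hvv
  linarith

/-- The sum of the `B`-products over the pairs of variables in `A`. -/
noncomputable def pairSum {V : Type*} (B : V → V → ℝ) (α : Fin M → V) (A : Finset (Fin M)) : ℝ :=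
  ∑ u ∈ pairsIn A, B (α u.1) (α u.2)

lemma sum_pairsIn {V : Type*} (B : V → V → ℝ) (α : Fin M → V) (A : Finset (Fin M)) (κ : ℝ) (n : ℕ) :
    ∑ u ∈ pairsIn A, (-B (α u.1) (α u.2) / κ - n) =
      -pairSum B α A / κ - n * (A.card.choose 2 : ℕ) := by
  rw [Finset.sum_sub_distrib, ← Finset.sum_div, Finset.sum_neg_distrib, Finset.sum_const,
    card_pairsIn, nsmul_eq_mul, mul_comm (n : ℝ)]
  rfl

lemma X_sub_C_ne_zero (a : Fin M) (w : ℂ) :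
    (MvPolynomial.X a - MvPolynomial.C w : MvPolynomial (Fin M) ℂ) ≠ 0 := by
  intro h
  have := congrArg (MvPolynomial.eval fun _ => w + 1) h
  simp at this

lemma coeff_zero_scaleHom_X_sub_C_ne {A : Finset (Fin M)} {c : Fin M} (a : Fin M) (w : ℂ) :
    (scaleHom A (MvPolynomial.X c) (MvPolynomial.X a - MvPolynomial.C w)).coeff 0 ≠ 0 := by
  rw [map_sub, scaleHom_X, scaleHom_C]
  split_ifs <;> simpa using X_sub_C_ne_zero _ w

/-- Each pair in A contributes its exponent once and the codimension is |A| - 1. The hypothesis says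
that F has order at most v, so the conclusion is that the logarithmic order exceeds the pair sum
divided by κ. -/
theorem IsSquareIntegrable.order_diag {V : Type*} {B : V → V → ℝ} {κ : ℝ} {lam : Fin N → V}
    {α : Fin M → V} {z : Fin N → ℂ} (hz : Function.Injective z) {F : MvPolynomial (Fin M) ℂ} {n : ℕ}
    (hsq : IsSquareIntegrable (masterAbs B κ lam α z) z F n) {A : Finset (Fin M)}
    (hA : 2 ≤ A.card) {v : ℕ} (hv : F ∉ diagIdeal A ^ (v + 1)) :
    pairSum B α A / κ + n * (A.card.choose 2 : ℕ) + 1 < v + A.card := by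
  obtain ⟨c, hc⟩ := Finset.card_pos.mp (show 0 < A.card by omega)
  rw [mem_diagIdeal_pow_iff hc] at hv
  have h := hsq.sum_order_pos hz (A := A) (c := MvPolynomial.X c) (w := A.card - 1) (by omega)
    (fun ε hε U => volume_image_scaleMap_X hc hε U)
    (fun a b hA hab h0 => not_X_dvd_scaleHom_X_sub_X hc hab hA (Polynomial.X_dvd_iff.mpr h0))
    (fun _ => 0) (fun a j => ⟨scaleHom A (MvPolynomial.X c) (MvPolynomial.X a - MvPolynomial.C (z j)),
      by simp, coeff_zero_scaleHom_X_sub_C_ne a (z j)⟩) hv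
  rw [sum_pairsIn, Nat.cast_sub (by omega)] at h
  simp only [Nat.cast_zero, mul_zero, Finset.sum_const_zero, add_zero, neg_div] at h
  push_cast at h
  linarith

/-- All |A| variables move to z_j, so the codimension is |A|, and the factors t_a - z_j contribute
as well, both in the master function and in the denominator. -/
theorem IsSquareIntegrable.order_point {V : Type*} {B : V → V → ℝ} {κ : ℝ} {lam : Fin N → V}
    {α : Fin M → V} {z : Fin N → ℂ} (hz : Function.Injective z) {F : MvPolynomial (Fin M) ℂ} {n : ℕ}
    (hsq : IsSquareIntegrable (masterAbs B κ lam α z) z F n) {A : Finset (Fin M)}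
    (hA : 1 ≤ A.card) (j : Fin N) {v : ℕ}
    (hv : ¬ Polynomial.X ^ (v + 1) ∣ scaleHom A (MvPolynomial.C (z j)) F) :
    pairSum B α A / κ + n * ((A.card.choose 2 + A.card : ℕ) : ℝ) <
      (∑ a ∈ A, B (lam j) (α a)) / κ + v + A.card := by
  have h := hsq.sum_order_pos hz (A := A) (c := MvPolynomial.C (z j)) (w := A.card) hA
    (fun ε hε U => volume_image_scaleMap_const A (z j) hε U)
    (fun a b hA hab => by
      rw [map_sub, scaleHom_X, scaleHom_X]
      split_ifs with h1 h2 h2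
      · exact absurd ⟨h1, h2⟩ hA
      · simpa [sub_eq_zero] using sub_ne_zero.mpr (sub_ne_zero.mp (X_sub_C_ne_zero b (z j))).symm
      · simpa using X_sub_C_ne_zero a (z j)
      · simpa using X_sub_X_ne_zero hab)
    (fun i => if i = j then 1 else 0) (fun a i => by
      rw [map_sub, scaleHom_X, scaleHom_C]
      split_ifs with ha hi
      · refine ⟨Polynomial.C (MvPolynomial.X a - MvPolynomial.C (z j)), ?_, ?_⟩
        · rw [hi]; ring
        · rw [Polynomial.coeff_C_zero]; exact X_sub_C_ne_zero a _
      · refine ⟨_, (one_mul _).symm, ?_⟩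
        have : (MvPolynomial.C (z j) - MvPolynomial.C (z i) : MvPolynomial (Fin M) ℂ) ≠ 0 := by
          rw [← map_sub, Ne, MvPolynomial.C_eq_zero, sub_eq_zero]
          exact fun h => hi (hz h).symm
        simpa using this
      · refine ⟨_, (one_mul _).symm, ?_⟩
        simpa using X_sub_C_ne_zero a (z i)) hv
  rw [sum_pairsIn] at h
  simp only [Nat.cast_ite, Nat.cast_one, Nat.cast_zero, mul_ite, mul_one, mul_zero,
    Finset.sum_ite_eq', Finset.mem_univ, if_true, Finset.sum_sub_distrib, ← Finset.sum_div,
    Finset.sum_const, nsmul_eq_mul, neg_div] at h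
  push_cast
  linarith

/-- The logarithmic order is an integer greater than the pair sum over κ, here nonnegative; in the
next lemma this bound is greater than -1. -/
lemma IsSquareIntegrable.logOrderGE_one {V : Type*} {B : V → V → ℝ} {κ : ℝ} (hκ : 0 < κ)
    {lam : Fin N → V} {α : Fin M → V} {z : Fin N → ℂ} (hz : Function.Injective z)
    {F : MvPolynomial (Fin M) ℂ} {n : ℕ}
    (hsq : IsSquareIntegrable (masterAbs B κ lam α z) z F n) {A : Finset (Fin M)}
    (hA : 2 ≤ A.card) (hs : 0 ≤ pairSum B α A) : LogOrderGE n F A 1 := by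
  intro m hm
  by_contra hF
  obtain _ | m := m
  · simp at hF
  have h := hsq.order_diag hz hA hF
  have h1 : 0 ≤ pairSum B α A / κ := by positivity
  have h2 : ((m + 1 + A.card : ℕ) : ℝ) ≤ ((1 + 1 + n * A.card.choose 2 : ℕ) : ℝ) := by
    exact_mod_cast hm
  push_cast at h2
  linarith

lemma IsSquareIntegrable.logOrderGE_zero {V : Type*} {B : V → V → ℝ} {κ : ℝ} (hκ : 0 < κ)
    {lam : Fin N → V} {α : Fin M → V} {z : Fin N → ℂ} (hz : Function.Injective z)
    {F : MvPolynomial (Fin M) ℂ} {n : ℕ}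
    (hsq : IsSquareIntegrable (masterAbs B κ lam α z) z F n) {A : Finset (Fin M)}
    (hA : 1 ≤ A.card) (hs : -κ < pairSum B α A) : LogOrderGE n F A 0 := by
  intro m hm
  by_contra hF
  obtain _ | m := m
  · simp at hF
  rcases hA.eq_or_lt with hA1 | hA2
  · rw [← hA1] at hm
    simp at hm
  have h := hsq.order_diag hz hA2 hF
  have h1 : -1 < pairSum B α A / κ := by rw [lt_div_iff₀ hκ]; linarith
  have h2 : ((m + 1 + A.card : ℕ) : ℝ) ≤ ((1 + 0 + n * A.card.choose 2 : ℕ) : ℝ) := by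
    exact_mod_cast hm
  push_cast at h2
  linarith

lemma coeffFun_mul_discr_pow (z : Fin N → ℂ) (F : MvPolynomial (Fin M) ℂ) (n m : ℕ) {t : Fin M → ℂ}
    (ht : t ∈ confSpace M z) :
    coeffFun z (F * discr M z ^ m) (n + m) t = coeffFun z F n t := by
  have := (eval_discr_ne_zero_iff z t).mpr ht
  unfold coeffFun
  rw [map_mul, map_pow, pow_add, mul_div_mul_right _ _ (pow_ne_zero _ this)]

lemma coeffRat_mul_discr_pow (z : Fin N → ℂ) (F : MvPolynomial (Fin M) ℂ) (n m : ℕ) :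
    coeffRat z (F * discr M z ^ m) (n + m) = coeffRat z F n := by
  have : toRat (discr M z) ≠ 0 :=
    (map_ne_zero_iff _ (IsFractionRing.injective _ _)).mpr (discr_ne_zero z)
  unfold coeffRat
  rw [toRat, map_mul, map_pow, pow_add, mul_div_mul_right _ _ (pow_ne_zero _ this)]

lemma IsSquareIntegrable.mul_discr_pow {R : (Fin M → ℂ) → ℝ} {z : Fin N → ℂ}
    {F : MvPolynomial (Fin M) ℂ} {n : ℕ} (h : IsSquareIntegrable R z F n) (m : ℕ) :
    IsSquareIntegrable R z (F * discr M z ^ m) (n + m) := by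
  refine IntegrableOn.congr_fun h (fun t ht => ?_) (measurableSet_confSpace z)
  simp only [coeffFun_mul_discr_pow z F n m ht]

lemma comp_perm_mem_confSpace {z : Fin N → ℂ} {t : Fin M → ℂ} (ht : t ∈ confSpace M z)
    (τ : Equiv.Perm (Fin M)) : t ∘ τ ∈ confSpace M z :=
  ⟨fun _ _ hab => ht.1 _ _ (τ.injective.ne hab), fun _ j => ht.2 _ j⟩

/-- Up to a sign independent of t, the square of the Vandermonde product is the product over all
ordered pairs of distinct indices, which is invariant. -/
lemma rename_discr_sq (z : Fin N → ℂ) (τ : Equiv.Perm (Fin M)) :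
    MvPolynomial.rename τ (discr M z ^ 2) = discr M z ^ 2 := by
  have key : ∀ t : Fin M → ℂ, (∏ a, ∏ c ∈ Finset.Ioi a, (t a - t c)) ^ 2 =
      (∏ u : Fin M × Fin M, if u.1 = u.2 then 1 else t u.1 - t u.2) *
        ∏ u : Fin M × Fin M, if u.1 < u.2 then -1 else 1 := by
    intro t
    have e1 : ∏ a, ∏ c ∈ Finset.Ioi a, (t a - t c) =
        ∏ u : Fin M × Fin M, if u.1 < u.2 then t u.1 - t u.2 else 1 := by
      rw [Fintype.prod_prod_type]
      refine Finset.prod_congr rfl fun a _ => ?_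
      rw [← Finset.prod_filter]
      exact Finset.prod_congr (by ext; simp) fun _ _ => rfl
    have e2 : ∏ a, ∏ c ∈ Finset.Ioi a, (t a - t c) =
        ∏ u : Fin M × Fin M, if u.2 < u.1 then t u.2 - t u.1 else 1 := by
      rw [e1]
      exact Fintype.prod_equiv (Equiv.prodComm _ _) _ _ fun u => rfl
    have e3 : ∏ u : Fin M × Fin M, (if u.1 < u.2 then (-1 : ℂ) else 1) =
        ∏ u : Fin M × Fin M, if u.2 < u.1 then -1 else 1 :=
      Fintype.prod_equiv (Equiv.prodComm _ _) _ _ fun u => rfl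
    rw [e3, sq]
    nth_rw 1 [e1]
    rw [e2, ← Finset.prod_mul_distrib, ← Finset.prod_mul_distrib]
    refine Finset.prod_congr rfl fun u _ => ?_
    rcases lt_trichotomy u.1 u.2 with h | h | h
    · rw [if_pos h, if_neg h.not_gt, if_neg h.ne, if_neg h.not_gt]
    · simp [h]
    · rw [if_neg h.not_gt, if_pos h, if_neg h.ne', if_pos h]; ring
  refine MvPolynomial.funext fun t => ?_
  rw [MvPolynomial.eval_rename]
  simp only [discr, map_pow, map_mul, map_prod, map_sub, MvPolynomial.eval_X, MvPolynomial.eval_C,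
    mul_pow, Function.comp_apply]
  rw [key t, key fun a => t (τ a), Equiv.prod_comp τ fun a => ∏ j, (t a - z j)]
  congr 2
  refine Fintype.prod_equiv (Equiv.prodCongr τ τ) _ _ fun u => ?_
  simp

/-- On X_z the polynomial is Q times the even power 2n + 2 of the discriminant; elsewhere both sides
vanish. -/
lemma rename_mul_discr_pow {z : Fin N → ℂ} {F : MvPolynomial (Fin M) ℂ} {n : ℕ}
    {τ : Equiv.Perm (Fin M)}
    (h : ∀ t ∈ confSpace M z, coeffFun z F n (t ∘ τ) = coeffFun z F n t) :
    MvPolynomial.rename τ (F * discr M z ^ (n + 2)) = F * discr M z ^ (n + 2) := by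
  have hd : ∀ t, (MvPolynomial.eval (t ∘ τ) (discr M z)) ^ 2 = (MvPolynomial.eval t (discr M z)) ^ 2 := by
    intro t
    have := congrArg (MvPolynomial.eval t) (rename_discr_sq z τ)
    rwa [MvPolynomial.eval_rename, map_pow, map_pow] at this
  refine MvPolynomial.funext fun t => ?_
  rw [MvPolynomial.eval_rename]
  by_cases ht : t ∈ confSpace M z
  · have h1 := (eval_discr_ne_zero_iff z t).mpr ht
    have h2 := (eval_discr_ne_zero_iff z _).mpr (comp_perm_mem_confSpace ht τ)
    have h3 := h t ht
    unfold coeffFun at h3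
    simp only [map_mul, map_pow]
    have e : ∀ x y : ℂ, y ≠ 0 → x * y ^ (n + 2) = x / y ^ n * (y ^ 2) ^ (n + 1) := by
      intro x y hy; field_simp; ring
    rw [e _ _ h1, e _ _ h2, h3, hd]
  · have h1 : MvPolynomial.eval t (discr M z) = 0 := by
      by_contra h'; exact ht ((eval_discr_ne_zero_iff z t).mp h')
    have h2 : MvPolynomial.eval (t ∘ τ) (discr M z) = 0 := by
      have := hd t; rw [h1] at this; simpa using this
    simp [h1, h2]

end Orders

/-! ### Logarithmic poles along the diagonals -/

section LogPoles

variable {𝔤 : Type*} [LieRing 𝔤] [LieAlgebra ℂ 𝔤] [FiniteDimensional ℂ 𝔤]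
  [LieAlgebra.IsSimple ℂ 𝔤] {H : LieSubalgebra ℂ 𝔤} [H.IsCartanSubalgebra]
  {b : (rootSystem H).Base} {θ : H.root} {M N : ℕ}

/-- The simple root attached to a variable. -/
noncomputable abbrev simpleAt (β : Fin M → b.support) (a : Fin M) : Dual ℂ H :=
  (rootSystem H).root (β a)

/-- The sum of the simple roots attached to the variables in `A`. -/
noncomputable def weightOf (β : Fin M → b.support) (A : Finset (Fin M)) : Dual ℂ H :=
  ∑ a ∈ A, simpleAt β a

lemma weightOf_singleton (β : Fin M → b.support) (a : Fin M) :
    weightOf β {a} = (rootSystem H).root (β a) := Finset.sum_singleton _ _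

lemma pairSum_eq (β : Fin M → b.support) (A : Finset (Fin M)) :
    pairSum (normForm H θ) (simpleAt β) A =
      (normForm H θ (weightOf β A) (weightOf β A) - ∑ a ∈ A, rootLen H θ (β a)) / 2 := by
  have h1 : normForm H θ (weightOf β A) (weightOf β A) =
      ∑ u ∈ A ×ˢ A, normForm H θ (simpleAt β u.1) (simpleAt β u.2) := by
    rw [weightOf, normForm_sum_left, Finset.sum_product]
    exact Finset.sum_congr rfl fun a _ => normForm_sum_right H θ _ _ _
  have h2 : ∑ u ∈ A ×ˢ A with u.2 < u.1, normForm H θ (simpleAt β u.1) (simpleAt β u.2) =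
      ∑ u ∈ A ×ˢ A with u.1 < u.2, normForm H θ (simpleAt β u.1) (simpleAt β u.2) := by
    refine Finset.sum_nbij' Prod.swap Prod.swap ?_ ?_ (fun _ _ => rfl) (fun _ _ => rfl)
      fun u _ => normForm_comm H θ _ _
    all_goals
      intro u hu
      simp only [Finset.mem_filter, Finset.mem_product, Prod.fst_swap, Prod.snd_swap] at hu ⊢
      tauto
  have h3 : ∑ u ∈ A ×ˢ A with u.1 = u.2, normForm H θ (simpleAt β u.1) (simpleAt β u.2) =
      ∑ a ∈ A, rootLen H θ (β a) := by
    refine Finset.sum_nbij' Prod.fst (fun a => (a, a)) ?_ ?_ ?_ ?_ ?_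
    · intro u hu; simp only [Finset.mem_filter, Finset.mem_product] at hu; exact hu.1.1
    · intro a ha; simp [ha]
    · intro u hu; simp only [Finset.mem_filter] at hu; exact Prod.ext rfl hu.2
    · intro a _; rfl
    · intro u hu
      simp only [Finset.mem_filter] at hu
      rw [hu.2]; rfl
  have h4 : ∑ u ∈ A ×ˢ A, normForm H θ (simpleAt β u.1) (simpleAt β u.2) =
      ∑ u ∈ A ×ˢ A with u.1 < u.2, normForm H θ (simpleAt β u.1) (simpleAt β u.2) +
      (∑ u ∈ A ×ˢ A with u.1 = u.2, normForm H θ (simpleAt β u.1) (simpleAt β u.2) +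
      ∑ u ∈ A ×ˢ A with u.2 < u.1, normForm H θ (simpleAt β u.1) (simpleAt β u.2)) := by
    rw [Finset.sum_filter, Finset.sum_filter, Finset.sum_filter, ← Finset.sum_add_distrib,
      ← Finset.sum_add_distrib]
    refine Finset.sum_congr rfl fun u _ => ?_
    rcases lt_trichotomy u.1 u.2 with h | h | h
    · rw [if_pos h, if_neg h.ne, if_neg h.not_gt]; ring
    · simp [h]
    · rw [if_neg h.not_gt, if_neg h.ne', if_pos h]; ring
  rw [h1, h4, h2, h3, pairSum, pairsIn]
  ring

lemma weightOf_ne_zero (β : Fin M → b.support) {A : Finset (Fin M)} (hA : A.Nonempty) :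
    weightOf β A ≠ 0 := by
  intro h
  have h1 := congrArg (b.toWeightBasis.constr ℂ (fun _ => (1 : ℂ))) h
  rw [weightOf, map_sum, map_zero] at h1
  have h2 : ∀ a, b.toWeightBasis.constr ℂ (fun _ => (1 : ℂ)) (simpleAt β a) = 1 := by
    intro a
    have := b.toWeightBasis.constr_basis ℂ (fun _ => (1 : ℂ)) (β a)
    simpa using this
  simp only [h2, Finset.sum_const, nsmul_eq_mul, mul_one] at h1
  exact hA.card_ne_zero (by exact_mod_cast h1)

/-- This is (w, w) > 0 for the nonzero weight w. For light sets it provides the bound -κ needed for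
logarithmic order 0. -/
lemma neg_lt_pairSum {β : Fin M → b.support} {A : Finset (Fin M)} (hA : A.Nonempty) {g : ℝ}
    (hlight : (∑ a ∈ A, rootLen H θ (β a)) / 2 ≤ g) :
    -g < pairSum (normForm H θ) (simpleAt β) A := by
  have := normForm_self_pos H θ (isIntegralWeight_sum H A fun a => (β a : H.root))
    (weightOf_ne_zero β hA)
  rw [pairSum_eq]
  change 0 < normForm H θ (weightOf β A) (weightOf β A) at this
  linarith

lemma sum_rootLen_le_of_subset {β : Fin M → b.support} {A A' : Finset (Fin M)} (h : A' ⊆ A) :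
    (∑ a ∈ A', rootLen H θ (β a)) / 2 ≤ (∑ a ∈ A, rootLen H θ (β a)) / 2 := by
  have := Finset.sum_le_sum_of_subset_of_nonneg h
    fun a _ _ => (rootLen_pos H θ (β a)).le (a := 0)
  linarith

lemma weightOf_apply_coroot (β : Fin M → b.support) (A : Finset (Fin M)) (i : H.root) :
    weightOf β A ((rootSystem H).coroot i) =
      ((∑ a ∈ A, (rootSystem H).pairingIn ℤ (β a) i : ℤ) : ℂ) := by
  rw [weightOf, LinearMap.sum_apply]
  push_cast
  exact Finset.sum_congr rfl fun a _ => pairingIn_eq_apply H _ _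

lemma normForm_weightOf_root (β : Fin M → b.support) (A : Finset (Fin M)) (i : H.root) :
    normForm H θ (weightOf β A) ((rootSystem H).root i) =
      (∑ a ∈ A, (rootSystem H).pairingIn ℤ (β a) i : ℤ) * rootLen H θ i / 2 :=
  normForm_root H θ (by rw [weightOf_apply_coroot]; push_cast; rfl)

lemma pairSum_pair {β : Fin M → b.support} {a c : Fin M} (hac : a ≠ c) :
    pairSum (normForm H θ) (simpleAt β) {a, c} =
      (rootSystem H).pairingIn ℤ (β c) (β a) * rootLen H θ (β a) / 2 := by
  rw [pairSum_eq, weightOf, Finset.sum_pair hac, Finset.sum_pair hac, normForm_add_left,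
    normForm_add_right, normForm_add_right, normForm_comm H θ (simpleAt β a) (simpleAt β c),
    ← normForm_root_root]
  have e : ∀ a, rootLen H θ (β a) = normForm H θ (simpleAt β a) (simpleAt β a) := fun _ => rfl
  rw [e, e]
  ring

/-- The p + 1 equal roots contribute C(p + 1, 2) squared lengths, and their pairs with y contribute
-(p + 1)p/2 of them. This is where the wheel condition comes from. -/
lemma pairSum_insert_eq_zero {β : Fin M → b.support} {x y : Fin M} {T : Finset (Fin M)} {p : ℕ}
    (hT : ∀ a ∈ T, β a = β x) (hy : y ∉ T) (hTc : T.card = p + 1)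
    (hp : (rootSystem H).pairingIn ℤ (β y) (β x) = -p) :
    pairSum (normForm H θ) (simpleAt β) (insert y T) = 0 := by
  have h1 : weightOf β T = ((p + 1 : ℕ) : ℕ) • (rootSystem H).root (β x) := by
    rw [weightOf, Finset.sum_congr rfl fun a ha => by rw [simpleAt, hT a ha], Finset.sum_const, hTc]
  have h2 : ∑ a ∈ T, rootLen H θ (β a) = (p + 1) * rootLen H θ (β x) := by
    rw [Finset.sum_congr rfl fun a ha => by rw [hT a ha], Finset.sum_const, hTc, nsmul_eq_mul]
    push_cast; rfl
  have h3 : ∀ w, normForm H θ w (weightOf β T) = (p + 1) * normForm H θ w (rootSystem H |>.root (β x)) := by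
    intro w
    rw [weightOf, normForm_sum_right, Finset.sum_congr rfl fun a ha => by rw [simpleAt, hT a ha],
      Finset.sum_const, hTc, nsmul_eq_mul]
    push_cast; rfl
  have h4 : weightOf β (insert y T) = simpleAt β y + weightOf β T := Finset.sum_insert hy
  have h5 := normForm_root_root H θ (β y) (β x)
  rw [hp] at h5
  push_cast at h5
  have e : ∀ a, normForm H θ (simpleAt β a) (simpleAt β a) = rootLen H θ (β a) := fun _ => rfl
  rw [pairSum_eq, h4, normForm_add_left, normForm_add_right, normForm_add_right, h3, h3,
    normForm_comm H θ (weightOf β T) (simpleAt β y), h3, normForm_comm H θ (weightOf β T), h3, e,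
    h5, Finset.sum_insert hy, h2]
  have e2 := e x
  rw [e2]
  ring

lemma pairSum_nonneg_of_eq {β : Fin M → b.support} {x : Fin M} {A : Finset (Fin M)}
    (hA : ∀ a ∈ A, β a = β x) : 0 ≤ pairSum (normForm H θ) (simpleAt β) A := by
  refine Finset.sum_nonneg fun u hu => ?_
  obtain ⟨h1, h2, -⟩ := mem_pairsIn.mp hu
  rw [simpleAt, simpleAt, hA _ h1, hA _ h2]
  exact (rootLen_pos H θ (β x)).le

/-- Induction on |A| by reflection in a simple root that pairs positively with the weight. Lightness
passes to subsets, so every nonempty subset of A has logarithmic order at least 0. -/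
theorem logOrderGE_one_of_not_root {κ : ℝ} (hκ : 0 < κ) (hκg : dualCoxeter H b θ ≤ κ)
    {lam : Fin N → Dual ℂ H} {β : Fin M → b.support} {z : Fin N → ℂ} (hz : Function.Injective z)
    {F : MvPolynomial (Fin M) ℂ} {n n' : ℕ} (hn : n = 2 * n') (hn' : 1 ≤ n')
    (hsq : IsSquareIntegrable (masterAbs (normForm H θ) κ lam (simpleAt β) z) z F n)
    (hsymm : ∀ τ : Equiv.Perm (Fin M), (∀ a, β (τ a) = β a) → MvPolynomial.rename τ F = F)
    (A : Finset (Fin M)) (hA : 2 ≤ A.card)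
    (hlight : (∑ a ∈ A, rootLen H θ (β a)) / 2 ≤ dualCoxeter H b θ)
    (hroot : ∀ γ : H.root, (rootSystem H).root γ ≠ weightOf β A) : LogOrderGE n F A 1 := by
  induction hm : A.card using Nat.strong_induction_on generalizing A with
  | _ m ih =>
  classical
  subst hm
  rcases le_or_gt 0 (pairSum (normForm H θ) (simpleAt β) A) with hs | hs
  · exact hsq.logOrderGE_one hκ hz hA hs
  have hzero : ∀ B ⊆ A, B.Nonempty → LogOrderGE n F B 0 := fun B hB hB0 =>
    hsq.logOrderGE_zero hκ hz hB0.card_pos (lt_of_le_of_lt (neg_le_neg hκg)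
      (neg_lt_pairSum hB0 ((sum_rootLen_le_of_subset hB).trans hlight)))
  have hA0 : A.Nonempty := Finset.card_pos.mp (by omega)
  -- (w, w) > 0 is the sum of the (w, β(a)), so one of these is positive.
  obtain ⟨x, hxA, hx⟩ : ∃ x ∈ A, 0 < normForm H θ (weightOf β A) (simpleAt β x) := by
    have := normForm_self_pos H θ (isIntegralWeight_sum H A fun a => (β a : H.root))
      (weightOf_ne_zero β hA0)
    rw [normForm_sum_right] at this
    refine Finset.exists_lt_of_sum_lt (f := fun _ => (0 : ℝ)) ?_
    rw [Finset.sum_const_zero]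
    exact this
  set pr : Fin M → ℤ := fun a => (rootSystem H).pairingIn ℤ (β a) (β x) with hpr
  have hlx := rootLen_pos H θ (β x)
  have hk0 : 0 < ∑ a ∈ A, pr a := by
    rw [simpleAt, normForm_weightOf_root] at hx
    have : (0 : ℝ) < (∑ a ∈ A, pr a : ℤ) := by
      by_contra! h
      have := mul_nonpos_of_nonpos_of_nonneg h hlx.le
      linarith
    exact_mod_cast this
  have hpr2 : ∀ a, β a = β x → pr a = 2 := by
    intro a ha; simp only [hpr, ha]; exact (rootSystem H).pairingIn_same ℤ _
  have hprle : ∀ a, β a ≠ β x → pr a ≤ 0 := fun a ha =>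
    b.pairingIn_le_zero_of_ne (fun h => ha (Subtype.ext h)) (β a).2 (β x).2
  set S := A.filter fun a => β a = β x with hS
  set Y := A.filter fun a => pr a < 0 with hY
  -- If all variables carried the same root, the pair sum would be nonnegative. A variable with
  -- another root serves as the center of scaling.
  obtain ⟨c, hcA, hcx⟩ : ∃ c ∈ A, β c ≠ β x := by
    by_contra! h
    exact absurd (pairSum_nonneg_of_eq h) (not_le.mpr hs)
  have hcS : c ∉ S := fun h => hcx (Finset.mem_filter.mp h).2
  have hYS : Disjoint Y S := by
    refine Finset.disjoint_left.mpr fun a ha haS => ?_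
    have h1 := (Finset.mem_filter.mp ha).2
    rw [hpr2 a (Finset.mem_filter.mp haS).2] at h1
    omega
  have hp : ∀ y ∈ Y, pr y = -((-pr y).toNat : ℤ) := fun y hy => by
    have := (Finset.mem_filter.mp hy).2
    rw [Int.toNat_of_nonneg (by omega)]; ring
  have hsum : ∑ a ∈ A, pr a = 2 * S.card - ∑ y ∈ Y, ((-pr y).toNat : ℤ) := by
    have h1 : ∑ a ∈ A, pr a = ∑ a ∈ S, pr a + ∑ a ∈ Y, pr a := by
      rw [hS, hY, Finset.sum_filter, Finset.sum_filter, ← Finset.sum_add_distrib]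
      refine Finset.sum_congr rfl fun a _ => ?_
      by_cases ha : β a = β x
      · rw [if_pos ha, if_neg (by rw [hpr2 a ha]; omega), add_zero]
      · rw [if_neg ha, zero_add]
        have := hprle a ha
        split_ifs <;> omega
    rw [h1, Finset.sum_congr rfl fun a ha => hpr2 a (Finset.mem_filter.mp ha).2, Finset.sum_const,
      Finset.sum_congr rfl hp, Finset.sum_neg_distrib, nsmul_eq_mul]
    ring
  obtain ⟨k, hk⟩ := Int.eq_ofNat_of_zero_le hk0.le
  have hSA : S ⊆ A := Finset.filter_subset _ _
  have hYA : Y ⊆ A := Finset.filter_subset _ _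
  refine logOrderGE_one_of_reflection hn hn' hSA hYA hYS hcA hcS (p := fun y => (-pr y).toNat)
    (k := k) ?_ ?_ ?_ (hzero A subset_rfl hA0) ?_ ?_ ?_ ?_
  · intro τ hτ
    refine hsymm τ fun a => ?_
    by_cases ha : a ∈ S
    · have : τ a ∈ S := by
        by_contra h
        exact h ((τ.injective (hτ _ h)).symm ▸ ha)
      rw [(Finset.mem_filter.mp ha).2, (Finset.mem_filter.mp this).2]
    · rw [hτ a ha]
  · intro a ha y hy
    exact hzero _ (Finset.insert_subset (hSA ha) (Finset.singleton_subset_iff.mpr (hYA hy)))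
      (Finset.insert_nonempty _ _)
  · intro a ha y hyA hyY hay
    refine hsq.logOrderGE_one hκ hz (Finset.card_pair hay).ge ?_
    rw [pairSum_pair hay, (Finset.mem_filter.mp ha).2]
    have : 0 ≤ pr y := by
      by_contra! h
      exact hyY (Finset.mem_filter.mpr ⟨hyA, h⟩)
    have : (0 : ℝ) ≤ (pr y : ℝ) := by exact_mod_cast this
    have := mul_nonneg this hlx.le
    linarith
  · intro a ha
    exact hzero _ (Finset.erase_subset _ _) ⟨c, Finset.mem_erase.mpr ⟨fun h => hcS (h ▸ ha), hcA⟩⟩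
  · intro y hy T hT hTc
    have hyT : y ∉ T := fun h => Finset.disjoint_left.mp hYS hy (hT h)
    refine hsq.logOrderGE_one hκ hz ?_ (pairSum_insert_eq_zero (x := x) (fun a ha =>
      (Finset.mem_filter.mp (hT ha)).2) hyT hTc (hp y hy)).ge
    rw [Finset.card_insert_of_notMem hyT]; omega
  · have := hsum
    rw [hk] at this
    zify
    linarith
  · intro K hK hKc
    have hKA : K ⊆ A := hK.trans hSA
    have hw : weightOf β A = weightOf β (A \ K) + (k : ℤ) • (rootSystem H).root (β x) := by
      rw [weightOf, ← Finset.sum_sdiff hKA, weightOf]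
      congr 1
      rw [Finset.sum_congr rfl fun a ha => by
        rw [simpleAt, (Finset.mem_filter.mp (hK ha)).2], Finset.sum_const, hKc, natCast_zsmul]
    -- The weight of A \ K is w - kα = s_α w; were it a root, its reflection w would be one.
    have hnr : ∀ γ : H.root, (rootSystem H).root γ ≠ weightOf β (A \ K) := by
      intro γ hγ
      refine hroot ((rootSystem H).reflectionPerm (β x) γ) ?_
      rw [root_reflectionPerm_eq, hγ, hw]
      congr 2
      have h1 := pairingIn_eq_apply H γ (β x)
      rw [hγ] at h1
      have h2 := weightOf_apply_coroot β A (β x)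
      rw [hw, LinearMap.add_apply, h1, LinearMap.smul_apply, pairingIn_eq_apply,
        (rootSystem H).pairingIn_same ℤ] at h2
      have h3 : (rootSystem H).pairingIn ℤ γ (β x) + k * 2 = ∑ a ∈ A, pr a := by
        rw [zsmul_eq_mul] at h2
        exact_mod_cast h2
      rw [hk] at h3
      linarith
    have hc' : c ∈ A \ K := Finset.mem_sdiff.mpr ⟨hcA, fun h => hcS (hK h)⟩
    have hcard := Finset.card_sdiff_add_card_eq_card hKA
    refine ih _ ?_ (A \ K) ?_ ((sum_rootLen_le_of_subset Finset.sdiff_subset).trans hlight) hnr rfl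
    · rw [hk] at hk0
      omega
    -- One variable alone would have a simple root as its weight.
    · have h1 : 0 < (A \ K).card := Finset.card_pos.mpr ⟨c, hc'⟩
      by_contra! h
      obtain ⟨a, ha⟩ := Finset.card_eq_one.mp (show (A \ K).card = 1 by omega)
      exact hnr (β a) (by rw [ha, weightOf_singleton])

end LogPoles

/-! ### Orders of iterated residues -/

section Residues

variable {M N : ℕ}

/-- The polynomial `P` vanishes to order exactly `v` along the center of the scaling. -/
def HasOrder (A : Finset (Fin M)) (c P : MvPolynomial (Fin M) ℂ) (v : ℕ) : Prop :=
  ∃ P', scaleHom A c P = Polynomial.X ^ v * P' ∧ P'.coeff 0 ≠ 0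

lemma HasOrder.mul {A : Finset (Fin M)} {c P P' : MvPolynomial (Fin M) ℂ} {v v' : ℕ}
    (h : HasOrder A c P v) (h' : HasOrder A c P' v') : HasOrder A c (P * P') (v + v') := by
  obtain ⟨Q, hQ, hQ0⟩ := h
  obtain ⟨Q', hQ', hQ0'⟩ := h'
  refine ⟨Q * Q', by rw [map_mul, hQ, hQ']; ring, ?_⟩
  rw [Polynomial.mul_coeff_zero]
  exact mul_ne_zero hQ0 hQ0'

lemma hasOrder_C (A : Finset (Fin M)) (c : MvPolynomial (Fin M) ℂ) {w : ℂ} (hw : w ≠ 0) :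
    HasOrder A c (MvPolynomial.C w) 0 :=
  ⟨Polynomial.C (MvPolynomial.C w), by rw [scaleHom_C, pow_zero, one_mul], by simpa using hw⟩

lemma hasOrder_one (A : Finset (Fin M)) (c : MvPolynomial (Fin M) ℂ) : HasOrder A c 1 0 := by
  simpa using hasOrder_C A c one_ne_zero

lemma HasOrder.pow {A : Finset (Fin M)} {c P : MvPolynomial (Fin M) ℂ} {v : ℕ}
    (h : HasOrder A c P v) (n : ℕ) : HasOrder A c (P ^ n) (n * v) := by
  induction n with
  | zero => simpa using hasOrder_one A c
  | succ n ih => rw [pow_succ, add_mul, one_mul]; exact ih.mul h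

lemma hasOrder_prod {ι : Type*} {A : Finset (Fin M)} {c : MvPolynomial (Fin M) ℂ} (s : Finset ι)
    {P : ι → MvPolynomial (Fin M) ℂ} {v : ι → ℕ} (h : ∀ i ∈ s, HasOrder A c (P i) (v i)) :
    HasOrder A c (∏ i ∈ s, P i) (∑ i ∈ s, v i) := by
  classical
  induction s using Finset.induction_on with
  | empty => simpa using hasOrder_one A c
  | insert i s hi ih =>
    rw [Finset.prod_insert hi, Finset.sum_insert hi]
    exact (h i (Finset.mem_insert_self _ _)).mul
      (ih fun j hj => h j (Finset.mem_insert_of_mem hj))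

lemma HasOrder.dvd_iff {A : Finset (Fin M)} {c P : MvPolynomial (Fin M) ℂ} {v : ℕ}
    (h : HasOrder A c P v) (m : ℕ) : Polynomial.X ^ m ∣ scaleHom A c P ↔ m ≤ v := by
  obtain ⟨P', hP, hP0⟩ := h
  rw [hP]
  refine ⟨fun hd => ?_, fun hm => Dvd.dvd.mul_right (pow_dvd_pow _ hm) _⟩
  by_contra! hlt
  have h1 := (pow_dvd_pow Polynomial.X (Nat.succ_le_of_lt hlt)).trans hd
  rw [Nat.succ_eq_add_one, pow_succ, mul_dvd_mul_iff_left (pow_ne_zero _ Polynomial.X_ne_zero)] at h1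
  exact not_X_dvd_of_coeff_zero_ne hP0 h1

lemma HasOrder.unique {A : Finset (Fin M)} {c P : MvPolynomial (Fin M) ℂ} {v v' : ℕ}
    (h : HasOrder A c P v) (h' : HasOrder A c P v') : v = v' :=
  le_antisymm ((h'.dvd_iff v).mp ((h.dvd_iff v).mpr le_rfl))
    ((h.dvd_iff v').mp ((h'.dvd_iff v').mpr le_rfl))

lemma HasOrder.dvd_mul_iff {A : Finset (Fin M)} {c P G : MvPolynomial (Fin M) ℂ} {v : ℕ}
    (h : HasOrder A c P v) (m : ℕ) : Polynomial.X ^ (m + v) ∣ scaleHom A c (P * G) ↔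
      Polynomial.X ^ m ∣ scaleHom A c G := by
  obtain ⟨P', hP, hP0⟩ := h
  rw [map_mul, hP, mul_assoc, pow_add, mul_comm (Polynomial.X ^ m),
    mul_dvd_mul_iff_left (pow_ne_zero _ Polynomial.X_ne_zero)]
  exact ⟨fun h => Polynomial.prime_X.pow_dvd_of_dvd_mul_left _ (not_X_dvd_of_coeff_zero_ne hP0) h,
    fun h => Dvd.dvd.mul_left h _⟩

lemma substPoly_X (a c i : Fin M) : substPoly a c (MvPolynomial.X i) =
    if i = a then MvPolynomial.X c else MvPolynomial.X i := by
  simp [substPoly]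

lemma substPoly_C (a c : Fin M) (w : ℂ) :
    substPoly a c (MvPolynomial.C w) = MvPolynomial.C w := by
  simp [substPoly, MvPolynomial.algebraMap_eq]

lemma dvd_iff_substPoly_eq_zero {a c : Fin M} (P : MvPolynomial (Fin M) ℂ) :
    MvPolynomial.X a - MvPolynomial.X c ∣ P ↔ substPoly a c P = 0 := by
  constructor
  · rintro ⟨P, rfl⟩
    rw [map_mul, map_sub, substPoly_X, substPoly_X, if_pos rfl]
    simp
  · intro h
    have key : ∀ P : MvPolynomial (Fin M) ℂ,
        MvPolynomial.X a - MvPolynomial.X c ∣ P - substPoly a c P := by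
      intro P
      induction P using MvPolynomial.induction_on with
      | C w => simp
      | add p q hp hq => rw [map_add, add_sub_add_comm]; exact dvd_add hp hq
      | mul_X p i hp =>
        have h1 : MvPolynomial.X a - MvPolynomial.X c ∣
            (MvPolynomial.X i - substPoly a c (MvPolynomial.X i) : MvPolynomial (Fin M) ℂ) := by
          rw [substPoly_X]
          split_ifs with hi
          · rw [hi]
          · simp
        have h2 : p * MvPolynomial.X i - substPoly a c (p * MvPolynomial.X i) =
            (p - substPoly a c p) * MvPolynomial.X i +
              substPoly a c p * (MvPolynomial.X i - substPoly a c (MvPolynomial.X i)) := by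
          rw [map_mul]; ring
        rw [h2]
        exact dvd_add (Dvd.dvd.mul_right hp _) (Dvd.dvd.mul_left h1 _)
    have := key P
    rwa [h, sub_zero] at this

lemma prime_X_sub_X {a c : Fin M} (hac : a ≠ c) :
    Prime (MvPolynomial.X a - MvPolynomial.X c : MvPolynomial (Fin M) ℂ) := by
  refine ⟨X_sub_X_ne_zero hac, fun h => ?_, fun p q h => ?_⟩
  · have := (dvd_iff_substPoly_eq_zero 1).mp h.dvd
    simp at this
  · simp only [dvd_iff_substPoly_eq_zero, map_mul, mul_eq_zero] at h ⊢
    exact h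

/-- Products of linear forms `t_a - t_b`, `t_a - w` and constants. -/
def IsLinearProduct (h : MvPolynomial (Fin M) ℂ) : Prop :=
  h ∈ Submonoid.closure {l : MvPolynomial (Fin M) ℂ |
    (∃ a b, a ≠ b ∧ l = MvPolynomial.X a - MvPolynomial.X b) ∨
    (∃ a w, l = MvPolynomial.X a - MvPolynomial.C w) ∨ ∃ w : ℂ, w ≠ 0 ∧ l = MvPolynomial.C w}

lemma isLinearProduct_X_sub_X {a b : Fin M} (hab : a ≠ b) :
    IsLinearProduct (MvPolynomial.X a - MvPolynomial.X b : MvPolynomial (Fin M) ℂ) :=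
  Submonoid.subset_closure (Or.inl ⟨a, b, hab, rfl⟩)

lemma isLinearProduct_X_sub_C (a : Fin M) (w : ℂ) :
    IsLinearProduct (MvPolynomial.X a - MvPolynomial.C w) :=
  Submonoid.subset_closure (Or.inr (Or.inl ⟨a, w, rfl⟩))

lemma isLinearProduct_C {w : ℂ} (hw : w ≠ 0) :
    IsLinearProduct (MvPolynomial.C w : MvPolynomial (Fin M) ℂ) :=
  Submonoid.subset_closure (Or.inr (Or.inr ⟨w, hw, rfl⟩))

lemma HasOrder.ne_zero {A : Finset (Fin M)} {c P : MvPolynomial (Fin M) ℂ} {v : ℕ}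
    (h : HasOrder A c P v) : P ≠ 0 := by
  rintro rfl
  have := (h.dvd_iff (v + 1)).mp (by rw [map_zero]; exact dvd_zero _)
  omega

lemma toRat_ne_zero {P : MvPolynomial (Fin M) ℂ} (h : P ≠ 0) : toRat P ≠ 0 :=
  (map_ne_zero_iff _ (IsFractionRing.injective _ _)).mpr h

lemma toRat_injective : Function.Injective (toRat (M := M)) := IsFractionRing.injective _ _

lemma toRat_mul (P Q : MvPolynomial (Fin M) ℂ) : toRat (P * Q) = toRat P * toRat Q := map_mul _ _ _

lemma toRat_pow (P : MvPolynomial (Fin M) ℂ) (n : ℕ) : toRat (P ^ n) = toRat P ^ n := map_pow _ _ _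

/-- The restriction to the diagonal can be computed from any fraction whose denominator does not
vanish on the diagonal. -/
lemma restrictDiag_div {a c : Fin M} {g h : MvPolynomial (Fin M) ℂ} (hh : substPoly a c h ≠ 0) :
    restrictDiag a c (toRat g / toRat h) =
      toRat (substPoly a c g) / toRat (substPoly a c h) := by
  set Q := toRat g / toRat h
  set p := IsFractionRing.num (MvPolynomial (Fin M) ℂ) Q
  set q : MvPolynomial (Fin M) ℂ := ↑(IsFractionRing.den (MvPolynomial (Fin M) ℂ) Q)
  have hq : q ≠ 0 := nonZeroDivisors.coe_ne_zero _
  have hh0 : h ≠ 0 := fun e => hh (by rw [e, map_zero])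
  have hpq : toRat p / toRat q = toRat g / toRat h := by
    have := IsFractionRing.mk'_num_den (MvPolynomial (Fin M) ℂ) Q
    rw [IsFractionRing.mk'_eq_div] at this
    exact this
  have hprod : p * h = g * q := by
    refine toRat_injective ?_
    rw [toRat_mul, toRat_mul]
    exact (div_eq_div_iff (toRat_ne_zero hq) (toRat_ne_zero hh0)).mp hpq
  -- If the reduced denominator vanished on the diagonal, so would the reduced numerator, and t_a -
  -- t_c would divide both.
  have hq0 : substPoly a c q ≠ 0 := by
    intro hq0
    have h1 := congrArg (substPoly a c) hprod
    rw [map_mul, map_mul, hq0, mul_zero] at h1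
    have h2 := (mul_eq_zero.mp h1).resolve_right hh
    have hu := IsFractionRing.num_den_reduced (MvPolynomial (Fin M) ℂ) Q
      ((dvd_iff_substPoly_eq_zero _).mpr h2) ((dvd_iff_substPoly_eq_zero _).mpr hq0)
    have := (dvd_iff_substPoly_eq_zero (a := a) (c := c) 1).mp hu.dvd
    simp at this
  change toRat (substPoly a c p) / toRat (substPoly a c q) = _
  rw [div_eq_div_iff (toRat_ne_zero hq0) (toRat_ne_zero hh), ← toRat_mul, ← toRat_mul,
    ← map_mul, ← map_mul, hprod]

/-- The rational function `Q`, with a product of linear forms as denominator, has order at least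
`e` along the locus where the variables in `A` are at the center. -/
def OrderGE (A : Finset (Fin M)) (c : MvPolynomial (Fin M) ℂ) (e : ℤ) (Q : RatFun M) : Prop :=
  ∃ (g h : MvPolynomial (Fin M) ℂ) (v : ℕ), Q = toRat g / toRat h ∧ IsLinearProduct h ∧
    HasOrder A c h v ∧ ∀ m : ℕ, (m : ℤ) ≤ v + e → Polynomial.X ^ m ∣ scaleHom A c g

/-- The order is here the multiplicity of f. The denominator is f^v times a factor prime to f, and
f^v divides f g. -/
lemma OrderGE.atMostSimplePole {A : Finset (Fin M)} {c f : MvPolynomial (Fin M) ℂ} (hf : f ≠ 0)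
    (hdvd : ∀ m P, Polynomial.X ^ m ∣ scaleHom A c P ↔ f ^ m ∣ P) {Q : RatFun M}
    (hQ : OrderGE A c (-1) Q) : AtMostSimplePole f Q := by
  obtain ⟨g, h, v, rfl, -, hv, hg⟩ := hQ
  obtain ⟨h₀, rfl⟩ := (hdvd v h).mp ((hv.dvd_iff v).mpr le_rfl)
  obtain ⟨g₀, hg₀⟩ : f ^ v ∣ f * g := by
    obtain _ | v := v
    · simp
    · rw [pow_succ']
      exact mul_dvd_mul_left f ((hdvd v g).mp (hg v (by push_cast; omega)))
  refine ⟨g₀, h₀, fun hd => ?_, ?_⟩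
  · have h1 : f ^ (v + 1) ∣ f ^ v * h₀ := by rw [pow_succ]; exact mul_dvd_mul_left _ hd
    have := (hv.dvd_iff _).mp ((hdvd _ _).mpr h1)
    omega
  · rw [← mul_div_assoc, ← toRat_mul, hg₀, toRat_mul, toRat_mul,
      mul_div_mul_left _ _ (by rw [toRat_pow]; exact pow_ne_zero _ (toRat_ne_zero hf))]

lemma isLinearProduct_discr (z : Fin N → ℂ) : IsLinearProduct (discr M z) :=
  Submonoid.mul_mem _
    (Submonoid.prod_mem _ fun _ _ => Submonoid.prod_mem _ fun _ hc =>
      isLinearProduct_X_sub_X (Finset.mem_Ioi.mp hc).ne)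
    (Submonoid.prod_mem _ fun a _ => Submonoid.prod_mem _ fun j _ =>
      isLinearProduct_X_sub_C a (z j))

lemma sum_sum_Ioi_ite (A : Finset (Fin M)) :
    ∑ a : Fin M, ∑ c ∈ Finset.Ioi a, (if a ∈ A ∧ c ∈ A then 1 else 0) = A.card.choose 2 := by
  rw [← card_pairsIn, Finset.card_eq_sum_ones, pairsIn, Finset.sum_filter, Finset.sum_product]
  have h1 : ∀ a, ∑ c ∈ Finset.Ioi a, (if a ∈ A ∧ c ∈ A then 1 else 0) =
      if a ∈ A then ∑ c ∈ A, (if a < c then 1 else 0) else 0 := by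
    intro a
    split_ifs with ha
    · simp only [ha, true_and]
      rw [← Finset.sum_filter, ← Finset.sum_filter]
      exact Finset.sum_congr (by ext c; simp [and_comm]) fun _ _ => rfl
    · simp [ha]
  simp only [h1]
  rw [Finset.sum_ite_mem, Finset.univ_inter]

open Classical in
lemma hasOrder_X_sub_C (A : Finset (Fin M)) (c : MvPolynomial (Fin M) ℂ) (a : Fin M) (w : ℂ) :
    HasOrder A c (MvPolynomial.X a - MvPolynomial.C w)
      (if a ∈ A ∧ c = MvPolynomial.C w then 1 else 0) := by
  split_ifs with h
  · refine ⟨Polynomial.C (MvPolynomial.X a - MvPolynomial.C w), ?_, ?_⟩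
    · rw [map_sub, scaleHom_X, if_pos h.1, scaleHom_C, h.2]; ring
    · rw [Polynomial.coeff_C_zero]; exact X_sub_C_ne_zero a w
  · refine ⟨_, by rw [pow_zero, one_mul], ?_⟩
    rw [map_sub, scaleHom_X, scaleHom_C]
    split_ifs with ha
    · have : c - MvPolynomial.C w ≠ 0 := sub_ne_zero.mpr fun h' => h ⟨ha, h'⟩
      simpa using this
    · simpa using X_sub_C_ne_zero a w

variable [NeZero M]

/-- The admissible centers: the variable `t_0` or a constant. -/
def IsCenter (c : MvPolynomial (Fin M) ℂ) : Prop :=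
  c = MvPolynomial.X 0 ∨ ∃ w, c = MvPolynomial.C w

lemma IsCenter.hasOrder_X_sub_X {c : MvPolynomial (Fin M) ℂ} (hc : IsCenter c) {A : Finset (Fin M)}
    (h0 : 0 ∈ A) {a b : Fin M} (hab : a ≠ b) :
    HasOrder A c (MvPolynomial.X a - MvPolynomial.X b) (if a ∈ A ∧ b ∈ A then 1 else 0) := by
  split_ifs with h
  · refine ⟨_, by rw [scaleHom_X_sub_X h.1 h.2, pow_one], ?_⟩
    rw [Polynomial.coeff_C_zero]; exact X_sub_X_ne_zero hab
  · refine ⟨_, by rw [pow_zero, one_mul], ?_⟩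
    rcases hc with rfl | ⟨w, rfl⟩
    · exact fun h1 => not_X_dvd_scaleHom_X_sub_X h0 hab h (Polynomial.X_dvd_iff.mpr h1)
    · rw [map_sub, scaleHom_X, scaleHom_X]
      split_ifs with h1 h2 h2
      · exact absurd ⟨h1, h2⟩ h
      · simpa [sub_eq_zero] using sub_ne_zero.mpr (sub_ne_zero.mp (X_sub_C_ne_zero b w)).symm
      · simpa using X_sub_C_ne_zero a w
      · simpa using X_sub_X_ne_zero hab

lemma IsCenter.substPoly_eq {c : MvPolynomial (Fin M) ℂ} (hc : IsCenter c) {a : Fin M} (ha : a ≠ 0) :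
    substPoly a 0 c = c := by
  rcases hc with rfl | ⟨w, rfl⟩
  · simp [substPoly, ha.symm]
  · simp [substPoly, MvPolynomial.algebraMap_eq]

/-- Identifying t_a with t_0 commutes with the scaling, because both are scaled in the same way. So
restriction to the diagonal cannot lower the order of a numerator. -/
lemma scaleHom_substPoly {c : MvPolynomial (Fin M) ℂ} (hc : IsCenter c) {C : Finset (Fin M)}
    (h0 : 0 ∈ C) {a : Fin M} (ha : a ∉ C) (P : MvPolynomial (Fin M) ℂ) :
    scaleHom C c (substPoly a 0 P) =
      (scaleHom (insert a C) c P).map (substPoly a 0).toRingHom := by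
  have ha0 : a ≠ 0 := fun h => ha (h ▸ h0)
  induction P using MvPolynomial.induction_on with
  | C w =>
    rw [substPoly_C, scaleHom_C, scaleHom_C, Polynomial.map_C]
    congr 1
    exact (substPoly_C _ _ w).symm
  | add p q hp hq => rw [map_add, map_add, map_add, Polynomial.map_add, hp, hq]
  | mul_X p i hp =>
    have hX : ∀ P : MvPolynomial (Fin M) ℂ, (substPoly a 0).toRingHom P = substPoly a 0 P := fun _ => rfl
    have hcs := hc.substPoly_eq ha0
    suffices h : scaleHom C c (substPoly a 0 (MvPolynomial.X i)) =
        (scaleHom (insert a C) c (MvPolynomial.X i)).map (substPoly a 0).toRingHom by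
      rw [map_mul, map_mul, map_mul, Polynomial.map_mul, hp, h]
    rw [scaleHom_X, substPoly_X]
    by_cases hi : i = a
    · rw [if_pos hi, if_pos (hi ▸ Finset.mem_insert_self _ _), scaleHom_X, if_pos h0,
        Polynomial.map_add, Polynomial.map_mul, Polynomial.map_C, Polynomial.map_C,
        Polynomial.map_X, hX, hX,
        map_sub (substPoly a 0), hcs, substPoly_X, if_pos hi]
    · rw [if_neg hi, scaleHom_X]
      by_cases hiC : i ∈ C
      · rw [if_pos hiC, if_pos (Finset.mem_insert_of_mem hiC), Polynomial.map_add,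
          Polynomial.map_mul, Polynomial.map_C, Polynomial.map_C, Polynomial.map_X, hX, hX,
          map_sub (substPoly a 0), hcs, substPoly_X, if_neg hi]
      · rw [if_neg hiC, if_neg (by simp [hi, hiC]), Polynomial.map_C, hX, substPoly_X, if_neg hi]

/-- Splitting off the powers of `t_a - t_0` from a product of linear forms. -/
lemma IsLinearProduct.exists_split {c : MvPolynomial (Fin M) ℂ} (hc : IsCenter c)
    {C : Finset (Fin M)} (h0 : 0 ∈ C) {a : Fin M} (ha : a ∉ C) {h : MvPolynomial (Fin M) ℂ}
    (hh : IsLinearProduct h) : ∃ (s : ℕ) (h₀ : MvPolynomial (Fin M) ℂ) (v : ℕ),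
      h = (MvPolynomial.X a - MvPolynomial.X 0) ^ s * h₀ ∧ IsLinearProduct (substPoly a 0 h₀) ∧
      HasOrder (insert a C) c h₀ v ∧ HasOrder C c (substPoly a 0 h₀) v := by
  classical
  have ha0 : a ≠ 0 := fun h => ha (h ▸ h0)
  have h0' : 0 ∈ insert a C := Finset.mem_insert_of_mem h0
  induction hh using Submonoid.closure_induction with
  | mem l hl =>
    rcases hl with ⟨i, j, hij, rfl⟩ | ⟨i, w, rfl⟩ | ⟨w, hw, rfl⟩
    · by_cases hia : i = a
      · subst hia
        by_cases hj : j = 0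
        · subst hj
          exact ⟨1, 1, 0, by ring, by rw [map_one]; exact Submonoid.one_mem _, hasOrder_one _ _,
            by rw [map_one]; exact hasOrder_one _ _⟩
        · have e : substPoly i 0 (MvPolynomial.X i - MvPolynomial.X j) =
              MvPolynomial.X 0 - MvPolynomial.X j := by
            rw [map_sub, substPoly_X, substPoly_X, if_pos rfl, if_neg hij.symm]
          refine ⟨0, _, _, by rw [pow_zero, one_mul], ?_, hc.hasOrder_X_sub_X h0' hij, ?_⟩
          · rw [e]; exact isLinearProduct_X_sub_X (Ne.symm hj)
          · rw [e]
            convert hc.hasOrder_X_sub_X h0 (Ne.symm hj) using 2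
            simp [h0, hij.symm]
      · by_cases hja : j = a
        · subst hja
          by_cases hi : i = 0
          · subst hi
            -- The form t_0 - t_a is the one split off up to the sign; hence the constants among the
            -- products of linear forms.
            refine ⟨1, MvPolynomial.C (-1), 0, by rw [map_neg, map_one]; ring, ?_,
              hasOrder_C _ _ (by norm_num), ?_⟩
            · rw [substPoly_C]; exact isLinearProduct_C (by norm_num)
            · rw [substPoly_C]; exact hasOrder_C _ _ (by norm_num)
          · have e : substPoly j 0 (MvPolynomial.X i - MvPolynomial.X j) =
                MvPolynomial.X i - MvPolynomial.X 0 := by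
              rw [map_sub, substPoly_X, substPoly_X, if_pos rfl, if_neg hij]
            refine ⟨0, _, _, by rw [pow_zero, one_mul], ?_, hc.hasOrder_X_sub_X h0' hij, ?_⟩
            · rw [e]; exact isLinearProduct_X_sub_X hi
            · rw [e]
              convert hc.hasOrder_X_sub_X h0 hi using 2
              simp [h0, hij]
        · have e : substPoly a 0 (MvPolynomial.X i - MvPolynomial.X j) =
              MvPolynomial.X i - MvPolynomial.X j := by
            rw [map_sub, substPoly_X, substPoly_X, if_neg hia, if_neg hja]
          refine ⟨0, _, _, by rw [pow_zero, one_mul], ?_, hc.hasOrder_X_sub_X h0' hij, ?_⟩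
          · rw [e]; exact isLinearProduct_X_sub_X hij
          · rw [e]
            convert hc.hasOrder_X_sub_X h0 hij using 2
            simp [hia, hja]
    · refine ⟨0, _, _, by rw [pow_zero, one_mul], ?_, hasOrder_X_sub_C _ _ i w, ?_⟩
      · rw [map_sub, substPoly_X, substPoly_C]
        split_ifs
        exacts [isLinearProduct_X_sub_C _ w, isLinearProduct_X_sub_C _ w]
      · rw [map_sub, substPoly_X, substPoly_C]
        by_cases hia : i = a
        · rw [if_pos hia]
          convert hasOrder_X_sub_C C c 0 w using 2
          simp [hia, h0]
        · rw [if_neg hia]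
          convert hasOrder_X_sub_C C c i w using 2
          simp [hia]
    · refine ⟨0, MvPolynomial.C w, 0, by rw [pow_zero, one_mul], ?_, hasOrder_C _ _ hw, ?_⟩
      · rw [substPoly_C]; exact isLinearProduct_C hw
      · rw [substPoly_C]; exact hasOrder_C _ _ hw
  | one => exact ⟨0, 1, 0, by ring, by rw [map_one]; exact Submonoid.one_mem _, hasOrder_one _ _,
      by rw [map_one]; exact hasOrder_one _ _⟩
  | mul p q _ _ hp hq =>
    obtain ⟨s, p₀, v, hp1, hp2, hp3, hp4⟩ := hp
    obtain ⟨s', q₀, v', hq1, hq2, hq3, hq4⟩ := hq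
    refine ⟨s + s', p₀ * q₀, v + v', by rw [hp1, hq1]; ring, ?_, hp3.mul hq3, ?_⟩
    · rw [map_mul]; exact Submonoid.mul_mem _ hp2 hq2
    · rw [map_mul]; exact hp4.mul hq4

/-- Multiplication by t_a - t_0 raises the order by one. Restriction can only raise the order of the
numerator, and it preserves that of the denominator once the powers of t_a - t_0 are cancelled. The
latter holds for products of linear forms but not for all polynomials. -/
theorem OrderGE.residue {c : MvPolynomial (Fin M) ℂ} (hc : IsCenter c) {C : Finset (Fin M)}
    (h0 : 0 ∈ C) {a : Fin M} (ha : a ∉ C) {e : ℤ} {Q : RatFun M}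
    (hQ : OrderGE (insert a C) c e Q) : OrderGE C c (e + 1) (residue a 0 Q) := by
  have ha0 : a ≠ 0 := fun h => ha (h ▸ h0)
  unfold ConfPoles.residue
  split_ifs with hpole
  swap
  -- Where the pole is not simple the residue has the value 0, which has every order.
  · exact ⟨0, 1, 0, by simp, Submonoid.one_mem _, hasOrder_one _ _, fun m _ => by simp⟩
  obtain ⟨g, h, v, rfl, hh, hv, hg⟩ := hQ
  obtain ⟨s, h₀, v₀, rfl, hlin, hv1, hv2⟩ := hh.exists_split hc h0 ha
  obtain ⟨g₁, h₁, hh₁, hQ₁⟩ := hpole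
  set f : MvPolynomial (Fin M) ℂ := MvPolynomial.X a - MvPolynomial.X 0
  have hf : Prime f := prime_X_sub_X ha0
  have hfo : HasOrder (insert a C) c f 1 := by
    have := hc.hasOrder_X_sub_X (A := insert a C) (Finset.mem_insert_of_mem h0) ha0
    rwa [if_pos ⟨Finset.mem_insert_self _ _, Finset.mem_insert_of_mem h0⟩] at this
  have hvs : v = s * 1 + v₀ := hv.unique ((hfo.pow s).mul hv1)
  have h₁0 : h₁ ≠ 0 := fun e => hh₁ (e ▸ dvd_zero _)
  have h₀0 : h₀ ≠ 0 := hv1.ne_zero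
  have hfr := toRat_ne_zero hf.ne_zero
  have h₀r := toRat_ne_zero h₀0
  have h1 : f * g * h₁ = f ^ s * (g₁ * h₀) := by
    refine toRat_injective ?_
    rw [← mul_div_assoc, toRat_mul, div_eq_div_iff (mul_ne_zero (by rw [toRat_pow]; exact pow_ne_zero _ hfr)
      h₀r) (toRat_ne_zero h₁0)] at hQ₁
    simp only [toRat_mul] at hQ₁ ⊢
    rw [hQ₁]; ring
  -- The pole being at most simple, the prime f does not divide h₁, so f^s divides f g.
  obtain ⟨g₀, hg₀⟩ := hf.pow_dvd_of_dvd_mul_right s hh₁ (Dvd.intro _ h1.symm)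
  have hfQ : toRat f * (toRat g / toRat (f ^ s * h₀)) = toRat g₀ / toRat h₀ := by
    rw [← mul_div_assoc, ← toRat_mul, hg₀, toRat_mul, toRat_mul,
      mul_div_mul_left _ _ (by rw [toRat_pow]; exact pow_ne_zero _ hfr)]
  rw [hfQ, restrictDiag_div hv2.ne_zero]
  refine ⟨(-1) ^ (M - 1 - (a : ℕ)) * substPoly a 0 g₀, substPoly a 0 h₀, v₀, ?_, hlin, hv2, ?_⟩
  · rw [mul_div_assoc', toRat_mul, toRat_pow]
    congr 2
    simp [toRat]
  · intro m hm
    rw [map_mul]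
    refine Dvd.dvd.mul_left ?_ _
    rw [scaleHom_substPoly hc h0 ha]
    have h2 : Polynomial.X ^ m ∣ scaleHom (insert a C) c g₀ := by
      rw [← (hfo.pow s).dvd_mul_iff m, ← hg₀]
      rcases Nat.eq_zero_or_pos (m + s * 1) with h | h
      · rw [h]; simp
      · obtain ⟨j, hj⟩ := Nat.exists_eq_add_of_lt h
        rw [hj, zero_add, mul_comm f, mul_comm, hfo.dvd_mul_iff j]
        exact hg j (by push_cast [hvs]; omega)
    have := map_dvd (Polynomial.mapRingHom (substPoly a 0).toRingHom) h2
    simpa using this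

/-- After j residues the variables with indices 1, ..., j have been absorbed into the variable 0,
and the order has gone up by j. -/
lemma OrderGE.iterRes {c : MvPolynomial (Fin M) ℂ} (hc : IsCenter c) {A : Finset (Fin M)} {ℓ : ℕ}
    (hℓ : ℓ ≤ M) (hA : ∀ a : Fin M, a.val < ℓ → a ∈ A) {e : ℤ} {Q : RatFun M}
    (hQ : OrderGE A c e Q) (j : ℕ) (hj : j < ℓ) :
    OrderGE (insert 0 (A.filter fun a => j < a.val)) c (e + j) (iterRes Q (j + 1)) := by
  induction j with
  | zero =>
    have : insert 0 (A.filter fun a => 0 < a.val) = A := by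
      ext a
      simp only [Finset.mem_insert, Finset.mem_filter]
      refine ⟨?_, fun h => ?_⟩
      · rintro (rfl | h)
        · exact hA 0 hj
        · exact h.1
      · rcases Nat.eq_zero_or_pos a.val with h' | h'
        · exact Or.inl (Fin.ext h')
        · exact Or.inr ⟨h, h'⟩
    rw [this]
    simpa [ConfPoles.iterRes] using hQ
  | succ j ih =>
    have hval : (Fin.ofNat M (j + 1)).val = j + 1 := Nat.mod_eq_of_lt (by omega)
    have h1 := ih (by omega)
    have h2 : insert 0 (A.filter fun a => j < a.val) =
        insert (Fin.ofNat M (j + 1)) (insert 0 (A.filter fun a => j + 1 < a.val)) := by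
      ext a
      simp only [Finset.mem_insert, Finset.mem_filter, Fin.ext_iff, hval]
      have := hA a
      constructor
      · rintro (h | ⟨h, h'⟩)
        · exact Or.inr (Or.inl h)
        · by_cases h3 : a.val = j + 1
          · exact Or.inl h3
          · exact Or.inr (Or.inr ⟨h, by omega⟩)
      · rintro (h | h | ⟨h, h'⟩)
        · exact Or.inr ⟨hA a (by omega), by omega⟩
        · exact Or.inl h
        · exact Or.inr ⟨h, by omega⟩
    rw [h2] at h1
    have h3 := OrderGE.residue hc (Finset.mem_insert_self _ _) (by
      rw [Finset.mem_insert, Finset.mem_filter, hval, Fin.ext_iff, hval]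
      simp) h1
    rw [ConfPoles.iterRes]
    convert h3 using 1
    push_cast; ring

lemma OrderGE.atMostSimplePole_X_sub_X {p : Fin M} (hp : p ≠ 0) {Q : RatFun M}
    (hQ : OrderGE {0, p} (MvPolynomial.X 0) (-1) Q) :
    AtMostSimplePole (MvPolynomial.X 0 - MvPolynomial.X p) Q := by
  refine hQ.atMostSimplePole (X_sub_X_ne_zero hp.symm) fun m P => ?_
  rw [← mem_diagIdeal_pow_iff (by simp), diagIdeal_pair, Ideal.span_singleton_pow,
    Ideal.mem_span_singleton]

lemma OrderGE.atMostSimplePole_X_sub_C {w : ℂ} {Q : RatFun M}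
    (hQ : OrderGE {0} (MvPolynomial.C w) (-1) Q) :
    AtMostSimplePole (MvPolynomial.X 0 - MvPolynomial.C w) Q := by
  refine hQ.atMostSimplePole (X_sub_C_ne_zero 0 w) fun m P => ?_
  have h1 : centerIdeal {0} (MvPolynomial.C w) =
      Ideal.span {(MvPolynomial.X (0 : Fin M) - MvPolynomial.C w : MvPolynomial (Fin M) ℂ)} := by
    unfold centerIdeal
    congr 1
    ext f
    simp
  rw [← Ideal.mem_span_singleton (x := P), ← Ideal.span_singleton_pow, ← h1]
  exact ⟨mem_centerIdeal_pow_of_dvd, dvd_scaleHom_of_mem (scaleHom_C _ _ w)⟩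

/-- Scaling one variable towards itself does nothing, so a positive order forces the numerator to be
zero. -/
lemma OrderGE.eq_zero {Q : RatFun M} (hQ : OrderGE {0} (MvPolynomial.X 0) 1 Q) : Q = 0 := by
  obtain ⟨g, h, v, rfl, -, -, hg⟩ := hQ
  have h1 : scaleHom {0} (MvPolynomial.X (0 : Fin M)) g = Polynomial.C g := by
    have key : ∀ P : MvPolynomial (Fin M) ℂ,
        scaleHom {0} (MvPolynomial.X (0 : Fin M)) P = Polynomial.C P := by
      intro P
      induction P using MvPolynomial.induction_on with
      | C w => exact scaleHom_C _ _ w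
      | add p q hp hq => rw [map_add, hp, hq, Polynomial.C_add]
      | mul_X p i hp =>
        rw [map_mul, hp, Polynomial.C_mul, scaleHom_X]
        congr 1
        split_ifs with hi
        · rw [Finset.mem_singleton.mp hi, sub_self, map_zero, mul_zero, add_zero]
        · rfl
    exact key g
  have h2 := hg 1 (by push_cast; omega)
  rw [pow_one, h1, Polynomial.X_dvd_iff, Polynomial.coeff_C_zero] at h2
  rw [h2, toRat, map_zero, zero_div]

open Classical in
lemma IsCenter.hasOrder_discr {c : MvPolynomial (Fin M) ℂ} (hc : IsCenter c) {A : Finset (Fin M)}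
    (h0 : 0 ∈ A) (z : Fin N → ℂ) : HasOrder A c (discr M z) (A.card.choose 2 +
      ∑ a : Fin M, ∑ j : Fin N, if a ∈ A ∧ c = MvPolynomial.C (z j) then 1 else 0) := by
  rw [← sum_sum_Ioi_ite A]
  exact (hasOrder_prod _ fun a _ => hasOrder_prod _ fun b hb =>
    hc.hasOrder_X_sub_X h0 (Finset.mem_Ioi.mp hb).ne).mul
    (hasOrder_prod _ fun a _ => hasOrder_prod _ fun j _ => hasOrder_X_sub_C _ _ a (z j))

lemma LogOrderGE.orderGE_coeffRat {z : Fin N → ℂ} {F : MvPolynomial (Fin M) ℂ} {n δ : ℕ}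
    {A : Finset (Fin M)} (h0 : 0 ∈ A) (h : LogOrderGE n F A δ) :
    OrderGE A (MvPolynomial.X 0) (1 + δ - A.card) (coeffRat z F n) := by
  classical
  have hd := (IsCenter.hasOrder_discr (Or.inl rfl) h0 z).pow n
  have hne : ∀ w : ℂ, ¬ (MvPolynomial.X 0 : MvPolynomial (Fin M) ℂ) = MvPolynomial.C w :=
    fun w => sub_ne_zero.mp (X_sub_C_ne_zero 0 w)
  simp only [hne, and_false, if_false, Finset.sum_const_zero, add_zero] at hd
  refine ⟨F, discr M z ^ n, _, by rw [toRat_pow, coeffRat],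
    Submonoid.pow_mem _ (isLinearProduct_discr z) n, hd, fun m hm => ?_⟩
  rw [← mem_diagIdeal_pow_iff h0]
  refine h m ?_
  push_cast at hm
  zify
  linarith

lemma orderGE_coeffRat_point {z : Fin N → ℂ} (hz : Function.Injective z)
    {F : MvPolynomial (Fin M) ℂ} {n : ℕ} {A : Finset (Fin M)} (h0 : 0 ∈ A) (j : Fin N)
    (h : ∀ m, m + A.card ≤ n * (A.card.choose 2 + A.card) →
      Polynomial.X ^ m ∣ scaleHom A (MvPolynomial.C (z j)) F) :
    OrderGE A (MvPolynomial.C (z j)) (-A.card) (coeffRat z F n) := by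
  classical
  have hd := (IsCenter.hasOrder_discr (Or.inr ⟨z j, rfl⟩) h0 z).pow n
  have hs : ∑ a : Fin M, ∑ i : Fin N, (if a ∈ A ∧
      (MvPolynomial.C (z j) : MvPolynomial (Fin M) ℂ) = MvPolynomial.C (z i) then 1 else 0) =
      A.card := by
    have : ∀ a : Fin M, ∑ i : Fin N, (if a ∈ A ∧
      (MvPolynomial.C (z j) : MvPolynomial (Fin M) ℂ) = MvPolynomial.C (z i) then 1 else 0) =
        if a ∈ A then 1 else 0 := by
      intro a
      by_cases ha : a ∈ A
      · simp [ha, MvPolynomial.C_inj, hz.eq_iff]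
      · simp [ha]
    rw [Finset.sum_congr rfl fun a _ => this a]
    simp
  rw [hs] at hd
  refine ⟨F, discr M z ^ n, _, by rw [toRat_pow, coeffRat],
    Submonoid.pow_mem _ (isLinearProduct_discr z) n, hd, fun m hm => h m ?_⟩
  zify
  push_cast at hm
  linarith

end Residues

/-! ### Iterated residues of square integrable forms -/

section Main

lemma residue_zero {M : ℕ} (a c : Fin M) : residue a c (0 : RatFun M) = 0 := by
  unfold residue
  split_ifs
  · have h : (0 : RatFun M) = toRat 0 / toRat 1 := by simp
    rw [mul_zero, h, restrictDiag_div (by simp)]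
    simp
  · rfl

variable {𝔤 : Type*} [LieRing 𝔤] [LieAlgebra ℂ 𝔤] [FiniteDimensional ℂ 𝔤]
  [LieAlgebra.IsSimple ℂ 𝔤] {H : LieSubalgebra ℂ 𝔤} [H.IsCartanSubalgebra]
  {b : (rootSystem H).Base} {θ : H.root} {M N : ℕ}

/-- The indices of the first `ℓ` variables. -/
def firstVars (M ℓ : ℕ) : Finset (Fin M) := Finset.univ.filter fun a => a.val < ℓ

lemma mem_firstVars {ℓ : ℕ} {a : Fin M} : a ∈ firstVars M ℓ ↔ a.val < ℓ := by
  simp [firstVars]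

lemma card_firstVars {ℓ : ℕ} (hℓ : ℓ ≤ M) : (firstVars M ℓ).card = ℓ := by
  unfold firstVars
  rw [Fin.card_filter_val_lt]
  omega

lemma firstVars_succ {ℓ : ℕ} (hℓ : ℓ < M) :
    firstVars M (ℓ + 1) = insert ⟨ℓ, hℓ⟩ (firstVars M ℓ) := by
  ext a
  simp only [mem_firstVars, Finset.mem_insert, Fin.ext_iff]
  omega

lemma weightOf_firstVars_succ (β : Fin M → b.support) {ℓ : ℕ} (hℓ : ℓ < M) :
    weightOf β (firstVars M (ℓ + 1)) =
      (rootSystem H).root (β ⟨ℓ, hℓ⟩) + weightOf β (firstVars M ℓ) := by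
  rw [firstVars_succ hℓ, weightOf, Finset.sum_insert (by simp [mem_firstVars])]
  rfl

/-- The variables of a root have half length sum at most g* - 1, and a further simple root adds at
most 1 because no root is longer than θ. -/
lemma IsHighestRoot.sum_rootLen_insert_le (hθ : IsHighestRoot H b θ) {β : Fin M → b.support}
    {A : Finset (Fin M)} {γ : H.root} (hγ : (rootSystem H).root γ = weightOf β A) {p : Fin M}
    (hp : p ∉ A) : (∑ a ∈ insert p A, rootLen H θ (β a)) / 2 ≤ dualCoxeter H b θ := by
  have h1 := hθ.half_sum_rootLen_le A β hγ
  have h2 := hθ.rootLen_le_two (β p)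
  rw [Finset.sum_insert hp]
  linarith

variable [NeZero M]

lemma OrderGE.iterRes_firstVars {c : MvPolynomial (Fin M) ℂ} (hc : IsCenter c) {ℓ : ℕ} (hℓ : 1 ≤ ℓ)
    (hℓM : ℓ ≤ M) {e : ℤ} {Q : RatFun M} (hQ : OrderGE (firstVars M ℓ) c e Q) :
    OrderGE {0} c (e + ℓ - 1) (ConfPoles.iterRes Q ℓ) := by
  obtain ⟨j, rfl⟩ : ∃ j, ℓ = j + 1 := ⟨ℓ - 1, by omega⟩
  have h := hQ.iterRes hc hℓM (fun a ha => mem_firstVars.mpr ha) j (by omega)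
  have h1 : insert 0 ((firstVars M (j + 1)).filter fun a => j < a.val) = {0} := by
    ext a
    simp only [Finset.mem_insert, Finset.mem_filter, mem_firstVars, Finset.mem_singleton]
    omega
  rw [h1] at h
  convert h using 1
  push_cast; ring

lemma OrderGE.iterRes_insert_firstVars {c : MvPolynomial (Fin M) ℂ} (hc : IsCenter c) {ℓ : ℕ}
    (hℓ : 1 ≤ ℓ) {p : Fin M} (hp : ℓ ≤ p.val) {e : ℤ} {Q : RatFun M}
    (hQ : OrderGE (insert p (firstVars M ℓ)) c e Q) :
    OrderGE {0, p} c (e + ℓ - 1) (ConfPoles.iterRes Q ℓ) := by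
  obtain ⟨j, rfl⟩ : ∃ j, ℓ = j + 1 := ⟨ℓ - 1, by omega⟩
  have h := hQ.iterRes hc (by omega) (fun a ha => Finset.mem_insert_of_mem (mem_firstVars.mpr ha)) j
    (by omega)
  have h1 : insert 0 ((insert p (firstVars M (j + 1))).filter fun a => j < a.val) = {0, p} := by
    ext a
    simp only [Finset.mem_insert, Finset.mem_filter, mem_firstVars, Finset.mem_singleton]
    constructor
    · rintro (h | ⟨h | h, h'⟩)
      · exact Or.inl h
      · exact Or.inr h
      · omega
    · rintro (h | h)
      · exact Or.inl h
      · exact Or.inr ⟨Or.inl h, by rw [h]; omega⟩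
  rw [h1] at h
  convert h using 1
  push_cast; ring

variable {κ : ℝ} {lam : Fin N → Dual ℂ H} {β : Fin M → b.support} {z : Fin N → ℂ}
  {F : MvPolynomial (Fin M) ℂ} {n n' : ℕ}

/-- Induction on ℓ: if the residue is nonzero, so is the preceding one, hence the first ℓ roots add
up to a root and the next set of variables is light. If its weight were not a root, its logarithmic
order at least 1 would turn, after ℓ residues, into positive order along no condition at all, that
is, zero. -/
theorem exists_isPos_of_iterRes_ne_zero (hθ : IsHighestRoot H b θ) (hκ : 0 < κ)
    (hκg : dualCoxeter H b θ ≤ κ) (hz : Function.Injective z) (hn : n = 2 * n') (hn' : 1 ≤ n')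
    (hsq : IsSquareIntegrable (masterAbs (normForm H θ) κ lam (simpleAt β) z) z F n)
    (hsymm : ∀ τ : Equiv.Perm (Fin M), (∀ a, β (τ a) = β a) → MvPolynomial.rename τ F = F)
    {ℓ : ℕ} (hℓ : 1 ≤ ℓ) (hℓM : ℓ ≤ M) (hres : iterRes (coeffRat z F n) ℓ ≠ 0) :
    ∃ γ : H.root, b.IsPos γ ∧ (rootSystem H).root γ = weightOf β (firstVars M ℓ) := by
  induction ℓ, hℓ using Nat.le_induction with
  | base =>
    refine ⟨β 0, RootPairing.Base.isPos_of_mem_support (β 0).2, ?_⟩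
    have : firstVars M 1 = {0} := by
      ext a
      rw [mem_firstVars, Finset.mem_singleton, Fin.ext_iff, Fin.val_zero, Nat.lt_one_iff]
    rw [this, weightOf_singleton]
  | succ ℓ hℓ ih =>
    have hℓ' : ℓ < M := hℓM
    obtain ⟨γ, hγ, hγw⟩ := ih hℓ'.le fun h0 => hres (by
      obtain ⟨j, rfl⟩ : ∃ j, ℓ = j + 1 := ⟨ℓ - 1, by omega⟩
      rw [iterRes, h0, residue_zero])
    by_contra! hcon
    refine hres ?_
    have hp : (⟨ℓ, hℓ'⟩ : Fin M) ∉ firstVars M ℓ := by simp [mem_firstVars]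
    have h1 : LogOrderGE n F (firstVars M (ℓ + 1)) 1 := by
      refine logOrderGE_one_of_not_root hκ hκg hz hn hn' hsq hsymm _
        (by rw [card_firstVars hℓM]; omega) ?_ fun γ' hγ' => ?_
      · rw [firstVars_succ hℓ']
        exact hθ.sum_rootLen_insert_le hγw hp
      · refine hcon γ' ?_ hγ'
        refine (RootPairing.Base.isPos_of_mem_support (β ⟨ℓ, hℓ'⟩).2).add hγ ?_
        rw [hγ', weightOf_firstVars_succ β hℓ', hγw]
    have h2 := (h1.orderGE_coeffRat (z := z) (mem_firstVars.mpr (by simp))).iterRes_firstVars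
      (Or.inl rfl) (by omega) hℓM
    rw [card_firstVars hℓM] at h2
    refine OrderGE.eq_zero ?_
    convert h2 using 1
    push_cast; ring

/-- Adding t_p to the variables of a root keeps the set light. Logarithmic order 0 for ℓ + 1
variables is order -ℓ, which ℓ - 1 residues raise to -1. -/
theorem atMostSimplePole_X_sub_X_iterRes (hθ : IsHighestRoot H b θ) (hκ : 0 < κ)
    (hκg : dualCoxeter H b θ ≤ κ) (hz : Function.Injective z)
    (hsq : IsSquareIntegrable (masterAbs (normForm H θ) κ lam (simpleAt β) z) z F n)
    {ℓ : ℕ} (hℓ : 1 ≤ ℓ) (hℓM : ℓ ≤ M) {γ : H.root}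
    (hγ : (rootSystem H).root γ = weightOf β (firstVars M ℓ)) {p : Fin M} (hp : ℓ ≤ p.val) :
    AtMostSimplePole (MvPolynomial.X 0 - MvPolynomial.X p) (iterRes (coeffRat z F n) ℓ) := by
  have hpn : p ∉ firstVars M ℓ := by rw [mem_firstVars]; omega
  have hcard : (insert p (firstVars M ℓ)).card = ℓ + 1 := by
    rw [Finset.card_insert_of_notMem hpn, card_firstVars hℓM]
  have h1 : LogOrderGE n F (insert p (firstVars M ℓ)) 0 :=
    hsq.logOrderGE_zero hκ hz (by omega) (lt_of_le_of_lt (neg_le_neg hκg)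
      (neg_lt_pairSum (Finset.insert_nonempty _ _) (hθ.sum_rootLen_insert_le hγ hpn)))
  have h2 := (h1.orderGE_coeffRat (z := z) (Finset.mem_insert_of_mem (mem_firstVars.mpr
    (by rw [Fin.val_zero]; omega)))).iterRes_insert_firstVars (Or.inl rfl) hℓ hp
  rw [hcard] at h2
  refine OrderGE.atMostSimplePole_X_sub_X (fun h => ?_) ?_
  · rw [h] at hp; simp at hp; omega
  · convert h2 using 1
    push_cast; ring

/-- Along t_1 = ... = t_ℓ = z_j the order of Q is at least -ℓ, and ℓ - 1 residues raise it to -1. -/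
theorem atMostSimplePole_X_sub_C_iterRes (hθ : IsHighestRoot H b θ) {k : ℕ}
    (hκg : k + dualCoxeter H b θ ≤ κ) (hz : Function.Injective z)
    (hlam : ∀ j, lam j ∈ levelWeights H b θ k)
    (hsq : IsSquareIntegrable (masterAbs (normForm H θ) κ lam (simpleAt β) z) z F n)
    {ℓ : ℕ} (hℓ : 1 ≤ ℓ) (hℓM : ℓ ≤ M) {γ : H.root}
    (hγ : (rootSystem H).root γ = weightOf β (firstVars M ℓ)) (j : Fin N) :
    AtMostSimplePole (MvPolynomial.X 0 - MvPolynomial.C (z j)) (iterRes (coeffRat z F n) ℓ) := by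
  have hg := hθ.one_le_dualCoxeter (β 0)
  have hκ : 0 < κ := by
    have : (0 : ℝ) ≤ k := Nat.cast_nonneg k
    linarith
  have h0 : (0 : Fin M) ∈ firstVars M ℓ := mem_firstVars.mpr (by rw [Fin.val_zero]; omega)
  have hcard := card_firstVars hℓM
  have h1 : OrderGE (firstVars M ℓ) (MvPolynomial.C (z j)) (-(firstVars M ℓ).card)
      (coeffRat z F n) := by
    refine orderGE_coeffRat_point hz h0 j fun m hm => ?_
    by_contra hF
    obtain _ | m := m
    · simp at hF
    have h2 := hsq.order_point hz (by omega) j hF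
    have h3 := hθ.normForm_levelWeight_le (hlam j) γ
    have h4 : ∑ a ∈ firstVars M ℓ, normForm H θ (lam j) (simpleAt β a) =
        normForm H θ (lam j) ((rootSystem H).root γ) := by
      rw [hγ, weightOf, normForm_sum_right]
    have h5 := neg_lt_pairSum ⟨0, h0⟩ (hθ.half_sum_rootLen_le (firstVars M ℓ) β hγ)
    have h6 : ((m + 1 + (firstVars M ℓ).card : ℕ) : ℝ) ≤
        ((n * ((firstVars M ℓ).card.choose 2 + (firstVars M ℓ).card) : ℕ) : ℝ) := by
      exact_mod_cast hm
    -- (λ_j, γ) ≤ k and the pair sum is greater than -(g* - 1), so their difference is less than κ.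
    have h7 : (∑ a ∈ firstVars M ℓ, normForm H θ (lam j) (simpleAt β a)) / κ ≤
        pairSum (normForm H θ) (simpleAt β) (firstVars M ℓ) / κ + 1 := by
      rw [div_add_one hκ.ne', h4]
      gcongr
      linarith
    rw [Nat.cast_mul] at h6
    push_cast at h6 h2
    linarith
  have h2 := h1.iterRes_firstVars (Or.inr ⟨_, rfl⟩) hℓ hℓM
  rw [hcard] at h2
  refine OrderGE.atMostSimplePole_X_sub_C ?_
  convert h2 using 1
  ring

end Main

end ConfPoles

theorem theorem7p2 {𝔤 : Type*} [LieRing 𝔤] [LieAlgebra ℂ 𝔤] [FiniteDimensional ℂ 𝔤]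
    [LieAlgebra.IsSimple ℂ 𝔤] (H : LieSubalgebra ℂ 𝔤) [H.IsCartanSubalgebra]
    (b : (rootSystem H).Base) (hg : ConfPoles.IsClassicalOrG2 H b)
    (θ : H.root) (hθ : ConfPoles.IsHighestRoot H b θ)
    (k : ℕ) {N M : ℕ} [NeZero M]
    (z : Fin N → ℂ) (hz : Function.Injective z)
    (lam : Fin N → Dual ℂ H) (hlam : ∀ j, lam j ∈ ConfPoles.levelWeights H b θ k)
    (β : Fin M → b.support)
    (hμ : ∑ j, lam j = ∑ a, (rootSystem H).root (β a))
    (F : MvPolynomial (Fin M) ℂ) (n : ℕ)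
    (hsymm : ∀ σ : Equiv.Perm (Fin M), (∀ a, β (σ a) = β a) →
      ∀ t ∈ ConfPoles.confSpace M z,
        ConfPoles.coeffFun z F n (t ∘ σ) = ConfPoles.coeffFun z F n t)
    (hsq : ConfPoles.IsSquareIntegrable
      (ConfPoles.masterAbs (ConfPoles.normForm H θ) (k + ConfPoles.dualCoxeter H b θ) lam
        (fun a => (rootSystem H).root (β a)) z) z F n)
    (ℓ : ℕ) (hℓ : 1 ≤ ℓ) (hℓM : ℓ ≤ M)
    (hres : ConfPoles.iterRes (ConfPoles.coeffRat z F n) ℓ ≠ 0) :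
    (∃ γ : H.root, b.IsPos γ ∧
      (rootSystem H).root γ = ∑ a : Fin M with a.val < ℓ, (rootSystem H).root (β a)) ∧
    (∀ p : Fin M, ℓ ≤ p.val →
      ConfPoles.AtMostSimplePole (MvPolynomial.X 0 - MvPolynomial.X p)
        (ConfPoles.iterRes (ConfPoles.coeffRat z F n) ℓ)) ∧
    ∀ j : Fin N,
      ConfPoles.AtMostSimplePole (MvPolynomial.X 0 - MvPolynomial.C (z j))
        (ConfPoles.iterRes (ConfPoles.coeffRat z F n) ℓ) := by
  have hg1 := hθ.one_le_dualCoxeter (β 0)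
  have hk0 : (0 : ℝ) ≤ k := Nat.cast_nonneg k
  -- Q is rewritten with the denominator exponent n + (n + 2) = 2(n + 1), even and positive, so that
  -- the numerator itself becomes a symmetric polynomial.
  have hsq' := hsq.mul_discr_pow (n + 2)
  have hsymm' : ∀ τ : Equiv.Perm (Fin M), (∀ a, β (τ a) = β a) →
      MvPolynomial.rename τ (F * ConfPoles.discr M z ^ (n + 2)) =
        F * ConfPoles.discr M z ^ (n + 2) :=
    fun τ hτ => ConfPoles.rename_mul_discr_pow (hsymm τ hτ)
  rw [← ConfPoles.coeffRat_mul_discr_pow z F n (n + 2)] at hres ⊢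
  obtain ⟨γ, hγ, hγw⟩ := ConfPoles.exists_isPos_of_iterRes_ne_zero (n' := n + 1) hθ (by linarith)
    (by linarith) hz (by ring) (by omega) hsq' hsymm' hℓ hℓM hres
  exact ⟨⟨γ, hγ, hγw⟩,
    fun p hp => ConfPoles.atMostSimplePole_X_sub_X_iterRes hθ (by linarith) (by linarith) hz hsq'
      hℓ hℓM hγw hp,
    fun j => ConfPoles.atMostSimplePole_X_sub_C_iterRes hθ le_rfl hz hlam hsq' hℓ hℓM hγw j⟩
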